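/- Let $n\ge 1$ and let $f_n(z)=\sum_{j=0}^n a_j\sqrt{\binom nj}\,z^j$, where $a_0,\dots,a_n$ are i.i.d. standard complex Gaussians (density $\pi^{-1}e^{-|z|^2}$). Put $$\widehat f_n(z)=\frac{f_n(z)}{(1+|z|^2)^{n/2}},\qquad D\widehat f_n(z)=\frac{f_n'(z)}{\sqrt n\,(1+|z|^2)^{n/2-1}},\qquad d_{\mathbb S^2}(z,w)=\frac{2|z-w|}{\sqrt{1+|z|^2}\sqrt{1+|w|^2}}.$$ For finite families $\mathbf w=(w_t)_{t=1}^{\ell}$ and $\mathbf z=(z_j)_{j=1}^{m}$ of complex numbers and exponents $p=(p_1,\dots,p_m)\in\mathbb Z_{\ge0}^m$ let $$\rho_{\ell,m,p}(\mathbf w,\mathbf z)=\frac{n^{\ell+m}}{\det\big[\mathrm{Cov}(\widehat f_n(z_j))_{j=1}^m\big]}\;\mathbb E\Big[\prod_{t=1}^{\ell}\log|\widehat f_n(w_t)|\prod_{j=1}^{m}\big(\log^{p_j}|D\widehat f_n(z_j)|\,|D\widehat f_n(z_j)|^2\big)\,\Big|\,f_n(z_j)=0\ \forall j\Big],$$ where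 the conditional law is the Gaussian one: given the linear conditions $f_n(z_j)=0$, the coefficient vector $(a_0,\dots,a_n)$ has the standard complex Gaussian law on the subspace of $\mathbb C^{n+1}$ that they define. Empty products are $1$. **Theorem.** Let $\ell\ge0$ and $m\ge1$. There are constants $D,c>0$ depending only on $\ell,m$, and for every $p\in\mathbb Z_{\ge0}^m$ a constant $C>0$ depending only on $\ell,m,p$, such that the following holds for all $n\ge1$. Let $w_1,\dots,w_\ell,z_1,\dots,z_m$ be pairwise distinct complex numbers, and let $[\ell]=I'\sqcup J'$, $[m]=I\sqcup J$ be partitions such that each of the two groups of points $(\mathbf w_{I'},\mathbf z_I)$ and $(\mathbf w_{J'},\mathbf z_J)$ is non-empty (in particular, $\ell=0$ is allowed). Let $d$ be the minimum of $d_{\mathbb S^2}(x/\sqrt n,y/\sqrt n)$ over the points $x$ of the first and $y$ of the second group. If $d\ge D/\sqrt n$, then $$\Big|\rho_{\ell,m,p}\Big(\tfrac{\mathbf w}{\sqrt n},\tfrac{\mathbf z}{\sqrt n}\Big)-\rho_{|I'|,|I|,p_I}\Big(\tfrac{\mathbf w_{I'}}{\sqrt n},\tfrac{\mathbf z_I}{\sqrt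 n}\Big)\,\rho_{|J'|,|J|,p_J}\Big(\tfrac{\mathbf w_{J'}}{\sqrt n},\tfrac{\mathbf z_J}{\sqrt n}\Big)\Big|\le C\,n^{\ell+m}\Big(\prod_{t=1}^{\ell}|\log\Delta'_t|\Big)e^{-cnd^2},$$ where $$\Delta'_t=\prod_{j=1}^m\min\Big\{n\,d_{\mathbb S^2}\Big(\tfrac{w_t}{\sqrt n},\tfrac{z_j}{\sqrt n}\Big)^2,\ \tfrac12\Big\}.$$ -/

import Mathlib

noncomputable section

namespace KacRice

open MeasureTheory

/-- The law of a standard complex Gaussian: density `π⁻¹ exp(-|z|²)` with respect to Lebesgue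
measure on `ℂ`. -/
def stdComplexGaussian : Measure ℂ :=
  (volume : Measure ℂ).withDensity (fun z => ENNReal.ofReal (Real.pi⁻¹ * Real.exp (-‖z‖ ^ 2)))

/-- The space of coefficient vectors `(a_0, …, a_n)`, with its Hermitian inner product. -/
abbrev Coeff (n : ℕ) : Type := EuclideanSpace ℂ (Fin (n + 1))

/-- The law of `(a_0, …, a_n)` for i.i.d. standard complex Gaussians `a_j`. -/
def coeffLaw (n : ℕ) : Measure (Coeff n) :=
  (Measure.pi (fun _ : Fin (n + 1) => stdComplexGaussian)).map (WithLp.toLp 2)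

/-- The elliptic polynomial `f_n(z) = ∑_j a_j √(n choose j) z^j` with coefficient vector `a`. -/
def poly (n : ℕ) (a : Coeff n) (z : ℂ) : ℂ :=
  ∑ j : Fin (n + 1), a j * (Real.sqrt (n.choose (j : ℕ)) : ℂ) * z ^ (j : ℕ)

/-- `f̂_n(z) = f_n(z) / (1 + |z|²)^{n/2}`. -/
def hatPoly (n : ℕ) (a : Coeff n) (z : ℂ) : ℂ :=
  poly n a z / (((1 + ‖z‖ ^ 2) ^ ((n : ℝ) / 2) : ℝ) : ℂ)

/-- `D f̂_n(z) = f_n'(z) / (√n (1 + |z|²)^{n/2 - 1})`. -/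
def hatDeriv (n : ℕ) (a : Coeff n) (z : ℂ) : ℂ :=
  deriv (poly n a) z / ((Real.sqrt n * (1 + ‖z‖ ^ 2) ^ ((n : ℝ) / 2 - 1) : ℝ) : ℂ)

/-- The coefficient vectors for which `f_n(z_j) = 0` for all `j`. -/
def vanishing (n : ℕ) {κ : Type} (z : κ → ℂ) : Submodule ℂ (Coeff n) where
  carrier := {a | ∀ j, poly n a (z j) = 0}
  zero_mem' := by intro j; simp [poly]
  add_mem' := by
    intro a b ha hb j
    have h : poly n (a + b) (z j) = poly n a (z j) + poly n b (z j) := by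
      simp [poly, add_mul, Finset.sum_add_distrib]
    rw [h, ha j, hb j, add_zero]
  smul_mem' := by
    intro c a ha j
    have h : poly n (c • a) (z j) = c * poly n a (z j) := by
      simp [poly, Finset.mul_sum, mul_assoc]
    rw [h, ha j, mul_zero]

/-- The conditional law of the Gaussian vector `(a_0, …, a_n)` given `f_n(z_j) = 0` for all `j`:
the standard Gaussian law on the linear subspace which the (linear) conditions cut out, that is,
the law of the orthogonal projection of `(a_0, …, a_n)` to it. See `coeffLaw_disintegration`: the
law of `P a + v`, for the `v` orthogonal to the subspace with prescribed values `f_n(z_j)`, is a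
regular conditional law of the coefficients given the values `f_n(z_j)`; it depends continuously
on these values, and at the values `0` it is this one. -/
def condLaw (n : ℕ) {κ : Type} (z : κ → ℂ) : Measure (Coeff n) :=
  (coeffLaw n).map (fun a => (vanishing n z).starProjection a)

/-- `Λ(w, z) = E[∏_t log|f̂_n(w_t)| ∏_j (log^{p_j}|D f̂_n(z_j)| |D f̂_n(z_j)|²) | f_n(z_j) = 0 ∀ j]`.
The points are indexed by arbitrary finite types, so that subfamilies need no relabelling. -/
def condMoment (n : ℕ) {ι κ : Type} [Fintype ι] [Fintype κ]
    (p : κ → ℕ) (w : ι → ℂ) (z : κ → ℂ) : ℝ :=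
  ∫ a, (∏ t, Real.log ‖hatPoly n a (w t)‖) *
    ∏ j, (Real.log ‖hatDeriv n a (z j)‖ ^ p j * ‖hatDeriv n a (z j)‖ ^ 2) ∂(condLaw n z)

/-- The covariance matrix of the complex random vector `(f̂_n(z_j))_j`, with entries
`E[(X_i - E X_i) conj (X_j - E X_j)]`. -/
def covHat (n : ℕ) {κ : Type} (z : κ → ℂ) : Matrix κ κ ℂ :=
  Matrix.of fun i j => ∫ a, (hatPoly n a (z i) - ∫ b, hatPoly n b (z i) ∂(coeffLaw n)) *
    (starRingEnd ℂ) (hatPoly n a (z j) - ∫ b, hatPoly n b (z j) ∂(coeffLaw n)) ∂(coeffLaw n)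

/-- The Kac–Rice density `ρ_{ℓ,m,p}(w, z) = n^{ℓ+m} Λ(w, z) / det Cov (f̂_n(z_j))_j`, where `ℓ` and
`m` are the numbers of points of `w` and of `z`. The determinant of a covariance matrix is real;
`.re` only changes its type. -/
def density (n : ℕ) {ι κ : Type} [Fintype ι] [Fintype κ] [DecidableEq κ]
    (p : κ → ℕ) (w : ι → ℂ) (z : κ → ℂ) : ℝ :=
  (n : ℝ) ^ (Fintype.card ι + Fintype.card κ) * (condMoment n p w z / (covHat n z).det.re)

/-- The spherical (chordal) distance on `ℂ`. -/
def sphDist (z w : ℂ) : ℝ :=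
  2 * ‖z - w‖ / (Real.sqrt (1 + ‖z‖ ^ 2) * Real.sqrt (1 + ‖w‖ ^ 2))

/-- The spherical distance between two finite nonempty families of points: the minimum of the
pairwise distances. -/
def familyDist {α β : Type} (x : α → ℂ) (y : β → ℂ) : ℝ :=
  ⨅ q : α × β, sphDist (x q.1) (y q.2)

/-- The rescaled family `x / √n`. -/
def scaled (n : ℕ) {α : Type} (x : α → ℂ) : α → ℂ := fun i => x i / (Real.sqrt n : ℂ)

/-- The subfamily of `x` with indices in `s`. -/
def sub {α : Type} (x : α → ℂ) (s : Finset α) : s → ℂ := fun i => x i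

/-- The density of the subfamilies `w_{I'}/√n`, `z_I/√n`, with exponents `p_I`. -/
def subDensity (n : ℕ) {ι κ : Type} [DecidableEq κ]
    (p : κ → ℕ) (w : ι → ℂ) (z : κ → ℂ) (I' : Finset ι) (I : Finset κ) : ℝ :=
  density n (fun j : I => p j) (sub (scaled n w) I') (sub (scaled n z) I)

/-- The spherical distance between the groups of points `(w_{I'}/√n, z_I/√n)` and
`(w_{J'}/√n, z_J/√n)`. -/
def groupDist (n : ℕ) {ι κ : Type} (w : ι → ℂ) (z : κ → ℂ)
    (I' J' : Finset ι) (I J : Finset κ) : ℝ :=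
  familyDist (Sum.elim (sub (scaled n w) I') (sub (scaled n z) I))
    (Sum.elim (sub (scaled n w) J') (sub (scaled n z) J))

/-- `Δ'_t = ∏_j min {n d(w_t/√n, z_j/√n)², 1/2}`, with `d` the spherical distance. -/
def deltaPrime (n : ℕ) {ι κ : Type} [Fintype κ] (w : ι → ℂ) (z : κ → ℂ) (t : ι) : ℝ :=
  ∏ j, min ((n : ℝ) * sphDist (scaled n w t) (scaled n z j) ^ 2) (1 / 2)

theorem integral_gaussianDensity : ∫ z : ℂ, Real.pi⁻¹ * Real.exp (-‖z‖ ^ 2) = 1 := by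
  rw [integral_const_mul]
  have h := GaussianFourier.integral_rexp_neg_mul_sq_norm (V := ℂ) (b := 1) one_pos
  simp only [neg_mul, one_mul, Complex.finrank_real_complex] at h
  rw [h]
  norm_num [Real.pi_ne_zero]

theorem integrable_gaussianDensity :
    Integrable (fun z : ℂ => Real.pi⁻¹ * Real.exp (-‖z‖ ^ 2)) := by
  by_contra h
  have := integral_undef h
  rw [integral_gaussianDensity] at this
  exact one_ne_zero this

instance : IsProbabilityMeasure stdComplexGaussian := by
  refine ⟨?_⟩
  rw [stdComplexGaussian, withDensity_apply _ MeasurableSet.univ, Measure.restrict_univ,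
    ← ofReal_integral_eq_lintegral_ofReal integrable_gaussianDensity
      (Filter.Eventually.of_forall fun z => by positivity), integral_gaussianDensity]
  simp

theorem pi_stdComplexGaussian (k : ℕ) :
    Measure.pi (fun _ : Fin k => stdComplexGaussian) =
      (volume : Measure (Fin k → ℂ)).withDensity
        (fun x => ENNReal.ofReal (∏ i, (Real.pi⁻¹ * Real.exp (-‖x i‖ ^ 2)))) := by
  refine Measure.pi_eq fun s hs => ?_
  rw [withDensity_apply _ (MeasurableSet.univ_pi hs), volume_pi, Measure.restrict_pi_pi,
    ← ofReal_integral_eq_lintegral_ofReal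
      (Integrable.fintype_prod (f := fun _ (z : ℂ) => Real.pi⁻¹ * Real.exp (-‖z‖ ^ 2))
        fun i => integrable_gaussianDensity.restrict)
      (Filter.Eventually.of_forall fun z => by positivity),
    integral_fintype_prod_eq_prod (fun _ (z : ℂ) => Real.pi⁻¹ * Real.exp (-‖z‖ ^ 2)),
    ENNReal.ofReal_prod_of_nonneg fun i _ => integral_nonneg fun z => by positivity]
  refine Finset.prod_congr rfl fun i _ => ?_
  rw [stdComplexGaussian, withDensity_apply _ (hs i),
    ofReal_integral_eq_lintegral_ofReal integrable_gaussianDensity.restrict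
      (Filter.Eventually.of_forall fun z => by positivity)]

/-- Lebesgue measure on the coefficient space. -/
def coeffVolume (n : ℕ) : Measure (Coeff n) :=
  (volume : Measure (Fin (n + 1) → ℂ)).map (WithLp.toLp 2)

instance (n : ℕ) : (coeffVolume n).IsAddHaarMeasure :=
  (PiLp.continuousLinearEquiv 2 ℝ (fun _ : Fin (n + 1) => ℂ)).symm.isAddHaarMeasure_map _

theorem coeffLaw_eq (n : ℕ) :
    coeffLaw n = (coeffVolume n).withDensity
      (fun a => ENNReal.ofReal (Real.pi⁻¹ ^ (n + 1) * Real.exp (-‖a‖ ^ 2))) := by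
  have hm : Measurable (WithLp.toLp 2 : (Fin (n + 1) → ℂ) → Coeff n) := by fun_prop
  ext s hs
  rw [coeffLaw, coeffVolume, Measure.map_apply hm hs, withDensity_apply _ hs,
    setLIntegral_map hs (by fun_prop) hm, pi_stdComplexGaussian, withDensity_apply _ (hm hs)]
  refine lintegral_congr fun x => ?_
  rw [Finset.prod_mul_distrib, ← Real.exp_sum, EuclideanSpace.norm_sq_eq]
  simp

instance (n : ℕ) : IsProbabilityMeasure (coeffLaw n) :=
  Measure.isProbabilityMeasure_map (by fun_prop)

/-- If `a`, `b` are independent with law `coeffLaw n` and `P` is an orthogonal projection, then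
`P a + (b - P b)` has law `coeffLaw n`. -/
theorem coeffLaw_projection (n : ℕ) (V : Submodule ℂ (Coeff n)) :
    ((coeffLaw n).prod (coeffLaw n)).map
      (fun q => V.starProjection q.1 + (q.2 - V.starProjection q.2)) = coeffLaw n := by
  set P : Coeff n →ₗ[ℝ] Coeff n := (V.starProjection : Coeff n →ₗ[ℂ] Coeff n).restrictScalars ℝ
    with hP
  have hPP : ∀ x, P (P x) = P x := fun x => by
    simp [hP, Submodule.starProjection_eq_self_iff]
  set T : (Coeff n × Coeff n) →ₗ[ℝ] (Coeff n × Coeff n) :=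
    (P ∘ₗ LinearMap.fst ℝ _ _ + (LinearMap.id - P) ∘ₗ LinearMap.snd ℝ _ _).prod
      ((LinearMap.id - P) ∘ₗ LinearMap.fst ℝ _ _ + P ∘ₗ LinearMap.snd ℝ _ _) with hT
  have hT1 : ∀ q, (T q).1 = P q.1 + (q.2 - P q.2) := fun q => by simp [hT]
  have hT2 : ∀ q, (T q).2 = (q.1 - P q.1) + P q.2 := fun q => by simp [hT]
  have hTT : T ∘ₗ T = LinearMap.id := by
    refine LinearMap.ext fun q => Prod.ext ?_ ?_
    · rw [LinearMap.comp_apply, hT1, hT1, hT2]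
      simp only [map_add, map_sub, hPP, LinearMap.id_apply]
      abel
    · rw [LinearMap.comp_apply, hT2, hT1, hT2]
      simp only [map_add, map_sub, hPP, LinearMap.id_apply]
      abel
  have hdet : LinearMap.det T * LinearMap.det T = 1 := by
    rw [← LinearMap.det_comp, hTT, LinearMap.det_id]
  have hne : LinearMap.det T ≠ 0 := fun h => by simp [h] at hdet
  have habs : |(LinearMap.det T)⁻¹| = 1 := by
    rcases mul_self_eq_one_iff.mp hdet with h | h <;> simp [h]
  have hmT : Measurable T := T.continuous_of_finiteDimensional.measurable
  have hmap : ((coeffVolume n).prod (coeffVolume n)).map T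
      = (coeffVolume n).prod (coeffVolume n) := by
    have : SigmaFinite (coeffVolume n) := inferInstance
    have : MeasurableAdd (Coeff n) := inferInstance
    have : ((coeffVolume n).prod (coeffVolume n)).IsAddHaarMeasure :=
      Measure.prod.instIsAddHaarMeasure _ _
    rw [Measure.map_linearMap_addHaar_eq_smul_addHaar _ hne, habs]
    simp
  have pyth : ∀ x y, ‖P x + (y - P y)‖ ^ 2 = ‖P x‖ ^ 2 + ‖y - P y‖ ^ 2 := fun x y => by
    have h0 : inner ℂ (P x) (y - P y) = 0 := by
      have hx : P x ∈ V := V.starProjection_apply_mem x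
      exact V.sub_starProjection_mem_orthogonal y _ hx
    have := norm_add_sq_eq_norm_sq_add_norm_sq_of_inner_eq_zero (𝕜 := ℂ) _ _ h0
    nlinarith [this]
  have hnorm : ∀ q, ‖(T q).1‖ ^ 2 + ‖(T q).2‖ ^ 2 = ‖q.1‖ ^ 2 + ‖q.2‖ ^ 2 := fun q => by
    have h1 := pyth q.1 q.1
    have h2 := pyth q.2 q.2
    rw [add_sub_cancel] at h1 h2
    rw [hT1, hT2, add_comm (q.1 - P q.1), pyth, pyth, h1, h2]
    ring
  have hinv : ((coeffLaw n).prod (coeffLaw n)).map T = (coeffLaw n).prod (coeffLaw n) := by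
    rw [coeffLaw_eq, prod_withDensity (by fun_prop) (by fun_prop)]
    ext s hs
    rw [Measure.map_apply hmT hs, withDensity_apply _ (hmT hs), withDensity_apply _ hs]
    nth_rw 2 [← hmap]
    rw [setLIntegral_map hs (by fun_prop) hmT]
    refine lintegral_congr fun q => ?_
    rw [← ENNReal.ofReal_mul (by positivity), ← ENNReal.ofReal_mul (by positivity)]
    congr 1
    have e : ∀ x y : Coeff n, Real.pi⁻¹ ^ (n + 1) * Real.exp (-‖x‖ ^ 2) *
        (Real.pi⁻¹ ^ (n + 1) * Real.exp (-‖y‖ ^ 2)) =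
        Real.pi⁻¹ ^ (n + 1) * Real.pi⁻¹ ^ (n + 1) * Real.exp (-(‖x‖ ^ 2 + ‖y‖ ^ 2)) :=
      fun x y => by rw [neg_add, Real.exp_add]; ring
    rw [e, e, hnorm]
  calc ((coeffLaw n).prod (coeffLaw n)).map
        (fun q => V.starProjection q.1 + (q.2 - V.starProjection q.2))
      = (((coeffLaw n).prod (coeffLaw n)).map T).map Prod.fst := by
        rw [Measure.map_map measurable_fst hmT]
        congr 1
    _ = coeffLaw n := by rw [hinv, Measure.map_fst_prod, measure_univ, one_smul]

theorem poly_add (n : ℕ) (a b : Coeff n) (z : ℂ) : poly n (a + b) z = poly n a z + poly n b z := by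
  simp [poly, add_mul, Finset.sum_add_distrib]

/-- The conditional law, as a disintegration of the law of the coefficients over the values
`f_n(z_j)`: given these values, the coefficient vector is `P a + v`, where `P a` has law `condLaw`
and `v`, the component of the coefficient vector orthogonal to `vanishing n z`, is determined
linearly by the values. -/
theorem coeffLaw_disintegration (n : ℕ) {κ : Type} [Fintype κ] (z : κ → ℂ)
    (G : (κ → ℂ) × Coeff n → ENNReal) (hG : Measurable G) :
    ∫⁻ a, G (fun j => poly n a (z j), a) ∂(coeffLaw n) =
      ∫⁻ b, ∫⁻ a, G (fun j => poly n b (z j), a + (b - (vanishing n z).starProjection b))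
        ∂(condLaw n z) ∂(coeffLaw n) := by
  have hp : ∀ z, Measurable fun a : Coeff n => poly n a z := fun z => by
    unfold poly; fun_prop
  have hP : Measurable (vanishing n z).starProjection :=
    (vanishing n z).starProjection.continuous.measurable
  have hF : Measurable fun a : Coeff n => G (fun j => poly n a (z j), a) :=
    hG.comp ((measurable_pi_lambda _ fun j => hp (z j)).prodMk measurable_id)
  have hM : Measurable fun q : Coeff n × Coeff n => (vanishing n z).starProjection q.1 +
      (q.2 - (vanishing n z).starProjection q.2) := by fun_prop
  have hval : ∀ (a b : Coeff n) (j : κ), poly n ((vanishing n z).starProjection a +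
      (b - (vanishing n z).starProjection b)) (z j) = poly n b (z j) := fun a b j => by
    have h1 : poly n ((vanishing n z).starProjection a) (z j) = 0 :=
      (vanishing n z).starProjection_apply_mem a j
    have h2 : poly n ((vanishing n z).starProjection b) (z j) = 0 :=
      (vanishing n z).starProjection_apply_mem b j
    have h3 := poly_add n ((vanishing n z).starProjection b)
      (b - (vanishing n z).starProjection b) (z j)
    rw [add_sub_cancel, h2, zero_add] at h3
    rw [poly_add, h1, zero_add, ← h3]
  nth_rw 1 [← coeffLaw_projection n (vanishing n z)]
  rw [lintegral_map hF hM]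
  refine (lintegral_prod_symm _ (hF.comp hM).aemeasurable).trans ?_
  refine lintegral_congr fun b => ?_
  rw [condLaw, lintegral_map _ hP]
  · refine lintegral_congr fun a => ?_
    simp only [Function.comp_apply, hval]
  · exact hG.comp (by fun_prop)

end KacRice

end

noncomputable section

namespace KacRice

open MeasureTheory

/-! ### The Gaussian measure on the coefficient space -/

/-! All variables are linear functionals of one standard Gaussian vector: `f̂_n(z)` is the inner
product with the unit vector `evalVec n z`, and `D f̂_n(z)` that with `derivVec n z`. Since
orthogonal projections are self-adjoint, conditioning on `f_n(z_j) = 0` means projecting these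
vectors off the span of the `evalVec n (z j)`, and the covariance determinant is the Gram
determinant of that family. Orthogonal vectors give independent variables, so the theorem asserts
that two separated groups are almost orthogonal, in a sense robust enough for logarithms and for
colliding points.

The geometric core is `exists_almost_orthogonal_jetSpan`: the spans of the value and derivative
vectors at the two groups satisfy `|⟨g, h⟩| ≤ ε ‖g‖ ‖h‖` with `ε = C exp(-c n d²)`, however close
points within one group are. Decay of the kernel alone does not give this, because the Gram matrix
of one group may be nearly singular. Instead, `exists_interpolation` replaces `h` by a vector with
the same values on a group, whose norm is controlled by the size of `h` on disks of radius `2/√n`.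
It matches an upper bound from Schwarz's lemma (`norm_inner_evalVec_le_of_vanishing`) with an
extremal vector built from products by Bombieri's inequality (`exists_vanishing`); both are products
of truncated distances. Derivatives are reached as limits of differences.

On the probabilistic side, after normalization each factor is a function of a Gaussian variable of
variance of order one, with a weak singularity at `0`, cubic growth and a Hölder estimate
(`TameFunction`). Expectations of products of at most `N` such functions are Hölder continuous in
the vectors with exponent `1/(N+1)` (`exists_perturbation_bound`), so making the groups exactly
orthogonal costs a power of `ε` (`exists_decoupling_bound`).

The normalizing factors must be paid for. A logarithm is divided by `|log Δ'_t|`, which dominates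
the logarithm of the conditional standard deviation. A derivative gives up one of its two powers of
the conditional standard deviation; `exists_prod_norm_derivVec_le` bounds the product of these by
the Gram determinant in the denominator, while the other power absorbs the logarithms. Finally
`gramDet_union` factors the determinant up to a relative error of order `ε`. -/

theorem coeffVolume_map_isometry (n : ℕ) (U : Coeff n ≃ₗᵢ[ℂ] Coeff n) :
    (coeffVolume n).map U = coeffVolume n := by
  set f : Coeff n →ₗ[ℝ] Coeff n := (U.toLinearEquiv : Coeff n →ₗ[ℂ] Coeff n).restrictScalars ℝ
    with hf
  have hdet : LinearMap.det f ≠ 0 := by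
    have : IsUnit (LinearMap.det f) := by
      have h : f = ((U.toLinearEquiv.restrictScalars ℝ : Coeff n ≃ₗ[ℝ] Coeff n) :
        Coeff n →ₗ[ℝ] Coeff n) := rfl
      rw [h]
      exact LinearEquiv.isUnit_det' _
    exact this.ne_zero
  have h := Measure.map_linearMap_addHaar_eq_smul_addHaar (coeffVolume n) hdet
  have hfU : (f : Coeff n → Coeff n) = U := rfl
  rw [hfU] at h
  -- The image measure is a multiple of Lebesgue measure; the invariance of the unit ball shows that
  -- the multiple is 1.
  have hball : (coeffVolume n).map U (Metric.ball 0 1) = coeffVolume n (Metric.ball 0 1) := by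
    rw [Measure.map_apply U.continuous.measurable Metric.isOpen_ball.measurableSet]
    congr 1
    have := U.toIsometryEquiv.preimage_ball 0 1
    rw [← U.toIsometryEquiv.apply_symm_apply (0 : Coeff n)] at this
    ext x
    simp
  have hpos : coeffVolume n (Metric.ball 0 1) ≠ 0 := (Metric.measure_ball_pos _ _ one_pos).ne'
  have hfin : coeffVolume n (Metric.ball 0 1) ≠ ⊤ := measure_ball_lt_top.ne
  rw [h, Measure.smul_apply, smul_eq_mul] at hball
  have hone : ENNReal.ofReal |(LinearMap.det f)⁻¹| = 1 := by
    have := (ENNReal.mul_eq_right hpos hfin).mp hball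
    exact this
  rw [h, hone, one_smul]

theorem coeffLaw_map_isometry (n : ℕ) (U : Coeff n ≃ₗᵢ[ℂ] Coeff n) :
    (coeffLaw n).map U = coeffLaw n := by
  have hU : Measurable U := U.continuous.measurable
  rw [coeffLaw_eq]
  ext s hs
  rw [Measure.map_apply hU hs, withDensity_apply _ (hU hs), withDensity_apply _ hs]
  nth_rw 2 [← coeffVolume_map_isometry n U]
  rw [setLIntegral_map hs (by fun_prop) hU]
  simp

theorem map_coord_coeffLaw (n : ℕ) (i : Fin (n + 1)) :
    (coeffLaw n).map (fun a => a i) = stdComplexGaussian := by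
  rw [coeffLaw, Measure.map_map (by fun_prop) (by fun_prop)]
  exact (measurePreserving_eval (fun _ : Fin (n + 1) => stdComplexGaussian) i).map_eq

/-- A linear functional of norm one is a standard complex Gaussian. -/
theorem map_inner_coeffLaw (n : ℕ) (v : Coeff n) (hv : ‖v‖ = 1) :
    (coeffLaw n).map (fun a => inner ℂ v a) = stdComplexGaussian := by
  have hon : Orthonormal ℂ (Set.domRestrict ({0} : Set (Fin (n + 1))) (fun _ => v)) := by
    constructor
    · intro i; exact hv
    · rintro ⟨i, hi⟩ ⟨j, hj⟩ hij
      simp only [Set.mem_singleton_iff] at hi hj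
      subst hi; subst hj
      exact absurd rfl hij
  obtain ⟨b, hb⟩ := hon.exists_orthonormalBasis_extension_of_card_eq
    (by simp) (v := fun _ => v)
  have hb0 : b 0 = v := hb 0 rfl
  have hU := coeffLaw_map_isometry n b.repr
  have : (fun a : Coeff n => inner ℂ v a) = (fun a : Coeff n => a 0) ∘ b.repr := by
    ext a
    simp [b.repr_apply_apply, hb0]
  rw [this, ← Measure.map_map (by fun_prop) b.repr.continuous.measurable, hU,
    map_coord_coeffLaw]

theorem integrable_norm_rpow_stdComplexGaussian {q : ℝ} (hq : -2 < q) :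
    Integrable (fun z : ℂ => ‖z‖ ^ q) stdComplexGaussian ∧
      ∫ z, ‖z‖ ^ q ∂stdComplexGaussian = Real.Gamma (q / 2 + 1) := by
  have h := Complex.integral_rpow_mul_exp_neg_rpow (p := 2) (q := q) (by norm_num) hq
  have h' : ∫ z : ℂ, (Real.pi⁻¹ * Real.exp (-‖z‖ ^ 2)) * ‖z‖ ^ q = Real.Gamma (q / 2 + 1) := by
    have e : (fun z : ℂ => (Real.pi⁻¹ * Real.exp (-‖z‖ ^ 2)) * ‖z‖ ^ q)
      = fun z : ℂ => Real.pi⁻¹ * (‖z‖ ^ q * Real.exp (-‖z‖ ^ (2 : ℝ))) := by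
      ext z
      rw [Real.rpow_two]; ring
    rw [e, integral_const_mul, h]
    field_simp
  have hpos : 0 < Real.Gamma (q / 2 + 1) := Real.Gamma_pos_of_pos (by linarith)
  -- A nonintegrable function has integral 0 by convention, whereas the value just found is
  -- positive.
  have hint : Integrable (fun z : ℂ => (Real.pi⁻¹ * Real.exp (-‖z‖ ^ 2)) * ‖z‖ ^ q) := by
    by_contra hc
    rw [integral_undef hc] at h'
    exact hpos.ne h'
  have hm : Measurable fun z : ℂ => ENNReal.ofReal (Real.pi⁻¹ * Real.exp (-‖z‖ ^ 2)) := by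
    fun_prop
  constructor
  · rw [stdComplexGaussian, integrable_withDensity_iff hm (by simp)]
    refine hint.congr (Filter.Eventually.of_forall fun z => ?_)
    simp only
    rw [ENNReal.toReal_ofReal (by positivity), mul_comm]
  · rw [stdComplexGaussian, integral_withDensity_eq_integral_toReal_smul hm (by simp), ← h']
    refine integral_congr_ae (Filter.Eventually.of_forall fun z => ?_)
    simp only
    rw [ENNReal.toReal_ofReal (by positivity), smul_eq_mul]

theorem measurable_inner_coeff (n : ℕ) (v : Coeff n) :
    Measurable (fun a : Coeff n => inner ℂ v a) := by
  fun_prop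

theorem integral_norm_inner_rpow (n : ℕ) (v : Coeff n) (hv : v ≠ 0) {q : ℝ} (hq : -2 < q) :
    Integrable (fun a : Coeff n => ‖inner ℂ v a‖ ^ q) (coeffLaw n) ∧
      ∫ a, ‖inner ℂ v a‖ ^ q ∂(coeffLaw n) = ‖v‖ ^ q * Real.Gamma (q / 2 + 1) := by
  have hv' : 0 < ‖v‖ := norm_pos_iff.mpr hv
  set u : Coeff n := ((‖v‖ : ℂ)⁻¹) • v with hu
  have hu1 : ‖u‖ = 1 := by
    rw [hu, norm_smul, norm_inv, Complex.norm_real, norm_norm, inv_mul_cancel₀ hv'.ne']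
  have hvu : v = (‖v‖ : ℂ) • u := by
    rw [hu, smul_smul, mul_inv_cancel₀ (by exact_mod_cast hv'.ne'), one_smul]
  have e : ∀ a : Coeff n, ‖inner ℂ v a‖ ^ q = ‖v‖ ^ q * ‖inner ℂ u a‖ ^ q := by
    intro a
    conv_lhs => rw [hvu]
    rw [inner_smul_left, norm_mul, Real.mul_rpow (norm_nonneg _) (norm_nonneg _)]
    simp
  obtain ⟨h1, h2⟩ := integrable_norm_rpow_stdComplexGaussian hq
  rw [← map_inner_coeffLaw n u hu1] at h1 h2
  have hm := (measurable_inner_coeff n u).aemeasurable (μ := coeffLaw n)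
  rw [integrable_map_measure h1.aestronglyMeasurable hm] at h1
  rw [integral_map hm (measurable_norm.pow_const q).aestronglyMeasurable] at h2
  simp_rw [e]
  refine ⟨h1.const_mul _, ?_⟩
  rw [integral_const_mul, h2]

theorem ae_inner_ne_zero (n : ℕ) (v : Coeff n) (hv : v ≠ 0) :
    ∀ᵐ a ∂(coeffLaw n), inner ℂ v a ≠ 0 := by
  have hv' : 0 < ‖v‖ := norm_pos_iff.mpr hv
  set u : Coeff n := ((‖v‖ : ℂ)⁻¹) • v with hu
  have hu1 : ‖u‖ = 1 := by
    rw [hu, norm_smul, norm_inv, Complex.norm_real, norm_norm, inv_mul_cancel₀ hv'.ne']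
  have hz : ∀ᵐ z ∂stdComplexGaussian, z ≠ 0 := by
    rw [stdComplexGaussian]
    refine (withDensity_absolutelyContinuous _ _).ae_le ?_
    exact Measure.ae_ne _ 0
  rw [← map_inner_coeffLaw n u hu1] at hz
  have := ae_of_ae_map (measurable_inner_coeff n u).aemeasurable hz
  filter_upwards [this] with a ha h0
  apply ha
  rw [hu, inner_smul_left, h0, mul_zero]

/-- Functions of the component in a subspace and of the component orthogonal to it are
independent. -/
theorem integral_mul_of_orthogonal (n : ℕ) (V : Submodule ℂ (Coeff n))
    (f g : Coeff n → ℝ) (hf : Measurable f) (hg : Measurable g)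
    (hfV : ∀ a b, a - b ∈ Vᗮ → f a = f b) (hgV : ∀ a b, a - b ∈ V → g a = g b) :
    ∫ a, f a * g a ∂(coeffLaw n) = (∫ a, f a ∂(coeffLaw n)) * ∫ a, g a ∂(coeffLaw n) := by
  have hM : Measurable fun q : Coeff n × Coeff n => V.starProjection q.1 +
      (q.2 - V.starProjection q.2) := by fun_prop
  rw [← integral_prod_mul]
  conv_lhs => rw [← coeffLaw_projection n V]
  have hfg : Measurable fun a => f a * g a := hf.mul hg
  rw [integral_map hM.aemeasurable hfg.aestronglyMeasurable]
  refine integral_congr_ae (Filter.Eventually.of_forall fun q => ?_)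
  simp only
  congr 1
  · refine hfV _ _ ?_
    have h1 := V.sub_starProjection_mem_orthogonal q.1
    have h2 := V.sub_starProjection_mem_orthogonal q.2
    have : V.starProjection q.1 + (q.2 - V.starProjection q.2) - q.1 =
      (q.2 - V.starProjection q.2) - (q.1 - V.starProjection q.1) := by abel
    rw [this]
    exact Vᗮ.sub_mem h2 h1
  · refine hgV _ _ ?_
    have : V.starProjection q.1 + (q.2 - V.starProjection q.2) - q.2 =
      V.starProjection q.1 - V.starProjection q.2 := by abel
    rw [this]
    exact V.sub_mem (V.starProjection_apply_mem _) (V.starProjection_apply_mem _)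

theorem integral_norm_inner_sq (n : ℕ) (v : Coeff n) :
    Integrable (fun a : Coeff n => ‖inner ℂ v a‖ ^ 2) (coeffLaw n) ∧
      ∫ a, ‖inner ℂ v a‖ ^ 2 ∂(coeffLaw n) = ‖v‖ ^ 2 := by
  by_cases hv : v = 0
  · simp [hv]
  · have h := integral_norm_inner_rpow n v hv (q := 2) (by norm_num)
    have hG : Real.Gamma ((2 : ℝ) / 2 + 1) = 1 := by
      norm_num [Real.Gamma_two]
    simp only [Real.rpow_two, hG, mul_one] at h
    exact h

theorem integral_inner_mul_conj_inner (n : ℕ) (v w : Coeff n) :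
    ∫ a, inner ℂ v a * (starRingEnd ℂ) (inner ℂ w a) ∂(coeffLaw n) = inner ℂ v w := by
  -- Polarization reduces covariances to the second moments of single functionals.
  have e : ∀ a : Coeff n, inner ℂ v a * (starRingEnd ℂ) (inner ℂ w a) =
      (((‖inner ℂ (w + v) a‖ ^ 2 : ℝ) : ℂ) - ((‖inner ℂ (w - v) a‖ ^ 2 : ℝ) : ℂ) +
        (((‖inner ℂ (w + Complex.I • v) a‖ ^ 2 : ℝ) : ℂ) -
          ((‖inner ℂ (w - Complex.I • v) a‖ ^ 2 : ℝ) : ℂ)) * Complex.I) / 4 := by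
    intro a
    have h := inner_eq_sum_norm_sq_div_four (𝕜 := ℂ) (inner ℂ w a : ℂ) (inner ℂ v a : ℂ)
    have h1 : (inner ℂ (inner ℂ w a : ℂ) (inner ℂ v a : ℂ) : ℂ)
        = inner ℂ v a * (starRingEnd ℂ) (inner ℂ w a) := rfl
    rw [h1] at h
    rw [h]
    have h2 : inner ℂ (w + Complex.I • v) a = inner ℂ w a - Complex.I • (inner ℂ v a : ℂ) := by
      rw [inner_add_left, inner_smul_left]; simp [sub_eq_add_neg]
    have h3 : inner ℂ (w - Complex.I • v) a = inner ℂ w a + Complex.I • (inner ℂ v a : ℂ) := by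
      rw [inner_sub_left, inner_smul_left]; simp
    rw [h2, h3, inner_add_left, inner_sub_left]
    push_cast
    rfl
  have hI : ∀ u : Coeff n, Integrable (fun a : Coeff n => ((‖inner ℂ u a‖ ^ 2 : ℝ) : ℂ))
      (coeffLaw n) := fun u => (integral_norm_inner_sq n u).1.ofReal
  have hv : ∀ u : Coeff n, ∫ a, ((‖inner ℂ u a‖ ^ 2 : ℝ) : ℂ) ∂(coeffLaw n)
      = ((‖u‖ ^ 2 : ℝ) : ℂ) := fun u => by
    rw [integral_complex_ofReal, (integral_norm_inner_sq n u).2]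
  have hS : ∀ u u' : Coeff n, Integrable (fun a : Coeff n => ((‖inner ℂ u a‖ ^ 2 : ℝ) : ℂ) -
      ((‖inner ℂ u' a‖ ^ 2 : ℝ) : ℂ)) (coeffLaw n) := fun u u' => (hI u).sub (hI u')
  simp_rw [e]
  rw [integral_div, integral_add (hS _ _) ((hS _ _).mul_const _),
    integral_mul_const, integral_sub (hI _) (hI _), integral_sub (hI _) (hI _), hv, hv, hv, hv,
    inner_eq_sum_norm_sq_div_four (𝕜 := ℂ) v w]
  have n1 : ‖w + v‖ = ‖v + w‖ := congrArg _ (add_comm w v)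
  have n2 : ‖w - v‖ = ‖v - w‖ := norm_sub_rev _ _
  have n3 : ‖w + Complex.I • v‖ = ‖v - Complex.I • w‖ := by
    have : w + Complex.I • v = Complex.I • (v - Complex.I • w) := by
      rw [smul_sub, smul_smul, Complex.I_mul_I]; simp [add_comm]
    rw [this, norm_smul]; simp
  have n4 : ‖w - Complex.I • v‖ = ‖v + Complex.I • w‖ := by
    have : w - Complex.I • v = -(Complex.I • (v + Complex.I • w)) := by
      rw [smul_add, smul_smul, Complex.I_mul_I]; simp [sub_eq_neg_add, add_comm]
    rw [this, norm_neg, norm_smul]; simp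
  rw [n1, n2, n3, n4]
  push_cast
  rfl

/-- The law is invariant under `a ↦ -a`. -/
theorem integral_inner_eq_zero (n : ℕ) (v : Coeff n) :
    ∫ a, inner ℂ v a ∂(coeffLaw n) = 0 := by
  have hneg := coeffLaw_map_isometry n (LinearIsometryEquiv.neg ℂ)
  have h : ∫ a, inner ℂ v a ∂(coeffLaw n) = -∫ a, inner ℂ v a ∂(coeffLaw n) := by
    conv_lhs => rw [← hneg]
    rw [integral_map (LinearIsometryEquiv.continuous _).measurable.aemeasurable
      (measurable_inner_coeff n v).aestronglyMeasurable, ← integral_neg]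
    simp
  exact self_eq_neg.mp h

/-! ### Moments and perturbation of products of functions of Gaussian variables -/

/-- A bound on the `k`-th moment of a nonnegative function. -/
structure MomentBound (n k : ℕ) (C : ℝ) (f : Coeff n → ℝ) : Prop where
  nonneg : ∀ a, 0 ≤ f a
  measurable : Measurable f
  integrable : Integrable (fun a => f a ^ k) (coeffLaw n)
  le : ∫ a, f a ^ k ∂(coeffLaw n) ≤ C

theorem MomentBound.add {n k : ℕ} {C C' : ℝ} {f g : Coeff n → ℝ} (hf : MomentBound n k C f)
    (hg : MomentBound n k C' g) :
    MomentBound n k (2 ^ (k - 1) * (C + C')) (fun a => f a + g a) := by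
  have hi := (hf.integrable.add hg.integrable).const_mul ((2 : ℝ) ^ (k - 1))
  have hle : ∀ a, (f a + g a) ^ k ≤ 2 ^ (k - 1) * (f a ^ k + g a ^ k) := fun a =>
    add_pow_le (hf.nonneg a) (hg.nonneg a) k
  have hint : Integrable (fun a => (f a + g a) ^ k) (coeffLaw n) := by
    refine hi.mono' ((hf.measurable.add hg.measurable).pow_const k).aestronglyMeasurable ?_
    filter_upwards with a
    rw [Real.norm_of_nonneg (pow_nonneg (add_nonneg (hf.nonneg a) (hg.nonneg a)) k)]
    exact hle a
  refine ⟨fun a => add_nonneg (hf.nonneg a) (hg.nonneg a), hf.measurable.add hg.measurable,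
    hint, ?_⟩
  refine (integral_mono hint hi hle).trans ?_
  simp only [Pi.add_apply]
  rw [integral_const_mul, integral_add hf.integrable hg.integrable]
  exact mul_le_mul_of_nonneg_left (add_le_add hf.le hg.le) (by positivity)

theorem MomentBound.mono {n k : ℕ} {C C' : ℝ} {f : Coeff n → ℝ} (hf : MomentBound n k C f)
    (h : C ≤ C') : MomentBound n k C' f :=
  ⟨hf.nonneg, hf.measurable, hf.integrable, hf.le.trans h⟩

theorem MomentBound.const (n k : ℕ) {c : ℝ} (hc : 0 ≤ c) :
    MomentBound n k (c ^ k) (fun _ => c) :=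
  ⟨fun _ => hc, measurable_const, integrable_const _, by simp⟩

/-- The constant depends on the family only through a bound for its cardinality, hence is uniform in
`n`. The summand 1 makes the sum at least 1, so that its powers can be compared. -/
theorem exists_momentBound_sum (k N : ℕ) (C : ℝ) :
    ∃ C' : ℝ, ∀ (n : ℕ) (ι : Type) (S : Finset ι) (f : ι → Coeff n → ℝ), S.card ≤ N →
      (∀ i ∈ S, MomentBound n k C (f i)) → MomentBound n k C' (fun a => 1 + ∑ i ∈ S, f i a) := by
  induction N with
  | zero =>
    refine ⟨1, fun n ι S f hS _ => ?_⟩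
    have : S = ∅ := Finset.card_eq_zero.mp (Nat.le_zero.mp hS)
    subst this
    simpa using MomentBound.const n k zero_le_one
  | succ N ih =>
    obtain ⟨C', hC'⟩ := ih
    refine ⟨max C' (2 ^ (k - 1) * (C + C')), fun n ι S f hS hf => ?_⟩
    classical
    rcases S.eq_empty_or_nonempty with rfl | ⟨i, hi⟩
    · exact (hC' n ι ∅ f (by simp) (by simp)).mono (le_max_left _ _)
    · have h1 := hC' n ι (S.erase i) f (by rw [Finset.card_erase_of_mem hi]; omega)
        fun j hj => hf j (Finset.mem_of_mem_erase hj)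
      have h2 := ((hf i hi).add h1).mono (le_max_right C' (2 ^ (k - 1) * (C + C')))
      have : (fun a => f i a + (1 + ∑ j ∈ S.erase i, f j a)) = fun a => 1 + ∑ j ∈ S, f j a := by
        ext a
        rw [← Finset.add_sum_erase S (fun j => f j a) hi]; ring
      rwa [this] at h2

/-- The majorant `r^{-s} + r^3`. -/
def majorant (s r : ℝ) : ℝ := r ^ (-s) + r ^ 3

theorem majorant_nonneg {s r : ℝ} (hr : 0 ≤ r) : 0 ≤ majorant s r := by
  unfold majorant; positivity

theorem one_le_majorant {s r : ℝ} (hs : 0 < s) (hr : 0 < r) : 1 ≤ majorant s r := by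
  unfold majorant
  rcases le_total r 1 with h | h
  · have := Real.one_le_rpow_of_pos_of_le_one_of_nonpos hr h (neg_nonpos.mpr hs.le)
    have : 0 ≤ r ^ 3 := by positivity
    linarith
  · have h1 : (1 : ℝ) ≤ r ^ 3 := one_le_pow₀ h
    have : 0 ≤ r ^ (-s) := Real.rpow_nonneg hr.le _
    linarith

/-- In the plane `|z|^q` is integrable at the origin for `q > -2`; keeping the standard deviation
between 1/2 and 2 makes the bound uniform. -/
theorem exists_momentBound_rpow {q : ℝ} (k : ℕ) (hq : -2 < q * k) :
    ∃ C : ℝ, ∀ (n : ℕ) (v : Coeff n), 1 / 2 ≤ ‖v‖ → ‖v‖ ≤ 2 →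
      MomentBound n k C (fun a => ‖inner ℂ v a‖ ^ q) := by
  refine ⟨2 ^ |q * k| * Real.Gamma (q * k / 2 + 1), fun n v h1 h2 => ?_⟩
  have hv : v ≠ 0 := by rintro rfl; norm_num at h1
  have e : ∀ a : Coeff n, (‖inner ℂ v a‖ ^ q) ^ k = ‖inner ℂ v a‖ ^ (q * k) := fun a => by
    rw [Real.rpow_mul (norm_nonneg _), Real.rpow_natCast]
  obtain ⟨hi, hval⟩ := integral_norm_inner_rpow n v hv hq
  refine ⟨fun a => by positivity, (measurable_inner_coeff n v).norm.pow_const q, ?_, ?_⟩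
  · simp_rw [e]; exact hi
  · simp_rw [e]
    rw [hval]
    have hG : 0 < Real.Gamma (q * k / 2 + 1) := Real.Gamma_pos_of_pos (by linarith)
    refine mul_le_mul_of_nonneg_right ?_ hG.le
    have hpos : 0 < ‖v‖ := by linarith
    rcases le_total 0 (q * k) with h | h
    · rw [abs_of_nonneg h]
      exact Real.rpow_le_rpow hpos.le h2 h
    · rw [abs_of_nonpos h, Real.rpow_neg (by norm_num), ← Real.inv_rpow (by norm_num)]
      exact Real.rpow_le_rpow_of_nonpos (by norm_num) (by linarith) h

theorem exists_momentBound_majorant {s : ℝ} (k : ℕ) (hs : s * k < 2) :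
    ∃ C : ℝ, ∀ (n : ℕ) (v : Coeff n), 1 / 2 ≤ ‖v‖ → ‖v‖ ≤ 2 →
      MomentBound n k C (fun a => majorant s ‖inner ℂ v a‖) := by
  obtain ⟨C₁, h₁⟩ := exists_momentBound_rpow (q := -s) k (by linarith)
  obtain ⟨C₂, h₂⟩ := exists_momentBound_rpow (q := (3 : ℕ)) k (by
    have : (0 : ℝ) ≤ ((3 : ℕ) : ℝ) * k := by positivity
    linarith)
  refine ⟨2 ^ (k - 1) * (C₁ + C₂), fun n v hv hv' => ?_⟩
  have := (h₁ n v hv hv').add (h₂ n v hv hv')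
  simp only [Real.rpow_natCast] at this
  exact this

theorem exists_momentBound_one_add (k : ℕ) :
    ∃ C : ℝ, ∀ (n : ℕ) (v : Coeff n), ‖v‖ ≤ 1 →
      MomentBound n k C (fun a => 1 + ‖inner ℂ v a‖) := by
  have hG : 0 < Real.Gamma ((k : ℝ) / 2 + 1) := Real.Gamma_pos_of_pos (by positivity)
  refine ⟨2 ^ (k - 1) * (1 ^ k + (1 + Real.Gamma ((k : ℝ) / 2 + 1))), fun n v hv => ?_⟩
  refine (MomentBound.const n k zero_le_one).add ?_
  by_cases h0 : v = 0
  · subst h0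
    refine ⟨fun _ => norm_nonneg _, by fun_prop, by simp, ?_⟩
    simp only [inner_zero_left, norm_zero, integral_const, probReal_univ, one_smul]
    have : (0 : ℝ) ^ k ≤ 1 := pow_le_one₀ le_rfl zero_le_one
    linarith
  · obtain ⟨hi, hval⟩ := integral_norm_inner_rpow n v h0 (q := (k : ℝ))
      (by have : (0 : ℝ) ≤ k := by positivity
          linarith)
    simp only [Real.rpow_natCast] at hi hval
    refine ⟨fun _ => norm_nonneg _, (measurable_inner_coeff n v).norm, hi, ?_⟩
    rw [hval]
    have : ‖v‖ ^ k ≤ 1 := pow_le_one₀ (norm_nonneg _) hv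
    nlinarith

/-- Functions with at most a weak singularity at `0` and cubic growth, with a matching Hölder
estimate. -/
structure TameFunction (s K : ℝ) (F : ℂ → ℝ) : Prop where
  measurable : Measurable F
  bound : ∀ z, z ≠ 0 → |F z| ≤ K * majorant s ‖z‖
  holder : ∀ z z', z ≠ 0 → z' ≠ 0 →
    |F z - F z'| ≤ K * ‖z - z'‖ ^ s * (majorant s ‖z‖ + majorant s ‖z'‖)

theorem abs_prod_le_pow_card {ι : Type} (S : Finset ι) (f : ι → ℝ) {Y : ℝ}
    (hf : ∀ i ∈ S, |f i| ≤ Y) : |∏ i ∈ S, f i| ≤ Y ^ S.card := by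
  rw [Finset.abs_prod, ← Finset.prod_const]
  exact Finset.prod_le_prod (fun i _ => abs_nonneg _) hf

theorem abs_prod_sub_prod_le {ι : Type} (S : Finset ι) (f g : ι → ℝ) {Y d : ℝ}
    (hf : ∀ i ∈ S, |f i| ≤ Y) (hg : ∀ i ∈ S, |g i| ≤ Y) (hfg : ∀ i ∈ S, |f i - g i| ≤ d * Y) :
    |∏ i ∈ S, f i - ∏ i ∈ S, g i| ≤ S.card * d * Y ^ S.card := by
  classical
  induction S using Finset.induction_on with
  | empty => simp
  | insert i S hi ih =>
    rw [Finset.prod_insert hi, Finset.prod_insert hi, Finset.card_insert_of_notMem hi]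
    have ih' := ih (fun j hj => hf j (Finset.mem_insert_of_mem hj))
      (fun j hj => hg j (Finset.mem_insert_of_mem hj))
      (fun j hj => hfg j (Finset.mem_insert_of_mem hj))
    have hY : 0 ≤ Y := (abs_nonneg _).trans (hf i (Finset.mem_insert_self _ _))
    have hp : |∏ j ∈ S, f j| ≤ Y ^ S.card :=
      abs_prod_le_pow_card S f fun j hj => hf j (Finset.mem_insert_of_mem hj)
    have e : f i * ∏ j ∈ S, f j - g i * ∏ j ∈ S, g j =
        (f i - g i) * ∏ j ∈ S, f j + g i * (∏ j ∈ S, f j - ∏ j ∈ S, g j) := by ring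
    rw [e]
    refine (abs_add_le _ _).trans ?_
    rw [abs_mul, abs_mul]
    have h1 := hfg i (Finset.mem_insert_self _ _)
    have h2 := hg i (Finset.mem_insert_self _ _)
    calc |f i - g i| * |∏ j ∈ S, f j| + |g i| * |∏ j ∈ S, f j - ∏ j ∈ S, g j|
        ≤ d * Y * Y ^ S.card + Y * (S.card * d * Y ^ S.card) := by
          gcongr
          exact (abs_nonneg _).trans h1
      _ = _ := by push_cast; ring

set_option maxHeartbeats 400000 in
/-- Products of tame functions of Gaussian variables are integrable with uniformly bounded
expectations, which depend Hölder continuously on the variables. -/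
theorem exists_perturbation_bound (N : ℕ) (K : ℝ) (hK : 1 ≤ K) :
    ∃ C : ℝ, 0 < C ∧ ∀ (n : ℕ) (ι : Type) (S : Finset ι) (F : ι → ℂ → ℝ) (x y : ι → Coeff n)
      (η : ℝ), S.card ≤ N → 0 < η →
      (∀ i ∈ S, TameFunction (1 / (N + 1)) K (F i)) →
      (∀ i ∈ S, 1 / 2 ≤ ‖x i‖ ∧ ‖x i‖ ≤ 2) → (∀ i ∈ S, 1 / 2 ≤ ‖y i‖ ∧ ‖y i‖ ≤ 2) →
      (∀ i ∈ S, ‖x i - y i‖ ≤ η) →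
      |∫ a, ∏ i ∈ S, F i (inner ℂ (x i) a) ∂(coeffLaw n)| ≤ C ∧
      |∫ a, ∏ i ∈ S, F i (inner ℂ (x i) a) ∂(coeffLaw n)
        - ∫ a, ∏ i ∈ S, F i (inner ℂ (y i) a) ∂(coeffLaw n)| ≤ C * η ^ (1 / (N + 1 : ℝ)) := by
  -- A product of `N` factors, with one more power from the Hölder increment, is dominated by an
  -- `(N+1)`-st power. With this exponent `r^{-s}` becomes `r^{-1}`, which is integrable in the
  -- plane.
  set s : ℝ := 1 / (N + 1) with hs
  have hs0 : 0 < s := by positivity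
  have hs1 : s ≤ 1 := by
    rw [hs, div_le_one (by positivity)]; linarith [(Nat.cast_nonneg N : (0 : ℝ) ≤ N)]
  obtain ⟨C₁, hC₁⟩ := exists_momentBound_majorant (s := s) (N + 1) (by
    rw [hs]; push_cast; field_simp; norm_num)
  obtain ⟨C₂, hC₂⟩ := exists_momentBound_one_add (N + 1)
  obtain ⟨C₃, hC₃⟩ := exists_momentBound_sum (N + 1) N
    (2 ^ (N + 1 - 1) * (2 ^ (N + 1 - 1) * (C₁ + C₁) + C₂))
  have hC₃0 : 0 ≤ C₃ := by
    have := hC₃ 0 PUnit ∅ (fun _ _ => 0) (by simp) (by simp)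
    have h2 := this.le
    simp at h2
    linarith
  refine ⟨(N + 1) * K ^ (N + 1) * (C₃ + 1), by positivity, ?_⟩
  intro n ι S F x y η hS hη hF hx hy hxy
  -- The increment of the `i`-th variable is `η` times a Gaussian variable with bounded moments.
  set g : ι → Coeff n := fun i => ((η : ℂ)⁻¹) • (x i - y i) with hg
  have hηc : (η : ℂ) ≠ 0 := by exact_mod_cast hη.ne'
  have hg1 : ∀ i ∈ S, ‖g i‖ ≤ 1 := fun i hi => by
    rw [hg]
    simp only [norm_smul, norm_inv, Complex.norm_real, Real.norm_of_nonneg hη.le]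
    rw [inv_mul_le_iff₀ hη, mul_one]
    exact hxy i hi
  set T : ι → Coeff n → ℝ := fun i a => majorant s ‖inner ℂ (x i) a‖ +
    majorant s ‖inner ℂ (y i) a‖ + (1 + ‖inner ℂ (g i) a‖) with hT
  have hTM : ∀ i ∈ S, MomentBound n (N + 1)
      (2 ^ (N + 1 - 1) * (2 ^ (N + 1 - 1) * (C₁ + C₁) + C₂)) (T i) := fun i hi =>
    ((hC₁ n (x i) (hx i hi).1 (hx i hi).2).add (hC₁ n (y i) (hy i hi).1 (hy i hi).2)).add
      (hC₂ n (g i) (hg1 i hi))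
  have hYM := hC₃ n ι S T hS hTM
  -- A single random variable that dominates, up to `K`, all factors of both products and, up to
  -- powers of `η`, all increments.
  set Y : Coeff n → ℝ := fun a => 1 + ∑ i ∈ S, T i a with hY
  have hT0 : ∀ i a, 0 ≤ T i a := fun i a => by
    have := majorant_nonneg (s := s) (norm_nonneg (inner ℂ (x i) a))
    have := majorant_nonneg (s := s) (norm_nonneg (inner ℂ (y i) a))
    have := norm_nonneg (inner ℂ (g i) a)
    simp only [hT]; linarith
  have hY1 : ∀ a, 1 ≤ Y a := fun a => by
    have := Finset.sum_nonneg fun i (_ : i ∈ S) => hT0 i a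
    simp only [hY]; linarith
  have hTY : ∀ i ∈ S, ∀ a, T i a ≤ Y a := fun i hi a => by
    have := Finset.single_le_sum (fun j (_ : j ∈ S) => hT0 j a) hi
    simp only [hY]; linarith
  have hne : ∀ᵐ a ∂(coeffLaw n), ∀ i ∈ S, inner ℂ (x i) a ≠ 0 ∧ inner ℂ (y i) a ≠ 0 := by
    refine (ae_ball_iff (S := (S : Set ι)) S.countable_toSet).mpr fun i hi => ?_
    have hxi : x i ≠ 0 := by
      intro h; have := (hx i hi).1; rw [h] at this; norm_num at this
    have hyi : y i ≠ 0 := by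
      intro h; have := (hy i hi).1; rw [h] at this; norm_num at this
    filter_upwards [ae_inner_ne_zero n _ hxi, ae_inner_ne_zero n _ hyi] with a h1 h2
    exact ⟨h1, h2⟩
  have hbx : ∀ a, ∀ i ∈ S, inner ℂ (x i) a ≠ 0 → |F i (inner ℂ (x i) a)| ≤ K * Y a := by
    intro a i hi h
    refine ((hF i hi).bound _ h).trans (mul_le_mul_of_nonneg_left ?_ (by linarith))
    refine le_trans ?_ (hTY i hi a)
    have := majorant_nonneg (s := s) (norm_nonneg (inner ℂ (y i) a))
    have := norm_nonneg (inner ℂ (g i) a)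
    simp only [hT]; linarith
  have hby : ∀ a, ∀ i ∈ S, inner ℂ (y i) a ≠ 0 → |F i (inner ℂ (y i) a)| ≤ K * Y a := by
    intro a i hi h
    refine ((hF i hi).bound _ h).trans (mul_le_mul_of_nonneg_left ?_ (by linarith))
    refine le_trans ?_ (hTY i hi a)
    have := majorant_nonneg (s := s) (norm_nonneg (inner ℂ (x i) a))
    have := norm_nonneg (inner ℂ (g i) a)
    simp only [hT]; linarith
  have hdiff : ∀ a, ∀ i ∈ S, inner ℂ (x i) a ≠ 0 → inner ℂ (y i) a ≠ 0 →
      |F i (inner ℂ (x i) a) - F i (inner ℂ (y i) a)| ≤ (η ^ s * Y a) * (K * Y a) := by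
    intro a i hi h h'
    refine ((hF i hi).holder _ _ h h').trans ?_
    have e : inner ℂ (x i) a - inner ℂ (y i) a = η * inner ℂ (g i) a := by
      rw [← inner_sub_left, hg]
      simp only [inner_smul_left, map_inv₀, Complex.conj_ofReal]
      rw [← mul_assoc, mul_inv_cancel₀ hηc, one_mul]
    have e2 : ‖(inner ℂ (x i) a - inner ℂ (y i) a : ℂ)‖ ^ s ≤ η ^ s * Y a := by
      rw [e, norm_mul, Complex.norm_real, Real.norm_of_nonneg hη.le,
        Real.mul_rpow hη.le (norm_nonneg _)]
      refine mul_le_mul_of_nonneg_left ?_ (by positivity)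
      refine le_trans ?_ (hTY i hi a)
      have h1 := majorant_nonneg (s := s) (norm_nonneg (inner ℂ (x i) a))
      have h2 := majorant_nonneg (s := s) (norm_nonneg (inner ℂ (y i) a))
      have h3 : ‖inner ℂ (g i) a‖ ^ s ≤ 1 + ‖inner ℂ (g i) a‖ := by
        rcases le_total ‖inner ℂ (g i) a‖ 1 with h | h
        · have := Real.rpow_le_one (norm_nonneg _) h hs0.le
          have := norm_nonneg (inner ℂ (g i) a)
          linarith
        · have := Real.rpow_le_rpow_of_exponent_le h hs1
          rw [Real.rpow_one] at this
          linarith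
      simp only [hT]; linarith
    have e3 : majorant s ‖inner ℂ (x i) a‖ + majorant s ‖inner ℂ (y i) a‖ ≤ Y a := by
      refine le_trans ?_ (hTY i hi a)
      have := norm_nonneg (inner ℂ (g i) a)
      simp only [hT]; linarith
    have hM0 : 0 ≤ majorant s ‖inner ℂ (x i) a‖ + majorant s ‖inner ℂ (y i) a‖ :=
      add_nonneg (majorant_nonneg (norm_nonneg _)) (majorant_nonneg (norm_nonneg _))
    have hYa := hY1 a
    have haux : ∀ A B P Q : ℝ, 0 ≤ A → 0 ≤ B → A ≤ P → B ≤ Q → K * A * B ≤ P * (K * Q) := by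
      intro A B P Q hA hB hAP hBQ
      have : A * B ≤ P * Q := mul_le_mul hAP hBQ hB (hA.trans hAP)
      nlinarith
    exact haux _ _ _ _ (Real.rpow_nonneg (norm_nonneg _) _) hM0 e2 e3
  have hKY : ∀ a, 1 ≤ K * Y a := fun a => one_le_mul_of_one_le_of_one_le hK (hY1 a)
  have hprod : ∀ (u : ι → Coeff n), (∀ a, ∀ i ∈ S, inner ℂ (u i) a ≠ 0 →
      |F i (inner ℂ (u i) a)| ≤ K * Y a) → ∀ a, (∀ i ∈ S, inner ℂ (u i) a ≠ 0) →
      |∏ i ∈ S, F i (inner ℂ (u i) a)| ≤ K ^ (N + 1) * Y a ^ (N + 1) := by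
    intro u hu a ha
    rw [← mul_pow]
    refine (abs_prod_le_pow_card S _ fun i hi => hu a i hi (ha i hi)).trans ?_
    exact pow_le_pow_right₀ (hKY a) (by omega)
  have hmeas : ∀ u : ι → Coeff n, AEStronglyMeasurable
      (fun a => ∏ i ∈ S, F i (inner ℂ (u i) a)) (coeffLaw n) := fun u => by
    refine (Finset.measurable_prod S fun i hi => ?_).aestronglyMeasurable
    exact (hF i hi).measurable.comp (measurable_inner_coeff n _)
  have hdom : Integrable (fun a => K ^ (N + 1) * Y a ^ (N + 1)) (coeffLaw n) :=
    hYM.integrable.const_mul (K ^ (N + 1))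
  have hix : Integrable (fun a => ∏ i ∈ S, F i (inner ℂ (x i) a)) (coeffLaw n) := by
    refine hdom.mono' (hmeas x) ?_
    filter_upwards [hne] with a ha
    rw [Real.norm_eq_abs]
    exact hprod x hbx a fun i hi => (ha i hi).1
  have hiy : Integrable (fun a => ∏ i ∈ S, F i (inner ℂ (y i) a)) (coeffLaw n) := by
    refine hdom.mono' (hmeas y) ?_
    filter_upwards [hne] with a ha
    rw [Real.norm_eq_abs]
    exact hprod y hby a fun i hi => (ha i hi).2
  have hK0 : 0 ≤ K ^ (N + 1) := by positivity
  have hN0 : (0 : ℝ) ≤ N := Nat.cast_nonneg N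
  constructor
  · refine (norm_integral_le_of_norm_le hdom (f := fun a => ∏ i ∈ S, F i (inner ℂ (x i) a)) ?_).trans ?_
    · filter_upwards [hne] with a ha
      rw [Real.norm_eq_abs]
      exact hprod x hbx a fun i hi => (ha i hi).1
    · rw [integral_const_mul]
      calc K ^ (N + 1) * ∫ a, Y a ^ (N + 1) ∂(coeffLaw n) ≤ K ^ (N + 1) * C₃ :=
            mul_le_mul_of_nonneg_left hYM.le hK0
        _ ≤ (N + 1) * K ^ (N + 1) * (C₃ + 1) := by
            have : 0 ≤ K ^ (N + 1) * C₃ := by positivity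
            have : 0 ≤ N * (K ^ (N + 1) * (C₃ + 1)) := by positivity
            nlinarith
  · rw [← integral_sub hix hiy]
    have hd2 : Integrable (fun a => N * η ^ s * K ^ (N + 1) * Y a ^ (N + 1)) (coeffLaw n) := hYM.integrable.const_mul (N * η ^ s * K ^ (N + 1))
    refine (norm_integral_le_of_norm_le hd2
      (f := fun a => ∏ i ∈ S, F i (inner ℂ (x i) a) - ∏ i ∈ S, F i (inner ℂ (y i) a)) ?_).trans ?_
    · filter_upwards [hne] with a ha
      have h := abs_prod_sub_prod_le S (fun i => F i (inner ℂ (x i) a))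
        (fun i => F i (inner ℂ (y i) a)) (Y := K * Y a) (d := η ^ s * Y a)
        (fun i hi => hbx a i hi (ha i hi).1) (fun i hi => hby a i hi (ha i hi).2)
        (fun i hi => hdiff a i hi (ha i hi).1 (ha i hi).2)
      rw [Real.norm_eq_abs]
      refine h.trans ?_
      have hYa := hY1 a
      have hcard : (S.card : ℝ) ≤ N := by exact_mod_cast hS
      calc (S.card : ℝ) * (η ^ s * Y a) * (K * Y a) ^ S.card
          ≤ N * (η ^ s * Y a) * (K * Y a) ^ N := by
            have := pow_le_pow_right₀ (hKY a) hS
            gcongr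
        _ = N * η ^ s * (K ^ N) * Y a ^ (N + 1) := by rw [mul_pow]; ring
        _ ≤ N * η ^ s * K ^ (N + 1) * Y a ^ (N + 1) := by
            have := pow_le_pow_right₀ hK (Nat.le_succ N)
            gcongr
    · rw [integral_const_mul]
      have hηs : 0 < η ^ s := by positivity
      calc N * η ^ s * K ^ (N + 1) * ∫ a, Y a ^ (N + 1) ∂(coeffLaw n)
          ≤ N * η ^ s * K ^ (N + 1) * C₃ := mul_le_mul_of_nonneg_left hYM.le (by positivity)
        _ ≤ (N + 1) * η ^ s * K ^ (N + 1) * (C₃ + 1) := by gcongr <;> linarith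
        _ = _ := by ring

/-- For `W` almost orthogonal to `V`, the projection to `V` is small on `W`. -/
theorem norm_starProjection_le_of_almost_orthogonal {n : ℕ} {V W : Submodule ℂ (Coeff n)} {ε : ℝ}
    (hε : 0 ≤ ε) (h : ∀ g ∈ V, ∀ k ∈ W, ‖inner ℂ g k‖ ≤ ε * ‖g‖ * ‖k‖) {x : Coeff n} (hx : x ∈ W) :
    ‖V.starProjection x‖ ≤ ε * ‖x‖ := by
  set y := V.starProjection x with hy
  have hyV : y ∈ V := V.starProjection_apply_mem x
  have h1 : inner ℂ y x = (‖y‖ : ℂ) ^ 2 := by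
    have h2 := V.sub_starProjection_mem_orthogonal x y hyV
    rw [← hy, inner_sub_right, sub_eq_zero] at h2
    rw [h2, inner_self_eq_norm_sq_to_K]; rfl
  have h3 := h y hyV x hx
  rw [h1, norm_pow, Complex.norm_real, norm_norm] at h3
  rcases (norm_nonneg y).eq_or_lt with h0 | h0
  · rw [← h0]
    positivity
  · nlinarith

/-- Subtracting from each vector of `B` its projection to `V` moves it by at most `ε` and makes the
group independent of the group `A`. The perturbation bound is used to pass from `y` to this modified
family, and again to return to `x` on `B` after factoring. The room of `2ε` between `x` and `y` is
for conditioning on all zeros instead of those of one group. -/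
theorem exists_decoupling_bound (N : ℕ) (K : ℝ) (hK : 1 ≤ K) :
    ∃ C : ℝ, 0 < C ∧ ∀ (n : ℕ) (ι : Type) [Fintype ι] (A B : Finset ι)
      (F : ι → ℂ → ℝ) (x y : ι → Coeff n) (V W : Submodule ℂ (Coeff n)) (ε : ℝ),
      IsCompl A B → Fintype.card ι ≤ N → 0 < ε → ε ≤ 1 / 8 →
      (∀ g ∈ V, ∀ h ∈ W, ‖inner ℂ g h‖ ≤ ε * ‖g‖ * ‖h‖) →
      (∀ i, TameFunction (1 / (N + 1)) K (F i)) → (∀ i, ‖x i‖ = 1) →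
      (∀ i ∈ A, x i ∈ V) → (∀ i ∈ B, x i ∈ W) → (∀ i, ‖x i - y i‖ ≤ 2 * ε) →
      |∫ a, ∏ i, F i (inner ℂ (y i) a) ∂(coeffLaw n)
        - (∫ a, ∏ i ∈ A, F i (inner ℂ (x i) a) ∂(coeffLaw n)) *
          ∫ a, ∏ i ∈ B, F i (inner ℂ (x i) a) ∂(coeffLaw n)| ≤ C * ε ^ (1 / (N + 1 : ℝ)) ∧
      |(∫ a, ∏ i ∈ A, F i (inner ℂ (x i) a) ∂(coeffLaw n)) *
          ∫ a, ∏ i ∈ B, F i (inner ℂ (x i) a) ∂(coeffLaw n)| ≤ C := by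
  obtain ⟨C, hC, hpert⟩ := exists_perturbation_bound N K hK
  -- The term `3C` comes from `‖y i - x' i‖ ≤ 3ε`, and `C * C` from changing one of two factors
  -- bounded by `C`.
  refine ⟨3 * C + C * C, by positivity, ?_⟩
  intro n ι _ A B F x y V W ε hAB hcard hε hε8 hVW hF hx hxA hxB hxy
  classical
  set s : ℝ := 1 / (N + 1) with hs
  have hs0 : 0 < s := by positivity
  have hs1 : s ≤ 1 := by
    rw [hs, div_le_one (by positivity)]; linarith [(Nat.cast_nonneg N : (0 : ℝ) ≤ N)]
  set x' : ι → Coeff n := fun i => if i ∈ B then x i - V.starProjection (x i) else x i with hx'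
  have hxx' : ∀ i, ‖x i - x' i‖ ≤ ε := fun i => by
    by_cases hi : i ∈ B
    · simp only [hx', hi, if_true, sub_sub_cancel]
      have := norm_starProjection_le_of_almost_orthogonal hε.le hVW (hxB i hi)
      rwa [hx i, mul_one] at this
    · simp only [hx', hi, if_false, sub_self, norm_zero]
      exact hε.le
  have hyx' : ∀ i, ‖y i - x' i‖ ≤ 3 * ε := fun i => by
    have e : y i - x' i = (x i - x' i) - (x i - y i) := by abel
    rw [e]
    refine (norm_sub_le _ _).trans ?_
    linarith [hxx' i, hxy i]
  have hnear : ∀ u : ι → Coeff n, (∀ i, ‖x i - u i‖ ≤ 2 * ε) → ∀ i, 1 / 2 ≤ ‖u i‖ ∧ ‖u i‖ ≤ 2 := by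
    intro u hu i
    have h1 := norm_sub_norm_le (x i) (u i)
    have h2 := norm_sub_norm_le (u i) (x i)
    rw [norm_sub_rev] at h2
    have h3 := hu i
    rw [hx i] at h1 h2
    constructor <;> linarith
  have hyn := hnear y hxy
  have hx'n := hnear x' fun i => (hxx' i).trans (by linarith)
  have hxn : ∀ i, 1 / 2 ≤ ‖x i‖ ∧ ‖x i‖ ≤ 2 := fun i => by rw [hx i]; norm_num
  obtain ⟨-, h1⟩ := hpert n ι Finset.univ F y x' (3 * ε) hcard (by linarith) (fun i _ => hF i)
    (fun i _ => hyn i) (fun i _ => hx'n i) (fun i _ => hyx' i)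
  obtain ⟨hBb, h2⟩ := hpert n ι B F x x' ε ((Finset.card_le_univ B).trans hcard) hε
    (fun i _ => hF i) (fun i _ => hxn i) (fun i _ => hx'n i) (fun i _ => hxx' i)
  obtain ⟨hAb, -⟩ := hpert n ι A F x x' ε ((Finset.card_le_univ A).trans hcard) hε
    (fun i _ => hF i) (fun i _ => hxn i) (fun i _ => hx'n i) (fun i _ => hxx' i)
  have hmeas : ∀ (S : Finset ι) (u : ι → Coeff n),
      Measurable (fun a => ∏ i ∈ S, F i (inner ℂ (u i) a)) := fun S u =>
    Finset.measurable_prod S fun i _ => (hF i).measurable.comp (measurable_inner_coeff n _)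
  have hind : ∫ a, ∏ i, F i (inner ℂ (x' i) a) ∂(coeffLaw n) =
      (∫ a, ∏ i ∈ A, F i (inner ℂ (x i) a) ∂(coeffLaw n)) *
        ∫ a, ∏ i ∈ B, F i (inner ℂ (x' i) a) ∂(coeffLaw n) := by
    rw [← integral_mul_of_orthogonal n V _ _ (hmeas A x) (hmeas B x')]
    · refine integral_congr_ae (Filter.Eventually.of_forall fun a => ?_)
      simp only
      have hu : (Finset.univ : Finset ι) = A ∪ B := by
        have := hAB.sup_eq_top
        simpa using this.symm
      rw [hu, Finset.prod_union hAB.disjoint]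
      congr 1
      refine Finset.prod_congr rfl fun i hi => ?_
      have : i ∉ B := Finset.disjoint_left.mp hAB.disjoint hi
      simp only [hx', this, if_false]
    · intro a b hab
      refine Finset.prod_congr rfl fun i hi => ?_
      have := hab _ (hxA i hi)
      rw [inner_sub_right, sub_eq_zero] at this
      rw [this]
    · intro a b hab
      refine Finset.prod_congr rfl fun i hi => ?_
      have h := V.sub_starProjection_mem_orthogonal (x i) _ hab
      have h' : inner ℂ (x' i) (a - b) = 0 := by
        simp only [hx', hi, if_true]
        rw [← inner_conj_symm, h, map_zero]
      rw [inner_sub_right, sub_eq_zero] at h'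
      rw [h']
  rw [hind] at h1
  have h3 : (3 * ε) ^ s ≤ 3 * ε ^ s := by
    rw [Real.mul_rpow (by norm_num) hε.le]
    have : (3 : ℝ) ^ s ≤ 3 ^ (1 : ℝ) := Real.rpow_le_rpow_of_exponent_le (by norm_num) hs1
    rw [Real.rpow_one] at this
    exact mul_le_mul_of_nonneg_right this (by positivity)
  set EA := ∫ a, ∏ i ∈ A, F i (inner ℂ (x i) a) ∂(coeffLaw n)
  set EB := ∫ a, ∏ i ∈ B, F i (inner ℂ (x i) a) ∂(coeffLaw n)
  set EB' := ∫ a, ∏ i ∈ B, F i (inner ℂ (x' i) a) ∂(coeffLaw n)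
  set E := ∫ a, ∏ i, F i (inner ℂ (y i) a) ∂(coeffLaw n)
  have hεs : 0 < ε ^ s := by positivity
  constructor
  · have e : E - EA * EB = (E - EA * EB') - EA * (EB - EB') := by ring
    rw [e]
    refine (abs_sub _ _).trans ?_
    rw [abs_mul]
    have h4 : |EA| * |EB - EB'| ≤ C * (C * ε ^ s) :=
      mul_le_mul hAb h2 (abs_nonneg _) hC.le
    have h5 : C * (3 * ε) ^ s ≤ C * (3 * ε ^ s) := mul_le_mul_of_nonneg_left h3 hC.le
    linarith
  · rw [abs_mul]
    have := mul_le_mul hAb hBb (abs_nonneg _) hC.le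
    linarith

/-! ### Reproducing vectors of the space of elliptic polynomials -/

/-- The vector representing the evaluation of the homogenized polynomial at `(u, v)`. -/
def veronese (n : ℕ) (u v : ℂ) : Coeff n :=
  WithLp.toLp 2 fun j : Fin (n + 1) =>
    (starRingEnd ℂ) ((Real.sqrt (n.choose (j : ℕ)) : ℂ) * u ^ (j : ℕ) * v ^ (n - j))

theorem inner_veronese (n : ℕ) (u v : ℂ) (a : Coeff n) :
    inner ℂ (veronese n u v) a =
      ∑ j : Fin (n + 1), a j * ((Real.sqrt (n.choose (j : ℕ)) : ℂ) * u ^ (j : ℕ) * v ^ (n - j)) := by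
  rw [PiLp.inner_apply]
  refine Finset.sum_congr rfl fun j _ => ?_
  simp [veronese]

/-- The binomial theorem. The weights `√(n choose j)` make the kernel the `n`-th power of the
Hermitian form on `ℂ²`, so that all estimates reduce to the geometry of the sphere. -/
theorem inner_veronese_veronese (n : ℕ) (u v u' v' : ℂ) :
    inner ℂ (veronese n u v) (veronese n u' v') =
      (u * (starRingEnd ℂ) u' + v * (starRingEnd ℂ) v') ^ n := by
  rw [inner_veronese, add_pow, Finset.sum_range]
  refine Finset.sum_congr rfl fun j _ => ?_
  have h : ((Real.sqrt (n.choose (j : ℕ)) : ℝ) : ℂ) * (Real.sqrt (n.choose (j : ℕ)) : ℝ)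
      = (n.choose (j : ℕ) : ℂ) := by
    rw [← Complex.ofReal_mul, Real.mul_self_sqrt (by positivity)]; simp
  rw [← h]
  simp only [veronese, map_mul, map_pow, Complex.conj_ofReal]
  ring

theorem norm_veronese_sq (n : ℕ) (u v : ℂ) :
    ‖veronese n u v‖ ^ 2 = (‖u‖ ^ 2 + ‖v‖ ^ 2) ^ n := by
  have h := inner_veronese_veronese n u v u v
  rw [inner_self_eq_norm_sq_to_K, Complex.mul_conj, Complex.mul_conj, Complex.normSq_eq_norm_sq,
    Complex.normSq_eq_norm_sq] at h
  apply Complex.ofReal_injective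
  push_cast at h ⊢
  exact h

theorem inner_veronese_mul (n : ℕ) (c u v : ℂ) (a : Coeff n) :
    inner ℂ (veronese n (c * u) (c * v)) a = c ^ n * inner ℂ (veronese n u v) a := by
  rw [inner_veronese, inner_veronese, Finset.mul_sum]
  refine Finset.sum_congr rfl fun j _ => ?_
  have hj : c ^ n = c ^ (j : ℕ) * c ^ (n - j) := by rw [← pow_add]; congr 1; omega
  rw [mul_pow, mul_pow, hj]
  ring

/-- `√(1 + |z|²)`. -/
def japanese (z : ℂ) : ℝ := Real.sqrt (1 + ‖z‖ ^ 2)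

theorem japanese_pos (z : ℂ) : 0 < japanese z := Real.sqrt_pos.mpr (by positivity)

theorem japanese_sq (z : ℂ) : japanese z ^ 2 = 1 + ‖z‖ ^ 2 := Real.sq_sqrt (by positivity)

/-- Half of the chordal distance. -/
def chord (z x : ℂ) : ℝ := ‖z - x‖ / (japanese z * japanese x)

theorem chord_nonneg (z x : ℂ) : 0 ≤ chord z x := by
  have := japanese_pos z; have := japanese_pos x; unfold chord; positivity

theorem chord_comm (z x : ℂ) : chord z x = chord x z := by
  unfold chord; rw [norm_sub_rev, mul_comm]

theorem chord_pos {z x : ℂ} (h : z ≠ x) : 0 < chord z x := by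
  have := japanese_pos z; have := japanese_pos x
  have : 0 < ‖z - x‖ := norm_pos_iff.mpr (sub_ne_zero.mpr h)
  unfold chord; positivity

theorem sphDist_eq (z x : ℂ) : sphDist z x = 2 * chord z x := by
  unfold sphDist chord japanese; ring

/-- The unit vector representing the evaluation of `f̂_n` at `z`. -/
def evalVec (n : ℕ) (z : ℂ) : Coeff n := veronese n (z / japanese z) (1 / japanese z)

theorem norm_sq_add_norm_sq_japanese (z : ℂ) :
    ‖z / (japanese z : ℂ)‖ ^ 2 + ‖1 / (japanese z : ℂ)‖ ^ 2 = 1 := by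
  have h := japanese_pos z
  rw [norm_div, norm_div, Complex.norm_real, Real.norm_of_nonneg h.le, norm_one, div_pow, div_pow,
    japanese_sq]
  have : 0 < 1 + ‖z‖ ^ 2 := by positivity
  field_simp
  ring

theorem norm_evalVec (n : ℕ) (z : ℂ) : ‖evalVec n z‖ = 1 := by
  have h := norm_veronese_sq n (z / japanese z) (1 / japanese z)
  rw [norm_sq_add_norm_sq_japanese, one_pow] at h
  exact (pow_eq_one_iff_of_nonneg (norm_nonneg _) two_ne_zero).mp h

theorem hatPoly_eq_inner (n : ℕ) (a : Coeff n) (z : ℂ) :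
    hatPoly n a z = inner ℂ (evalVec n z) a := by
  have h := japanese_pos z
  have hc : (japanese z : ℂ) ≠ 0 := by exact_mod_cast h.ne'
  have e : evalVec n z = veronese n ((japanese z : ℂ)⁻¹ * z) ((japanese z : ℂ)⁻¹ * 1) := by
    unfold evalVec; congr 1 <;> ring
  rw [e, inner_veronese_mul, inner_veronese, hatPoly, poly]
  have hp : ((1 + ‖z‖ ^ 2) ^ ((n : ℝ) / 2) : ℝ) = japanese z ^ n := by
    rw [← japanese_sq, ← Real.rpow_natCast, ← Real.rpow_mul h.le, ← Real.rpow_natCast]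
    congr 1; push_cast; ring
  rw [hp, div_eq_mul_inv, mul_comm]
  congr 1
  · push_cast; rw [inv_pow]
  · refine Finset.sum_congr rfl fun j _ => ?_
    ring

/-- Lagrange's identity for `(z, 1)` and `(x, 1)`: `chord z x` is the sine of the angle between the
lines that they span. -/
theorem norm_sq_one_add_conj_mul (z x : ℂ) :
    ‖1 + (starRingEnd ℂ) z * x‖ ^ 2 = (1 - chord z x ^ 2) * (japanese z * japanese x) ^ 2 := by
  have hz := japanese_pos z
  have hx := japanese_pos x
  have h : (1 - chord z x ^ 2) * (japanese z * japanese x) ^ 2 =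
      japanese z ^ 2 * japanese x ^ 2 - ‖z - x‖ ^ 2 := by
    unfold chord; field_simp
  rw [h, japanese_sq, japanese_sq, ← Complex.normSq_eq_norm_sq, ← Complex.normSq_eq_norm_sq,
    ← Complex.normSq_eq_norm_sq, ← Complex.normSq_eq_norm_sq]
  simp only [Complex.normSq_apply, Complex.add_re, Complex.add_im, Complex.sub_re, Complex.sub_im,
    Complex.mul_re, Complex.mul_im, Complex.conj_re, Complex.conj_im, Complex.one_re,
    Complex.one_im]
  ring

theorem chord_sq_le_one (z x : ℂ) : chord z x ^ 2 ≤ 1 := by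
  have h := norm_sq_one_add_conj_mul z x
  have hz := japanese_pos z
  have hx := japanese_pos x
  by_contra hc
  push Not at hc
  have h1 : 0 ≤ ‖1 + (starRingEnd ℂ) z * x‖ ^ 2 := by positivity
  have h2 : 0 < (japanese z * japanese x) ^ 2 := by positivity
  rw [h] at h1
  nlinarith

theorem chord_le_one (z x : ℂ) : chord z x ≤ 1 := by
  have := chord_sq_le_one z x
  nlinarith [chord_nonneg z x]

theorem norm_inner_evalVec (n : ℕ) (z x : ℂ) :
    ‖inner ℂ (evalVec n x) (evalVec n z)‖ ^ 2 = (1 - chord z x ^ 2) ^ n := by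
  have hz := japanese_pos z
  have hx := japanese_pos x
  unfold evalVec
  rw [inner_veronese_veronese, norm_pow, ← pow_mul, mul_comm n 2, pow_mul]
  congr 1
  have e : x / (japanese x : ℂ) * (starRingEnd ℂ) (z / (japanese z : ℂ)) +
      1 / (japanese x : ℂ) * (starRingEnd ℂ) (1 / (japanese z : ℂ)) =
      (1 + (starRingEnd ℂ) z * x) / ((japanese z * japanese x : ℝ) : ℂ) := by
    have hzc : (japanese z : ℂ) ≠ 0 := by exact_mod_cast hz.ne'
    have hxc : (japanese x : ℂ) ≠ 0 := by exact_mod_cast hx.ne'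
    simp only [map_div₀, Complex.conj_ofReal, map_one]
    push_cast
    field_simp
    ring
  rw [e, norm_div, div_pow, norm_sq_one_add_conj_mul, Complex.norm_real,
    Real.norm_of_nonneg (by positivity)]
  field_simp

/-- Bombieri's inequality: the product of homogeneous polynomials is bounded by the product of
their norms. -/
theorem exists_product (n₁ n₂ : ℕ) (a : Coeff n₁) (b : Coeff n₂) :
    ∃ c : Coeff (n₁ + n₂), ‖c‖ ≤ ‖a‖ * ‖b‖ ∧ ∀ u v : ℂ,
      inner ℂ (veronese (n₁ + n₂) u v) c =
        inner ℂ (veronese n₁ u v) a * inner ℂ (veronese n₂ u v) b := by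
  classical
  set g : Fin (n₁ + 1) × Fin (n₂ + 1) → Fin (n₁ + n₂ + 1) :=
    fun p => ⟨(p.1 : ℕ) + p.2, by omega⟩ with hg
  set A : Fin (n₁ + 1) × Fin (n₂ + 1) → ℝ :=
    fun p => Real.sqrt (n₁.choose p.1) * Real.sqrt (n₂.choose p.2) with hA
  have hCpos : ∀ k : Fin (n₁ + n₂ + 1), 0 < ((n₁ + n₂).choose (k : ℕ) : ℝ) := fun k => by
    exact_mod_cast Nat.choose_pos (by omega)
  set c : Coeff (n₁ + n₂) := WithLp.toLp 2 fun k =>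
    (∑ p ∈ Finset.univ with g p = k, (A p : ℂ) * (a p.1 * b p.2)) /
      (Real.sqrt ((n₁ + n₂).choose (k : ℕ)) : ℂ) with hc
  refine ⟨c, ?_, ?_⟩
  -- Vandermonde's identity: the squared weights over one output degree sum to at most its binomial
  -- coefficient, so Cauchy–Schwarz in each coefficient loses no constant.
  · have hfib : ∀ k, ∑ p ∈ Finset.univ with g p = k, A p ^ 2 ≤ ((n₁ + n₂).choose (k : ℕ) : ℝ) := by
      intro k
      rw [Nat.add_choose_eq]
      push_cast
      have e : ∀ p, A p ^ 2 = (fun q : ℕ × ℕ => (n₁.choose q.1 : ℝ) * (n₂.choose q.2 : ℝ))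
          ((p.1 : ℕ), (p.2 : ℕ)) := fun p => by
        simp only [hA, mul_pow]
        rw [Real.sq_sqrt (by positivity), Real.sq_sqrt (by positivity)]
      simp_rw [e]
      have hinj : Set.InjOn (fun p : Fin (n₁ + 1) × Fin (n₂ + 1) => ((p.1 : ℕ), (p.2 : ℕ)))
          ((Finset.univ.filter fun p => g p = k) : Finset _) := by
        intro p _ q _ h
        simp only [Prod.mk.injEq] at h
        exact Prod.ext (Fin.ext h.1) (Fin.ext h.2)
      rw [← Finset.sum_image (f := fun q : ℕ × ℕ => (n₁.choose q.1 : ℝ) * (n₂.choose q.2 : ℝ)) hinj]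
      refine Finset.sum_le_sum_of_subset_of_nonneg ?_ fun q _ _ => by positivity
      intro q hq
      obtain ⟨p, hp, rfl⟩ := Finset.mem_image.mp hq
      rw [Finset.HasAntidiagonal.mem_antidiagonal]
      have := (Finset.mem_filter.mp hp).2
      rw [← this]
    have hck : ∀ k, ‖c k‖ ^ 2 ≤ ∑ p ∈ Finset.univ with g p = k, (‖a p.1‖ * ‖b p.2‖) ^ 2 := by
      intro k
      have h1 : ‖c k‖ = ‖∑ p ∈ Finset.univ with g p = k, (A p : ℂ) * (a p.1 * b p.2)‖ /
          Real.sqrt ((n₁ + n₂).choose (k : ℕ)) := by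
        simp only [hc]
        rw [norm_div, Complex.norm_real, Real.norm_of_nonneg (Real.sqrt_nonneg _)]
      rw [h1, div_pow, Real.sq_sqrt (hCpos k).le, div_le_iff₀ (hCpos k)]
      have h2 : ‖∑ p ∈ Finset.univ with g p = k, (A p : ℂ) * (a p.1 * b p.2)‖ ≤
          ∑ p ∈ Finset.univ with g p = k, A p * (‖a p.1‖ * ‖b p.2‖) := by
        refine (norm_sum_le _ _).trans (Finset.sum_le_sum fun p _ => ?_)
        rw [norm_mul, norm_mul, Complex.norm_real, Real.norm_of_nonneg (by positivity)]
      have h3 := Finset.sum_mul_sq_le_sq_mul_sq (Finset.univ.filter fun p => g p = k) A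
        (fun p => ‖a p.1‖ * ‖b p.2‖)
      refine (pow_le_pow_left₀ (norm_nonneg _) h2 2).trans (h3.trans ?_)
      rw [mul_comm]
      refine mul_le_mul_of_nonneg_left (hfib k) (Finset.sum_nonneg fun p _ => by positivity)
    have hsq : ‖c‖ ^ 2 ≤ (‖a‖ * ‖b‖) ^ 2 := by
      rw [EuclideanSpace.norm_sq_eq, mul_pow, EuclideanSpace.norm_sq_eq, EuclideanSpace.norm_sq_eq]
      refine (Finset.sum_le_sum fun k _ => hck k).trans ?_
      rw [Finset.sum_fiberwise, Finset.sum_mul_sum, ← Finset.univ_product_univ,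
        Finset.sum_product]
      refine le_of_eq (Finset.sum_congr rfl fun i _ => Finset.sum_congr rfl fun j _ => ?_)
      rw [mul_pow]
    exact le_of_sq_le_sq hsq (by positivity) 
  · intro u v
    rw [inner_veronese, inner_veronese, inner_veronese, Finset.sum_mul_sum, ← Finset.sum_product',
      Finset.univ_product_univ, ← Finset.sum_fiberwise _ g]
    refine Finset.sum_congr rfl fun k _ => ?_
    have hk : (Real.sqrt ((n₁ + n₂).choose (k : ℕ)) : ℂ) ≠ 0 := by
      exact_mod_cast (Real.sqrt_pos.mpr (hCpos k)).ne'
    simp only [hc]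
    rw [mul_assoc, ← mul_assoc, div_mul_cancel₀ _ hk, Finset.sum_mul]
    refine Finset.sum_congr rfl fun p hp => ?_
    have hpk : (p.1 : ℕ) + p.2 = k := by
      have := (Finset.mem_filter.mp hp).2
      rw [← this]
    have e1 : n₁ + n₂ - k = (n₁ - p.1) + (n₂ - p.2) := by omega
    rw [e1, ← hpk, pow_add, pow_add]
    simp only [hA]
    push_cast
    ring

/-! ### Interpolation: lower bounds -/

/-- The extremal vector is the normalized component of `evalVec q z` orthogonal to `evalVec q x`;
its value at `z` is the norm of that component. -/
theorem exists_vanishing_one (q : ℕ) (x z : ℂ) :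
    ∃ b : Coeff q, ‖b‖ ≤ 1 ∧ inner ℂ (evalVec q x) b = 0 ∧
      Real.sqrt (1 - (1 - chord z x ^ 2) ^ q) ≤ ‖inner ℂ (evalVec q z) b‖ := by
  set k : ℂ := inner ℂ (evalVec q x) (evalVec q z) with hk
  set u : Coeff q := evalVec q z - k • evalVec q x with hu
  have hxx : inner ℂ (evalVec q x) (evalVec q x) = (1 : ℂ) := by
    rw [inner_self_eq_norm_sq_to_K, norm_evalVec]; simp
  have hzz : inner ℂ (evalVec q z) (evalVec q z) = (1 : ℂ) := by
    rw [inner_self_eq_norm_sq_to_K, norm_evalVec]; simp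
  have hxu : inner ℂ (evalVec q x) u = 0 := by
    rw [hu, inner_sub_right, inner_smul_right, hxx, ← hk]; ring
  have hkn : ‖k‖ ^ 2 = (1 - chord z x ^ 2) ^ q := norm_inner_evalVec q z x
  have hzu : inner ℂ (evalVec q z) u = ((1 - (1 - chord z x ^ 2) ^ q : ℝ) : ℂ) := by
    have h1 : inner ℂ (evalVec q z) (evalVec q x) = (starRingEnd ℂ) k := by
      rw [hk, inner_conj_symm]
    rw [hu, inner_sub_right, inner_smul_right, hzz, h1, Complex.mul_conj,
      Complex.normSq_eq_norm_sq, hkn]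
    push_cast; ring
  have huu : ‖u‖ ^ 2 = 1 - (1 - chord z x ^ 2) ^ q := by
    have h1 : inner ℂ u u = inner ℂ (evalVec q z) u := by
      nth_rw 1 [hu]
      rw [inner_sub_left, inner_smul_left, hxu, mul_zero, sub_zero]
    rw [hzu, inner_self_eq_norm_sq_to_K] at h1
    apply Complex.ofReal_injective
    push_cast at h1 ⊢
    exact h1
  rw [← huu, Real.sqrt_sq (norm_nonneg _)]
  rcases (norm_nonneg u).eq_or_lt with h0 | h0
  · exact ⟨0, by simp, by simp, by simp [← h0]⟩
  · have hc : (‖u‖ : ℂ) ≠ 0 := by exact_mod_cast h0.ne'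
    refine ⟨((‖u‖ : ℂ)⁻¹) • u, ?_, ?_, ?_⟩
    · rw [norm_smul, norm_inv, Complex.norm_real, norm_norm, inv_mul_cancel₀ h0.ne']
    · rw [inner_smul_right, hxu, mul_zero]
    · rw [inner_smul_right, hzu, ← huu, norm_mul, norm_inv, Complex.norm_real, norm_norm,
        Complex.norm_real, Real.norm_of_nonneg (by positivity)]
      apply le_of_eq
      field_simp

/-- Multiply vectors of degree `q`, one for each point of `S`: values multiply, and by Bombieri's
inequality the norm stays at most one. The remaining degree is filled in the base case by the
evaluation vector at `z`, which has value 1 there. -/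
theorem exists_vanishing_pow (q : ℕ) (S : Finset ℂ) (z : ℂ) : ∀ n : ℕ, S.card * q ≤ n →
    ∃ e : Coeff n, ‖e‖ ≤ 1 ∧ (∀ x ∈ S, inner ℂ (evalVec n x) e = 0) ∧
      ∏ x ∈ S, Real.sqrt (1 - (1 - chord z x ^ 2) ^ q) ≤ ‖inner ℂ (evalVec n z) e‖ := by
  classical
  induction S using Finset.induction_on with
  | empty =>
    intro n _
    refine ⟨evalVec n z, (norm_evalVec n z).le, by simp, ?_⟩
    rw [inner_self_eq_norm_sq_to_K, norm_evalVec]; simp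
  | insert x S hx ih =>
    intro n hn
    rw [Finset.card_insert_of_notMem hx, add_mul, one_mul] at hn
    obtain ⟨k, rfl⟩ : ∃ k, n = k + q := ⟨n - q, by omega⟩
    obtain ⟨e, he1, he0, hez⟩ := ih k (by omega)
    obtain ⟨b, hb1, hb0, hbz⟩ := exists_vanishing_one q x z
    obtain ⟨c, hc, hmul⟩ := exists_product k q e b
    have hmul' : ∀ y, inner ℂ (evalVec (k + q) y) c =
        inner ℂ (evalVec k y) e * inner ℂ (evalVec q y) b := fun y => hmul _ _
    refine ⟨c, hc.trans (mul_le_one₀ he1 (norm_nonneg _) hb1), ?_, ?_⟩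
    · intro y hy
      rw [hmul']
      rcases Finset.mem_insert.mp hy with rfl | hy
      · rw [hb0, mul_zero]
      · rw [he0 y hy, zero_mul]
    · rw [Finset.prod_insert hx, hmul', norm_mul, mul_comm]
      exact mul_le_mul hez hbz (Real.sqrt_nonneg _) (norm_nonneg _)

/-- The chordal distance in units of `1/√n`, truncated at `1`. -/
def trunc (n : ℕ) (z x : ℂ) : ℝ := min 1 (Real.sqrt n * chord z x)

theorem trunc_nonneg (n : ℕ) (z x : ℂ) : 0 ≤ trunc n z x :=
  le_min zero_le_one (mul_nonneg (Real.sqrt_nonneg _) (chord_nonneg _ _))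

theorem trunc_le_one (n : ℕ) (z x : ℂ) : trunc n z x ≤ 1 := min_le_left _ _

theorem trunc_comm (n : ℕ) (z x : ℂ) : trunc n z x = trunc n x z := by
  unfold trunc; rw [chord_comm]

theorem trunc_pos {n : ℕ} (hn : 1 ≤ n) {z x : ℂ} (h : z ≠ x) : 0 < trunc n z x := by
  have : (0 : ℝ) < Real.sqrt n := Real.sqrt_pos.mpr (by exact_mod_cast hn)
  exact lt_min one_pos (mul_pos this (chord_pos h))

/-- The rounded quotient `n / N` is at least `n/(2N)`, so `t = τ²/(2N)` is at most `q σ²` and `(1 -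
σ²)^q ≤ exp(-t)`. The truncation ensures `t ≤ 1`, where `exp(-t) ≤ 1 - t/2`. -/
theorem trunc_div_le (N n : ℕ) (hN : 1 ≤ N) (hn : N ≤ n) (z x : ℂ) :
    trunc n z x / (2 * N) ≤ Real.sqrt (1 - (1 - chord z x ^ 2) ^ (n / N)) := by
  have hNR : (1 : ℝ) ≤ N := by exact_mod_cast hN
  set q := n / N with hq
  set σ := chord z x with hσ
  set τ := trunc n z x with hτ
  have hτ0 : 0 ≤ τ := trunc_nonneg _ _ _
  have hτ1 : τ ≤ 1 := trunc_le_one _ _ _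
  have hnq : (n : ℝ) ≤ 2 * N * q := by
    have h1 : n < N * (q + 1) := by
      rw [hq, mul_comm]; exact Nat.lt_mul_of_div_lt (Nat.lt_succ_self _) (by omega)
    have h2 : 1 ≤ q := (Nat.one_le_div_iff (by omega)).mpr hn
    have h3 : n ≤ 2 * N * q := by nlinarith
    exact_mod_cast h3
  have hτσ : τ ^ 2 ≤ n * σ ^ 2 := by
    have h1 : τ ≤ Real.sqrt n * σ := min_le_right _ _
    have := pow_le_pow_left₀ hτ0 h1 2
    rwa [mul_pow, Real.sq_sqrt (by positivity)] at this
  set t := τ ^ 2 / (2 * N) with ht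
  have ht0 : 0 ≤ t := by positivity
  have ht1 : t ≤ 1 := by
    rw [ht, div_le_one (by positivity)]; nlinarith
  have htq : t ≤ q * σ ^ 2 := by
    rw [ht, div_le_iff₀ (by positivity)]
    nlinarith [sq_nonneg σ]
  have hexp : (1 - σ ^ 2) ^ q ≤ Real.exp (-t) := by
    have h1 : 1 - σ ^ 2 ≤ Real.exp (-σ ^ 2) := by
      have := Real.add_one_le_exp (-σ ^ 2); linarith
    have h2 : 0 ≤ 1 - σ ^ 2 := by have := chord_sq_le_one z x; linarith
    calc (1 - σ ^ 2) ^ q ≤ Real.exp (-σ ^ 2) ^ q := pow_le_pow_left₀ h2 h1 q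
      _ = Real.exp (-(q * σ ^ 2)) := by rw [← Real.exp_nat_mul]; congr 1; ring
      _ ≤ Real.exp (-t) := Real.exp_le_exp.mpr (by linarith)
  have hexp2 : Real.exp (-t) ≤ 1 - t / 2 := by
    rw [Real.exp_neg]
    have h1 := Real.add_one_le_exp t
    have h2 : (Real.exp t)⁻¹ ≤ (t + 1)⁻¹ := inv_anti₀ (by linarith) h1
    refine h2.trans ?_
    rw [inv_le_iff_one_le_mul₀ (by linarith)]
    nlinarith
  refine Real.le_sqrt_of_sq_le ?_
  have h5 : (τ / (2 * N)) ^ 2 ≤ t / 2 := by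
    rw [ht, div_pow, div_div, div_le_div_iff₀ (by positivity) (by positivity)]
    exact mul_le_mul_of_nonneg_left (by nlinarith) (by positivity)
  linarith

/-- A vector vanishing on a finite set, of norm at most one, with the largest possible value at
another point, up to a constant. -/
theorem exists_vanishing (N : ℕ) (hN : 1 ≤ N) (S : Finset ℂ) (hS : S.card ≤ N) (z : ℂ) (n : ℕ)
    (hn : N ≤ n) :
    ∃ e : Coeff n, ‖e‖ ≤ 1 ∧ (∀ x ∈ S, inner ℂ (evalVec n x) e = 0) ∧
      ∏ x ∈ S, (trunc n z x / (2 * N)) ≤ ‖inner ℂ (evalVec n z) e‖ := by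
  obtain ⟨e, h1, h2, h3⟩ := exists_vanishing_pow (n / N) S z n
    ((Nat.mul_le_mul_right _ hS).trans (Nat.mul_div_le n N))
  refine ⟨e, h1, h2, le_trans ?_ h3⟩
  exact Finset.prod_le_prod (fun x _ => div_nonneg (trunc_nonneg _ _ _) (by positivity))
    fun x _ => trunc_div_le N n hN hn z x

/-! ### Schwarz's lemma: upper bounds -/

/-- Divide out the roots one at a time. On the circle of radius `2r` a linear factor is at least `r`
in modulus, so by the maximum principle the quotient is at most `M / r` on the disk; at `0` the
factor is `‖t i‖`. -/
theorem norm_eval_zero_le_of_roots {ι : Type} (T : Finset ι) (t : ι → ℂ) (ht : Set.InjOn t T)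
    {r : ℝ} (hr : 0 < r) (htr : ∀ i ∈ T, ‖t i‖ ≤ r) :
    ∀ (P : Polynomial ℂ) (M : ℝ), (∀ i ∈ T, P.eval (t i) = 0) →
      (∀ ζ : ℂ, ‖ζ‖ ≤ 2 * r → ‖P.eval ζ‖ ≤ M) → ‖P.eval 0‖ ≤ M * ∏ i ∈ T, (‖t i‖ / r) := by
  classical
  induction T using Finset.induction_on with
  | empty =>
    intro P M _ hM
    simpa using hM 0 (by simp; positivity)
  | insert i T hi ih =>
    intro P M hroot hM
    obtain ⟨Q, rfl⟩ := Polynomial.dvd_iff_isRoot.mpr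
      (show P.IsRoot (t i) from hroot i (Finset.mem_insert_self _ _))
    have hev : ∀ ζ, ((Polynomial.X - Polynomial.C (t i)) * Q).eval ζ = (ζ - t i) * Q.eval ζ :=
      fun ζ => by simp
    have hti := htr i (Finset.mem_insert_self _ _)
    have hQM : ∀ ζ : ℂ, ‖ζ‖ ≤ 2 * r → ‖Q.eval ζ‖ ≤ M / r := by
      have hfr : ∀ ζ ∈ frontier (Metric.ball (0 : ℂ) (2 * r)), ‖Q.eval ζ‖ ≤ M / r := by
        intro ζ hζ
        rw [frontier_ball _ (by positivity), mem_sphere_zero_iff_norm] at hζ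
        have h1 := hM ζ hζ.le
        rw [hev, norm_mul] at h1
        have h2 : r ≤ ‖ζ - t i‖ := by
          have := norm_sub_norm_le ζ (t i); linarith
        rw [le_div_iff₀ hr, mul_comm]
        exact (mul_le_mul_of_nonneg_right h2 (norm_nonneg _)).trans h1
      intro ζ hζ
      refine Complex.norm_le_of_forall_mem_frontier_norm_le Metric.isBounded_ball
        (Q.differentiable.diffContOnCl) hfr ?_
      rw [closure_ball _ (by positivity)]
      simpa using hζ
    have hQroot : ∀ j ∈ T, Q.eval (t j) = 0 := by
      intro j hj
      have h1 := hroot j (Finset.mem_insert_of_mem hj)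
      rw [hev] at h1
      rcases mul_eq_zero.mp h1 with h | h
      · have := ht (Finset.mem_coe.mpr (Finset.mem_insert_of_mem hj))
          (Finset.mem_coe.mpr (Finset.mem_insert_self i T)) (sub_eq_zero.mp h)
        subst this; exact absurd hj hi
      · exact h
    have h := ih (ht.mono (by intro j hj; exact Finset.mem_coe.mpr (Finset.mem_insert_of_mem hj)))
      (fun j hj => htr j (Finset.mem_insert_of_mem hj)) Q (M / r) hQroot hQM
    rw [hev, norm_mul, zero_sub, norm_neg, Finset.prod_insert hi]
    refine (mul_le_mul_of_nonneg_left h (norm_nonneg _)).trans (le_of_eq ?_)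
    ring

/-- The vector representing the evaluation at the point of a disk around `z`, with local
coordinate `ζ`. -/
def diskVec (n : ℕ) (z ζ : ℂ) : Coeff n :=
  veronese n ((z + ζ) / japanese z) ((1 - (starRingEnd ℂ) z * ζ) / japanese z)

theorem diskVec_zero (n : ℕ) (z : ℂ) : diskVec n z 0 = evalVec n z := by
  simp [diskVec, evalVec]

/-- The pair is the image of `(ζ, 1)` under a unitary map of `ℂ²` which takes `(0, 1)` to the unit
vector in the direction of `(z, 1)`. -/
theorem norm_sq_add_norm_sq_disk (z ζ : ℂ) :
    ‖(z + ζ) / (japanese z : ℂ)‖ ^ 2 + ‖(1 - (starRingEnd ℂ) z * ζ) / (japanese z : ℂ)‖ ^ 2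
      = 1 + ‖ζ‖ ^ 2 := by
  have h := japanese_pos z
  have h2 : 0 < 1 + ‖z‖ ^ 2 := by positivity
  have h3 : ‖z + ζ‖ ^ 2 + ‖1 - (starRingEnd ℂ) z * ζ‖ ^ 2 = (1 + ‖z‖ ^ 2) * (1 + ‖ζ‖ ^ 2) := by
    rw [← Complex.normSq_eq_norm_sq, ← Complex.normSq_eq_norm_sq, ← Complex.normSq_eq_norm_sq,
      ← Complex.normSq_eq_norm_sq]
    simp only [Complex.normSq_apply, Complex.add_re, Complex.add_im, Complex.sub_re,
      Complex.sub_im, Complex.mul_re, Complex.mul_im, Complex.conj_re, Complex.conj_im,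
      Complex.one_re, Complex.one_im]
    ring
  rw [norm_div, norm_div, Complex.norm_real, Real.norm_of_nonneg h.le, div_pow, div_pow,
    japanese_sq, ← add_div, h3]
  field_simp

theorem norm_diskVec_le {n : ℕ} (hn : 1 ≤ n) (z : ℂ) {ζ : ℂ} (hζ : ‖ζ‖ ≤ 2 / Real.sqrt n) :
    ‖diskVec n z ζ‖ ≤ Real.exp 2 := by
  have hnR : (0 : ℝ) < n := by exact_mod_cast hn
  have h1 : ‖ζ‖ ^ 2 ≤ 4 / n := by
    have := pow_le_pow_left₀ (norm_nonneg _) hζ 2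
    rw [div_pow, Real.sq_sqrt hnR.le] at this
    norm_num at this ⊢; exact this
  have h2 : ‖diskVec n z ζ‖ ^ 2 ≤ Real.exp 2 ^ 2 := by
    rw [diskVec, norm_veronese_sq, norm_sq_add_norm_sq_disk]
    calc (1 + ‖ζ‖ ^ 2) ^ n ≤ Real.exp (4 / n) ^ n := by
          refine pow_le_pow_left₀ (by positivity) ?_ n
          have := Real.add_one_le_exp ((4 : ℝ) / n)
          linarith
      _ = Real.exp 2 ^ 2 := by
          rw [← Real.exp_nat_mul, ← Real.exp_nat_mul]; congr 1; field_simp; norm_num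
  exact le_of_sq_le_sq h2 (Real.exp_pos 2).le

theorem exists_polynomial_eval_eq (n : ℕ) (z : ℂ) (a : Coeff n) :
    ∃ P : Polynomial ℂ, ∀ ζ, P.eval ζ = inner ℂ (diskVec n z ζ) a := by
  refine ⟨∑ j : Fin (n + 1), Polynomial.C (a j * (Real.sqrt (n.choose (j : ℕ)) : ℂ)) *
    (Polynomial.C ((japanese z : ℂ)⁻¹) * (Polynomial.C z + Polynomial.X)) ^ (j : ℕ) *
    (Polynomial.C ((japanese z : ℂ)⁻¹) *
      (1 - Polynomial.C ((starRingEnd ℂ) z) * Polynomial.X)) ^ (n - j), fun ζ => ?_⟩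
  rw [diskVec, inner_veronese, Polynomial.eval_finsetSum]
  refine Finset.sum_congr rfl fun j _ => ?_
  simp
  ring

/-- The local coordinate at `z` of the point `x`. -/
def diskCoord (z x : ℂ) : ℂ := (x - z) / (1 + (starRingEnd ℂ) z * x)

theorem norm_one_add_conj_mul_ge {z x : ℂ} (h : chord z x ≤ 1 / 2) :
    1 / 2 * (japanese z * japanese x) ≤ ‖1 + (starRingEnd ℂ) z * x‖ := by
  have h1 := norm_sq_one_add_conj_mul z x
  have hz := japanese_pos z
  have hx := japanese_pos x
  refine le_of_sq_le_sq ?_ (norm_nonneg _)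
  rw [h1, mul_pow]
  have := chord_nonneg z x
  refine mul_le_mul_of_nonneg_right ?_ (by positivity)
  nlinarith

theorem norm_diskCoord_le {z x : ℂ} (h : chord z x ≤ 1 / 2) :
    ‖diskCoord z x‖ ≤ 2 * chord z x := by
  have hz := japanese_pos z
  have hx := japanese_pos x
  have h1 := norm_one_add_conj_mul_ge h
  have h2 : 0 < japanese z * japanese x := by positivity
  have h3 : 0 < ‖1 + (starRingEnd ℂ) z * x‖ := by linarith
  rw [diskCoord, norm_div, norm_sub_rev, div_le_iff₀ h3]
  have h4 : ‖z - x‖ = chord z x * (japanese z * japanese x) := by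
    unfold chord; field_simp
  rw [h4]
  nlinarith [chord_nonneg z x]

/-- In homogeneous coordinates, the point with local coordinate `diskCoord z x` is a multiple `c` of
the unit representative of `x`, so the two evaluations differ by the factor `c ^ n`. -/
theorem diskVec_diskCoord (n : ℕ) {z x : ℂ} (h : 1 + (starRingEnd ℂ) z * x ≠ 0) (a : Coeff n)
    (ha : inner ℂ (evalVec n x) a = 0) : inner ℂ (diskVec n z (diskCoord z x)) a = 0 := by
  have hz := japanese_pos z
  have hx := japanese_pos x
  have hzc : (japanese z : ℂ) ≠ 0 := by exact_mod_cast hz.ne'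
  have hxc : (japanese x : ℂ) ≠ 0 := by exact_mod_cast hx.ne'
  have hsq : (1 : ℂ) + z * (starRingEnd ℂ) z = (japanese z : ℂ) ^ 2 := by
    rw [Complex.mul_conj, Complex.normSq_eq_norm_sq, ← Complex.ofReal_pow, japanese_sq]
    push_cast; rfl
  obtain ⟨d, hd⟩ : ∃ d, d = 1 + (starRingEnd ℂ) z * x := ⟨_, rfl⟩
  rw [← hd] at h
  set c : ℂ := japanese z * japanese x / d with hc
  have e1 : (z + diskCoord z x) / (japanese z : ℂ) = c * (x / (japanese x : ℂ)) := by
    rw [hc, diskCoord, ← hd]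
    field_simp
    linear_combination x * hsq + z * hd
  have e2 : (1 - (starRingEnd ℂ) z * diskCoord z x) / (japanese z : ℂ) =
      c * (1 / (japanese x : ℂ)) := by
    rw [hc, diskCoord, ← hd]
    field_simp
    linear_combination hsq + hd
  rw [diskVec, e1, e2, inner_veronese_mul]
  have : inner ℂ (veronese n (x / (japanese x : ℂ)) (1 / (japanese x : ℂ))) a = (0 : ℂ) := ha
  rw [this, mul_zero]

theorem diskCoord_injOn (z : ℂ) {x y : ℂ} (hx : 1 + (starRingEnd ℂ) z * x ≠ 0)
    (hy : 1 + (starRingEnd ℂ) z * y ≠ 0) (h : diskCoord z x = diskCoord z y) : x = y := by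
  have hz := japanese_pos z
  have hzc : (japanese z : ℂ) ^ 2 ≠ 0 := pow_ne_zero 2 (by exact_mod_cast hz.ne')
  have hsq : (1 : ℂ) + z * (starRingEnd ℂ) z = (japanese z : ℂ) ^ 2 := by
    rw [Complex.mul_conj, Complex.normSq_eq_norm_sq, ← Complex.ofReal_pow, japanese_sq]
    push_cast; rfl
  rw [diskCoord, diskCoord, div_eq_div_iff hx hy] at h
  have : (japanese z : ℂ) ^ 2 * (x - y) = 0 := by
    rw [← hsq]; linear_combination h
  exact sub_eq_zero.mp ((mul_eq_zero.mp this).resolve_left hzc)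

/-- A function which vanishes on `S` and is bounded near `z` is small at `z`, according to the
distances from `z` to `S`. -/
theorem norm_inner_evalVec_le_of_vanishing {n : ℕ} (hn : 1 ≤ n) (S : Finset ℂ) (z : ℂ)
    (a : Coeff n) (ha : ∀ x ∈ S, inner ℂ (evalVec n x) a = 0) {M : ℝ}
    (hM : ∀ ζ : ℂ, ‖ζ‖ ≤ 2 / Real.sqrt n → ‖inner ℂ (diskVec n z ζ) a‖ ≤ M) :
    ‖inner ℂ (evalVec n z) a‖ ≤ M * ∏ x ∈ S, (2 * trunc n z x) := by
  classical
  have hnR : (1 : ℝ) ≤ n := by exact_mod_cast hn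
  have hsn : 1 ≤ Real.sqrt n := Real.one_le_sqrt.mpr hnR
  have hM0 : 0 ≤ M := (norm_nonneg _).trans (hM 0 (by simp; positivity))
  obtain ⟨P, hP⟩ := exists_polynomial_eval_eq n z a
  -- Only points within `1/(2√n)` are used as zeros; for the others the factor `2 * trunc n z x` is
  -- at least 1 and may be inserted freely.
  set T := S.filter fun x => Real.sqrt n * chord z x ≤ 1 / 2 with hT
  have hTc : ∀ x ∈ T, chord z x ≤ 1 / 2 := fun x hx => by
    have := (Finset.mem_filter.mp hx).2
    nlinarith [chord_nonneg z x]
  have hTne : ∀ x ∈ T, 1 + (starRingEnd ℂ) z * x ≠ 0 := fun x hx h0 => by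
    have := norm_one_add_conj_mul_ge (hTc x hx)
    rw [h0, norm_zero] at this
    have := mul_pos (japanese_pos z) (japanese_pos x)
    linarith
  have hTt : ∀ x ∈ T, ‖diskCoord z x‖ / (1 / Real.sqrt n) ≤ 2 * trunc n z x := fun x hx => by
    have h1 := norm_diskCoord_le (hTc x hx)
    have h2 := (Finset.mem_filter.mp hx).2
    have h3 : trunc n z x = Real.sqrt n * chord z x := min_eq_right (by linarith)
    rw [h3, div_div_eq_mul_div, div_one]
    nlinarith
  have h := norm_eval_zero_le_of_roots T (diskCoord z)
    (fun x hx y hy h => diskCoord_injOn z (hTne x hx) (hTne y hy) h)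
    (r := 1 / Real.sqrt n) (by positivity)
    (fun x hx => by
      have h1 := hTt x hx
      have h2 := (Finset.mem_filter.mp hx).2
      have h3 : trunc n z x = Real.sqrt n * chord z x := min_eq_right (by linarith)
      rw [h3, div_le_iff₀ (by positivity)] at h1
      have : 0 < 1 / Real.sqrt n := by positivity
      nlinarith) P M
    (fun x hx => by
      rw [hP]
      exact diskVec_diskCoord n (hTne x hx) a (ha x (Finset.mem_filter.mp hx).1))
    (fun ζ hζ => by
      rw [hP]
      exact hM ζ (by rw [mul_one_div] at hζ; exact hζ))
  rw [hP, diskVec_zero] at h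
  refine h.trans (mul_le_mul_of_nonneg_left ?_ hM0)
  rw [← Finset.prod_filter_mul_prod_filter_not S fun x => Real.sqrt n * chord z x ≤ 1 / 2]
  have h1 : ∏ x ∈ T, ‖diskCoord z x‖ / (1 / Real.sqrt n) ≤ ∏ x ∈ T, (2 * trunc n z x) :=
    Finset.prod_le_prod (fun x _ => by positivity) hTt
  have h2 : 1 ≤ ∏ x ∈ S with ¬ Real.sqrt n * chord z x ≤ 1 / 2, (2 * trunc n z x) := by
    refine Finset.one_le_prod fun x hx => ?_
    have h3 := (Finset.mem_filter.mp hx).2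
    push Not at h3
    have : 1 / 2 ≤ trunc n z x := le_min (by norm_num) h3.le
    linarith
  have h0 : 0 ≤ ∏ x ∈ T, (2 * trunc n z x) :=
    Finset.prod_nonneg fun x _ => mul_nonneg zero_le_two (trunc_nonneg _ _ _)
  nlinarith

/-! ### Interpolation with norm control and almost orthogonality -/

/-- Newton interpolation, one point `z` at a time. The error of an interpolant on the other points
vanishes there, so by Schwarz's lemma its value at `z` is at most a constant times the product of
the truncated distances. The vector of `exists_vanishing` attains this product up to a constant,
hence the correcting coefficient is bounded even when points nearly collide. For Schwarz's lemma `h`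
must be controlled on disks, not only at the points. -/
theorem exists_interpolation (N : ℕ) (hN : 1 ≤ N) : ∃ C : ℝ, 0 < C ∧
    ∀ (n : ℕ) (S : Finset ℂ) (h : Coeff n) (M : ℝ), N ≤ n → S.card ≤ N →
      (∀ z ∈ S, ∀ ζ : ℂ, ‖ζ‖ ≤ 2 / Real.sqrt n → ‖inner ℂ (diskVec n z ζ) h‖ ≤ M) →
      0 ≤ M → ∃ e : Coeff n, ‖e‖ ≤ C * M ∧ ∀ x ∈ S, inner ℂ (evalVec n x) (h - e) = 0 := by
  classical
  have key : ∀ k : ℕ, ∃ C : ℝ, 0 < C ∧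
      ∀ (n : ℕ) (S : Finset ℂ) (h : Coeff n) (M : ℝ), N ≤ n → S.card ≤ N → S.card ≤ k →
        (∀ z ∈ S, ∀ ζ : ℂ, ‖ζ‖ ≤ 2 / Real.sqrt n → ‖inner ℂ (diskVec n z ζ) h‖ ≤ M) →
        0 ≤ M → ∃ e : Coeff n, ‖e‖ ≤ C * M ∧ ∀ x ∈ S, inner ℂ (evalVec n x) (h - e) = 0 := by
    intro k
    induction k with
    | zero =>
      refine ⟨1, one_pos, fun n S h M _ _ hS _ hM => ⟨0, by simpa using hM, ?_⟩⟩
      have : S = ∅ := Finset.card_eq_zero.mp (Nat.le_zero.mp hS)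
      simp [this]
    | succ k ih =>
      obtain ⟨C, hC, ih⟩ := ih
      -- The first term bounds the old interpolant; `1 + exp 2 * C` bounds the error on the disk
      -- around `z`; each remaining point contributes the ratio `4N` of `2 * trunc` to `trunc /
      -- (2N)`.
      refine ⟨C + (1 + Real.exp 2 * C) * (4 * N) ^ N, by positivity, ?_⟩
      intro n S h M hn hSN hS hM hM0
      rcases S.eq_empty_or_nonempty with rfl | ⟨z, hz⟩
      · exact ⟨0, by simp; positivity, by simp⟩
      have hn1 : 1 ≤ n := hN.trans hn
      have hT : (S.erase z).card ≤ k := by rw [Finset.card_erase_of_mem hz]; omega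
      have hTN : (S.erase z).card ≤ N := (Finset.card_erase_le).trans hSN
      obtain ⟨e, he, hv⟩ := ih n (S.erase z) h M hn hTN hT
        (fun x hx => hM x (Finset.mem_of_mem_erase hx)) hM0
      obtain ⟨e', he', hv', hb⟩ := exists_vanishing N hN (S.erase z) hTN z n hn
      have hup := norm_inner_evalVec_le_of_vanishing hn1 (S.erase z) z (h - e) hv
        (M := M + Real.exp 2 * (C * M)) (fun ζ hζ => by
          rw [inner_sub_right]
          refine (norm_sub_le _ _).trans (add_le_add (hM z hz ζ hζ) ?_)
          refine (norm_inner_le_norm _ _).trans ?_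
          exact mul_le_mul (norm_diskVec_le hn1 z hζ) he (norm_nonneg _) (Real.exp_pos 2).le)
      set P := ∏ x ∈ S.erase z, (trunc n z x / (2 * N)) with hP
      have hNR : (1 : ℝ) ≤ N := by exact_mod_cast hN
      have hPpos : 0 < P := Finset.prod_pos fun x hx =>
        div_pos (trunc_pos hn1 (Finset.ne_of_mem_erase hx).symm) (by positivity)
      have hPeq : ∏ x ∈ S.erase z, (2 * trunc n z x) ≤ (4 * N) ^ N * P := by
        have h1 : ∏ x ∈ S.erase z, (2 * trunc n z x) = (4 * N) ^ (S.erase z).card * P := by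
          rw [hP, ← Finset.prod_const, ← Finset.prod_mul_distrib]
          refine Finset.prod_congr rfl fun x _ => ?_
          field_simp; ring
        rw [h1]
        exact mul_le_mul_of_nonneg_right (pow_le_pow_right₀ (by linarith) hTN) hPpos.le
      set v : ℂ := inner ℂ (evalVec n z) e' with hvdef
      set u : ℂ := inner ℂ (evalVec n z) (h - e) with hudef
      have hv0 : 0 < ‖v‖ := hPpos.trans_le hb
      have hvne : v ≠ 0 := norm_pos_iff.mp hv0
      have hu : ‖u / v‖ ≤ (M + Real.exp 2 * (C * M)) * (4 * N) ^ N := by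
        rw [norm_div, div_le_iff₀ hv0]
        have hM' : 0 ≤ M + Real.exp 2 * (C * M) := by positivity
        calc ‖u‖ ≤ (M + Real.exp 2 * (C * M)) * ((4 * N) ^ N * P) :=
              hup.trans (mul_le_mul_of_nonneg_left hPeq hM')
          _ ≤ (M + Real.exp 2 * (C * M)) * ((4 * N) ^ N * ‖v‖) := by gcongr
          _ = _ := by ring
      refine ⟨e + (u / v) • e', ?_, ?_⟩
      · refine (norm_add_le _ _).trans ?_
        rw [norm_smul]
        have : ‖u / v‖ * ‖e'‖ ≤ (M + Real.exp 2 * (C * M)) * (4 * N) ^ N := by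
          refine (mul_le_of_le_one_right (norm_nonneg _) he').trans hu
        calc ‖e‖ + ‖u / v‖ * ‖e'‖ ≤ C * M + (M + Real.exp 2 * (C * M)) * (4 * N) ^ N :=
              add_le_add he this
          _ = _ := by ring
      · intro x hx
        rw [← sub_sub, inner_sub_right, inner_smul_right]
        by_cases hxz : x = z
        · subst hxz
          rw [← hudef, ← hvdef, div_mul_cancel₀ _ hvne, sub_self]
        · have hx' := Finset.mem_erase.mpr ⟨hxz, hx⟩
          rw [hv x hx', hv' x hx', mul_zero, sub_zero]
  obtain ⟨C, hC, h⟩ := key N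
  exact ⟨C, hC, fun n S g M hn hS => h n S g M hn hS hS⟩

/-- The span of the evaluation vectors. -/
def evalSpan (n : ℕ) (S : Finset ℂ) : Submodule ℂ (Coeff n) :=
  Submodule.span ℂ (evalVec n '' S)

/-- Only the values of `h` on `S` enter the inner product, so `h` may be replaced by its
interpolant, and Cauchy–Schwarz applies. No bound on the inverse of a Gram matrix is needed. -/
theorem exists_inner_evalSpan_le (N : ℕ) (hN : 1 ≤ N) : ∃ C : ℝ, 0 < C ∧
    ∀ (n : ℕ) (S : Finset ℂ) (h : Coeff n) (M : ℝ), N ≤ n → S.card ≤ N →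
      (∀ z ∈ S, ∀ ζ : ℂ, ‖ζ‖ ≤ 2 / Real.sqrt n → ‖inner ℂ (diskVec n z ζ) h‖ ≤ M) →
      0 ≤ M → ∀ g ∈ evalSpan n S, ‖inner ℂ g h‖ ≤ C * M * ‖g‖ := by
  obtain ⟨C, hC, hI⟩ := exists_interpolation N hN
  refine ⟨C, hC, fun n S h M hn hS hM hM0 g hg => ?_⟩
  obtain ⟨e, he, hv⟩ := hI n S h M hn hS hM hM0
  have h0 : inner ℂ g (h - e) = (0 : ℂ) := by
    unfold evalSpan at hg
    induction hg using Submodule.span_induction with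
    | mem x hx => obtain ⟨y, hy, rfl⟩ := hx; exact hv y hy
    | zero => simp
    | add x y _ _ hx hy => rw [inner_add_left, hx, hy, add_zero]
    | smul c x _ hx => rw [inner_smul_left, hx, mul_zero]
  rw [inner_sub_right, sub_eq_zero] at h0
  rw [h0, mul_comm]
  exact (norm_inner_le_norm _ _).trans (mul_le_mul_of_nonneg_left he (norm_nonneg _))

/-- By Lagrange's identity in `ℂ²`, the squared Hermitian product is the product of the squared
norms minus the squared determinant. The determinant stays at least `δ/2` on disks of radius at most
`δ/8`, and the `n`-th power turns this deficit into Gaussian decay; the norms cost the factor `exp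
4`. -/
theorem norm_inner_diskVec_le {n : ℕ} (hn : 1 ≤ n) {x y : ℂ} {δ : ℝ} (hδ : δ ≤ chord x y)
    (hδn : 16 ≤ Real.sqrt n * δ) {ζ ω : ℂ} (hζ : ‖ζ‖ ≤ 2 / Real.sqrt n)
    (hω : ‖ω‖ ≤ 2 / Real.sqrt n) :
    ‖inner ℂ (diskVec n x ζ) (diskVec n y ω)‖ ≤
      Real.exp 4 * Real.exp (-(Real.exp (-8) / 8) * n * δ ^ 2) := by
  have hnR : (1 : ℝ) ≤ n := by exact_mod_cast hn
  have hs1 : 1 ≤ Real.sqrt n := Real.one_le_sqrt.mpr hnR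
  have hs0 : 0 < Real.sqrt n := by linarith
  have hsn : Real.sqrt n ^ 2 = n := Real.sq_sqrt (by linarith)
  have hx := japanese_pos x
  have hy := japanese_pos y
  have hxy : 0 < japanese x * japanese y := by positivity
  set r := 2 / Real.sqrt n with hr
  have hr0 : 0 < r := by positivity
  have hr2 : r ≤ 2 := by rw [hr, div_le_iff₀ hs0]; linarith
  have hrsq : r ^ 2 = 4 / n := by rw [hr, div_pow, hsn]; norm_num
  have hδr : 8 * r ≤ δ := by
    rw [hr, mul_div_assoc', div_le_iff₀ hs0]; linarith
  set p₀ := (x + ζ) / (japanese x : ℂ) with hp₀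
  set p₁ := (1 - (starRingEnd ℂ) x * ζ) / (japanese x : ℂ) with hp₁
  set q₀ := (y + ω) / (japanese y : ℂ) with hq₀
  set q₁ := (1 - (starRingEnd ℂ) y * ω) / (japanese y : ℂ) with hq₁
  have hp : ‖p₀‖ ^ 2 + ‖p₁‖ ^ 2 = 1 + ‖ζ‖ ^ 2 := norm_sq_add_norm_sq_disk x ζ
  have hq : ‖q₀‖ ^ 2 + ‖q₁‖ ^ 2 = 1 + ‖ω‖ ^ 2 := norm_sq_add_norm_sq_disk y ω
  have hlag : ‖p₀ * (starRingEnd ℂ) q₀ + p₁ * (starRingEnd ℂ) q₁‖ ^ 2 + ‖p₀ * q₁ - p₁ * q₀‖ ^ 2 =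
      (‖p₀‖ ^ 2 + ‖p₁‖ ^ 2) * (‖q₀‖ ^ 2 + ‖q₁‖ ^ 2) := by
    simp only [← Complex.normSq_eq_norm_sq, Complex.normSq_apply, Complex.add_re, Complex.add_im,
      Complex.sub_re, Complex.sub_im, Complex.mul_re, Complex.mul_im, Complex.conj_re,
      Complex.conj_im]
    ring
  -- Relative to `japanese x * japanese y`, the numerator is at least `chord x y` minus errors `r`,
  -- `r` and `2r`, and `4r ≤ δ/2`.
  have hW : δ / 2 ≤ ‖p₀ * q₁ - p₁ * q₀‖ := by
    have hxc : (japanese x : ℂ) ≠ 0 := by exact_mod_cast hx.ne'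
    have hyc : (japanese y : ℂ) ≠ 0 := by exact_mod_cast hy.ne'
    have e : p₀ * q₁ - p₁ * q₀ = ((x - y) + ζ * (1 + (starRingEnd ℂ) x * y)
        - ω * (1 + (starRingEnd ℂ) y * x) - ζ * ω * (starRingEnd ℂ) (y - x)) /
        ((japanese x * japanese y : ℝ) : ℂ) := by
      rw [hp₀, hp₁, hq₀, hq₁]
      push_cast
      rw [map_sub]
      field_simp
      ring
    rw [e, norm_div, Complex.norm_real, Real.norm_of_nonneg hxy.le, le_div_iff₀ hxy]
    have hb : ∀ u v : ℂ, ‖1 + (starRingEnd ℂ) u * v‖ ≤ japanese u * japanese v := fun u v => by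
      have h1 := norm_sq_one_add_conj_mul u v
      have := japanese_pos u
      have := japanese_pos v
      refine le_of_sq_le_sq ?_ (by positivity)
      rw [h1]
      exact mul_le_of_le_one_left (by positivity) (by nlinarith [sq_nonneg (chord u v)])
    have hxyn : ‖x - y‖ = chord x y * (japanese x * japanese y) := by
      unfold chord; field_simp
    have h1 : ‖ζ * (1 + (starRingEnd ℂ) x * y)‖ ≤ r * (japanese x * japanese y) := by
      rw [norm_mul]
      exact mul_le_mul hζ (hb x y) (norm_nonneg _) hr0.le
    have h2 : ‖ω * (1 + (starRingEnd ℂ) y * x)‖ ≤ r * (japanese x * japanese y) := by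
      rw [norm_mul, mul_comm (japanese x)]
      exact mul_le_mul hω (hb y x) (norm_nonneg _) hr0.le
    have h3 : ‖ζ * ω * (starRingEnd ℂ) (y - x)‖ ≤ 2 * r * (japanese x * japanese y) := by
      rw [norm_mul, norm_mul, RCLike.norm_conj, norm_sub_rev, hxyn]
      have h4 := chord_le_one x y
      have h5 : ‖ζ‖ * ‖ω‖ ≤ 2 * r := mul_le_mul (hζ.trans hr2) hω (norm_nonneg _) zero_le_two
      exact mul_le_mul h5 (mul_le_of_le_one_left hxy.le h4)
        (mul_nonneg (chord_nonneg _ _) hxy.le) (by positivity)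
    have h4 : ‖x - y‖ ≤ ‖(x - y) + ζ * (1 + (starRingEnd ℂ) x * y)
        - ω * (1 + (starRingEnd ℂ) y * x) - ζ * ω * (starRingEnd ℂ) (y - x)‖ +
        ‖ζ * (1 + (starRingEnd ℂ) x * y)‖ + ‖ω * (1 + (starRingEnd ℂ) y * x)‖ +
        ‖ζ * ω * (starRingEnd ℂ) (y - x)‖ := by
      set A := ζ * (1 + (starRingEnd ℂ) x * y)
      set B := ω * (1 + (starRingEnd ℂ) y * x)
      set D := ζ * ω * (starRingEnd ℂ) (y - x)
      have e2 : x - y = ((x - y) + A - B - D) - A + B + D := by ring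
      calc ‖x - y‖ = ‖((x - y) + A - B - D) - A + B + D‖ := by rw [← e2]
        _ ≤ _ := (norm_add_le _ _).trans (add_le_add_left ((norm_add_le _ _).trans
            (add_le_add_left (norm_sub_le _ _) _)) _)
    rw [hxyn] at h4
    nlinarith
  have hsq : ‖inner ℂ (diskVec n x ζ) (diskVec n y ω)‖ ^ 2 ≤
      (Real.exp 4 * Real.exp (-(Real.exp (-8) / 8) * n * δ ^ 2)) ^ 2 := by
    rw [diskVec, diskVec, inner_veronese_veronese, norm_pow, ← pow_mul, mul_comm n 2, pow_mul]
    have h1 : ‖p₀ * (starRingEnd ℂ) q₀ + p₁ * (starRingEnd ℂ) q₁‖ ^ 2 ≤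
        Real.exp (8 / n) * Real.exp (-(Real.exp (-8) * δ ^ 2 / 4)) := by
      have hζ2 : ‖ζ‖ ^ 2 ≤ 4 / n := by
        rw [← hrsq]; exact pow_le_pow_left₀ (norm_nonneg _) hζ 2
      have hω2 : ‖ω‖ ^ 2 ≤ 4 / n := by
        rw [← hrsq]; exact pow_le_pow_left₀ (norm_nonneg _) hω 2
      have h2 : (1 + ‖ζ‖ ^ 2) * (1 + ‖ω‖ ^ 2) ≤ Real.exp (8 / n) := by
        have h3 := Real.add_one_le_exp ((4 : ℝ) / n)
        have : Real.exp (8 / n) = Real.exp (4 / n) * Real.exp (4 / n) := by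
          rw [← Real.exp_add]; congr 1; ring
        rw [this]
        exact mul_le_mul (by linarith) (by linarith) (by positivity) (by positivity)
      have h3 : δ ^ 2 / 4 ≤ ‖p₀ * q₁ - p₁ * q₀‖ ^ 2 := by
        have := pow_le_pow_left₀ (by linarith) hW 2
        linarith
      -- The weight `exp (-8)` in the decay rate compensates for the factor `exp (8 / n)` when that
      -- factor is pulled out of the difference.
      have h4 : Real.exp (8 / n) * Real.exp (-8) ≤ 1 := by
        rw [← Real.exp_add]
        refine Real.exp_le_one_iff.mpr ?_
        have : (8 : ℝ) / n ≤ 8 := by rw [div_le_iff₀ (by linarith)]; linarith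
        linarith
      have h5 := Real.add_one_le_exp (-(Real.exp (-8) * δ ^ 2 / 4))
      have h6 : Real.exp (8 / n) * (1 - Real.exp (-8) * δ ^ 2 / 4) ≤
          Real.exp (8 / n) * Real.exp (-(Real.exp (-8) * δ ^ 2 / 4)) :=
        mul_le_mul_of_nonneg_left (by linarith) (Real.exp_pos _).le
      refine le_trans ?_ h6
      have h7 : Real.exp (8 / n) * Real.exp (-8) * (δ ^ 2 / 4) ≤ 1 * (δ ^ 2 / 4) :=
        mul_le_mul_of_nonneg_right h4 (by positivity)
      rw [hp, hq] at hlag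
      nlinarith
    calc (‖p₀ * (starRingEnd ℂ) q₀ + p₁ * (starRingEnd ℂ) q₁‖ ^ 2) ^ n
        ≤ (Real.exp (8 / n) * Real.exp (-(Real.exp (-8) * δ ^ 2 / 4))) ^ n :=
          pow_le_pow_left₀ (by positivity) h1 n
      _ = _ := by
          rw [mul_pow, mul_pow, ← Real.exp_nat_mul, ← Real.exp_nat_mul, ← Real.exp_nat_mul,
            ← Real.exp_nat_mul]
          congr 2
          · field_simp; norm_num
          · push_cast; ring
  exact le_of_sq_le_sq hsq (by positivity)

/-- Duality is used twice: decay of the kernel between disks bounds `h` on the disks around `S`, by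
interpolation on `T`; this bounds `h` against the span of `S`, by interpolation on `S`. -/
theorem exists_almost_orthogonal_evalSpan (N : ℕ) (hN : 1 ≤ N) : ∃ C : ℝ, 0 < C ∧
    ∀ (n : ℕ) (S T : Finset ℂ) (δ : ℝ), N ≤ n → S.card ≤ N → T.card ≤ N →
      16 ≤ Real.sqrt n * δ → (∀ x ∈ S, ∀ y ∈ T, δ ≤ chord x y) →
      ∀ g ∈ evalSpan n S, ∀ h ∈ evalSpan n T,
        ‖inner ℂ g h‖ ≤ C * Real.exp (-(Real.exp (-8) / 8) * n * δ ^ 2) * ‖g‖ * ‖h‖ := by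
  obtain ⟨C, hC, hI⟩ := exists_inner_evalSpan_le N hN
  refine ⟨C * (C * Real.exp 4), by positivity, ?_⟩
  intro n S T δ hn hS hT hδn hδ g hg h hh
  have hn1 : 1 ≤ n := hN.trans hn
  have h1 : ∀ x ∈ S, ∀ ζ : ℂ, ‖ζ‖ ≤ 2 / Real.sqrt n → ‖inner ℂ (diskVec n x ζ) h‖ ≤
      C * (Real.exp 4 * Real.exp (-(Real.exp (-8) / 8) * n * δ ^ 2)) * ‖h‖ := by
    intro x hx ζ hζ
    rw [norm_inner_symm]
    refine hI n T (diskVec n x ζ) _ hn hT ?_ (by positivity) h hh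
    intro y hy ω hω
    exact norm_inner_diskVec_le hn1 (by rw [chord_comm]; exact hδ x hx y hy) hδn hω hζ
  refine (hI n S h _ hn hS h1 (by positivity) g hg).trans (le_of_eq ?_)
  ring

end KacRice

end

noncomputable section

namespace KacRice

open MeasureTheory Filter Topology

/-! ### Derivatives as limits of differences -/

theorem hasDerivAt_poly (n : ℕ) (a : Coeff n) (z : ℂ) :
    HasDerivAt (poly n a) (∑ j : Fin (n + 1), a j * (Real.sqrt (n.choose (j : ℕ)) : ℂ) *
      ((j : ℕ) * z ^ ((j : ℕ) - 1))) z := by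
  unfold poly
  refine HasDerivAt.fun_sum fun j _ => ?_
  exact (hasDerivAt_pow (j : ℕ) z).const_mul _

/-- The normalization `√n (1 + |z|²)^{n/2 - 1}` of the derivative. -/
def derivWeight (n : ℕ) (z : ℂ) : ℝ := Real.sqrt n * (1 + ‖z‖ ^ 2) ^ ((n : ℝ) / 2 - 1)

/-- The vector representing the normalized derivative at `z`. -/
def derivVec (n : ℕ) (z : ℂ) : Coeff n :=
  WithLp.toLp 2 fun j : Fin (n + 1) => (starRingEnd ℂ) ((Real.sqrt (n.choose (j : ℕ)) : ℂ) *
    ((j : ℕ) * z ^ ((j : ℕ) - 1)) / (derivWeight n z : ℂ))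

theorem hatDeriv_eq_inner (n : ℕ) (a : Coeff n) (z : ℂ) :
    hatDeriv n a z = inner ℂ (derivVec n z) a := by
  rw [PiLp.inner_apply, hatDeriv, (hasDerivAt_poly n a z).deriv, Finset.sum_div]
  refine Finset.sum_congr rfl fun j _ => ?_
  simp [derivVec, derivWeight]
  ring

/-- The span of the evaluation vectors and of the derivative vectors. -/
def jetSpan (n : ℕ) (S : Finset ℂ) : Submodule ℂ (Coeff n) :=
  Submodule.span ℂ (evalVec n '' S ∪ derivVec n '' S)

theorem veronese_mem_evalSpan (n : ℕ) {S : Finset ℂ} {z : ℂ} (hz : z ∈ S) :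
    veronese n z 1 ∈ evalSpan n S := by
  have h := japanese_pos z
  have hc : (japanese z : ℂ) ≠ 0 := by exact_mod_cast h.ne'
  have e : veronese n z 1 = ((japanese z : ℂ) ^ n) • evalVec n z := by
    refine ext_inner_right ℂ fun a => ?_
    rw [inner_smul_left, evalVec, map_pow, Complex.conj_ofReal, ← inner_veronese_mul]
    congr 2 <;> field_simp
  rw [e]
  exact Submodule.smul_mem _ _ (Submodule.subset_span ⟨z, hz, rfl⟩)

theorem tendsto_difference_derivVec (n : ℕ) (z : ℂ) :
    Tendsto (fun t : ℝ => (((derivWeight n z)⁻¹ * t⁻¹ : ℝ) : ℂ) •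
      (veronese n (z + t) 1 - veronese n z 1)) (𝓝[≠] 0) (𝓝 (derivVec n z)) := by
  have hcoord : Tendsto (fun t : ℝ => fun j : Fin (n + 1) =>
      (((derivWeight n z)⁻¹ * t⁻¹ : ℝ) : ℂ) * ((starRingEnd ℂ)
        ((Real.sqrt (n.choose (j : ℕ)) : ℂ) * ((z + t) ^ (j : ℕ) - z ^ (j : ℕ)))))
      (𝓝[≠] 0) (𝓝 fun j : Fin (n + 1) => (starRingEnd ℂ) ((Real.sqrt (n.choose (j : ℕ)) : ℂ) *
    ((j : ℕ) * z ^ ((j : ℕ) - 1)) / (derivWeight n z : ℂ))) := by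
    refine tendsto_pi_nhds.mpr fun j => ?_
    have h1 : HasDerivAt (fun t : ℝ => (z + t) ^ (j : ℕ)) ((j : ℕ) * z ^ ((j : ℕ) - 1)) 0 := by
      have h2 : HasDerivAt (fun t : ℝ => z + (t : ℂ)) 1 0 :=
        (Complex.ofRealCLM.hasDerivAt (x := 0)).const_add z
      have := h2.fun_pow (j : ℕ)
      simpa using this
    have h3 := hasDerivAt_iff_tendsto_slope_zero.mp h1
    have h4 : Tendsto (fun t : ℝ => (starRingEnd ℂ) ((Real.sqrt (n.choose (j : ℕ)) : ℂ) *
        (t⁻¹ • ((z + ((0 + t : ℝ) : ℂ)) ^ (j : ℕ) - (z + ((0 : ℝ) : ℂ)) ^ (j : ℕ))) /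
          (derivWeight n z : ℂ))) (𝓝[≠] 0) _ :=
      (RCLike.continuous_conj.tendsto _).comp ((h3.const_mul _).div_const _)
    refine h4.congr fun t => ?_
    simp only [zero_add, Complex.ofReal_zero, add_zero, map_div₀, map_mul, Complex.conj_ofReal,
      Complex.real_smul]
    push_cast
    ring
  have := ((PiLp.continuous_toLp 2 fun _ : Fin (n + 1) => ℂ).tendsto _).comp hcoord
  refine this.congr fun t => ?_
  ext j
  simp only [Function.comp_apply, veronese, PiLp.smul_apply, PiLp.sub_apply, one_pow, mul_one,
    smul_eq_mul]
  rw [← map_sub, ← mul_sub]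

/-- Each derivative vector is a limit of differences of evaluations at `z + t` and `z`. Since almost
orthogonality of evaluation spans is uniform under collisions, it passes to the limit, with at most
twice as many points. -/
theorem exists_tendsto_of_mem_jetSpan (n : ℕ) (S : Finset ℂ) {g : Coeff n}
    (hg : g ∈ jetSpan n S) : ∃ G : ℝ → Coeff n, Tendsto G (𝓝[≠] 0) (𝓝 g) ∧
      ∀ t : ℝ, G t ∈ evalSpan n (S ∪ S.image (· + (t : ℂ))) := by
  classical
  unfold jetSpan at hg
  induction hg using Submodule.span_induction with
  | mem x hx =>
    rcases hx with ⟨z, hz, rfl⟩ | ⟨z, hz, rfl⟩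
    · exact ⟨fun _ => evalVec n z, tendsto_const_nhds, fun t =>
        Submodule.subset_span ⟨z, Finset.mem_coe.mpr (Finset.mem_union_left _ hz), rfl⟩⟩
    · refine ⟨_, tendsto_difference_derivVec n z, fun t => Submodule.smul_mem _ _ ?_⟩
      exact Submodule.sub_mem _
        (veronese_mem_evalSpan n (Finset.mem_union_right _ (Finset.mem_image_of_mem _ hz)))
        (veronese_mem_evalSpan n (Finset.mem_union_left _ hz))
  | zero => exact ⟨fun _ => 0, tendsto_const_nhds, fun t => Submodule.zero_mem _⟩
  | add x y _ _ hx hy =>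
    obtain ⟨G, hG, hG'⟩ := hx
    obtain ⟨H, hH, hH'⟩ := hy
    exact ⟨fun t => G t + H t, hG.add hH, fun t => Submodule.add_mem _ (hG' t) (hH' t)⟩
  | smul c x _ hx =>
    obtain ⟨G, hG, hG'⟩ := hx
    exact ⟨fun t => c • G t, hG.const_smul c, fun t => Submodule.smul_mem _ _ (hG' t)⟩

theorem continuous_japanese : Continuous japanese := by
  unfold japanese; fun_prop

theorem continuous_chord : Continuous fun p : ℂ × ℂ => chord p.1 p.2 := by
  unfold chord
  refine Continuous.div (by fun_prop)
    ((continuous_japanese.comp continuous_fst).mul (continuous_japanese.comp continuous_snd)) ?_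
  intro p
  exact (mul_pos (japanese_pos _) (japanese_pos _)).ne'

/-- The spans of jets at separated families of points are almost orthogonal. -/
theorem exists_almost_orthogonal_jetSpan (N : ℕ) (hN : 1 ≤ N) : ∃ C c : ℝ, 0 < C ∧ 0 < c ∧
    ∀ (n : ℕ) (S T : Finset ℂ) (δ : ℝ), 2 * N ≤ n → S.card ≤ N → T.card ≤ N →
      32 ≤ Real.sqrt n * δ → (∀ x ∈ S, ∀ y ∈ T, δ ≤ chord x y) →
      ∀ g ∈ jetSpan n S, ∀ h ∈ jetSpan n T,
        ‖inner ℂ g h‖ ≤ C * Real.exp (-c * n * δ ^ 2) * ‖g‖ * ‖h‖ := by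
  classical
  obtain ⟨C, hC, hA⟩ := exists_almost_orthogonal_evalSpan (2 * N) (by omega)
  -- The shifted points are only known to be `δ/2` apart, which divides the rate by 4 and doubles
  -- the threshold 16 to 32.
  refine ⟨C, Real.exp (-8) / 8 / 4, hC, by positivity, ?_⟩
  intro n S T δ hn hS hT hδn hδ g hg h hh
  have hnR : (1 : ℝ) ≤ n := by exact_mod_cast (show 1 ≤ n by omega)
  have hδ0 : 0 < δ := by
    by_contra hc
    push Not at hc
    have := mul_nonpos_of_nonneg_of_nonpos (Real.sqrt_nonneg n) hc
    linarith
  obtain ⟨G, hG, hGm⟩ := exists_tendsto_of_mem_jetSpan n S hg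
  obtain ⟨H, hH, hHm⟩ := exists_tendsto_of_mem_jetSpan n T hh
  have hsep : ∀ᶠ t : ℝ in 𝓝[≠] 0, ∀ x ∈ S, ∀ y ∈ T, δ / 2 ≤ chord (x + t) y ∧
      δ / 2 ≤ chord x (y + t) ∧ δ / 2 ≤ chord (x + t) (y + t) := by
    refine nhdsWithin_le_nhds ?_
    refine (Filter.eventually_all_finset S).mpr fun x hx =>
      (Filter.eventually_all_finset T).mpr fun y hy => ?_
    have hxy := hδ x hx y hy
    have hlt : δ / 2 < chord x y := by linarith
    have h1 : Continuous fun t : ℝ => chord (x + t) y :=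
      continuous_chord.comp (by fun_prop : Continuous fun t : ℝ => ((x + t : ℂ), y))
    have h2 : Continuous fun t : ℝ => chord x (y + t) :=
      continuous_chord.comp (by fun_prop : Continuous fun t : ℝ => (x, (y + t : ℂ)))
    have h3 : Continuous fun t : ℝ => chord (x + t) (y + t) :=
      continuous_chord.comp (by fun_prop : Continuous fun t : ℝ => ((x + t : ℂ), (y + t : ℂ)))
    have e1 := (h1.tendsto 0).eventually (lt_mem_nhds (by simpa using hlt))
    have e2 := (h2.tendsto 0).eventually (lt_mem_nhds (by simpa using hlt))
    have e3 := (h3.tendsto 0).eventually (lt_mem_nhds (by simpa using hlt))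
    filter_upwards [e1, e2, e3] with t a b c
    exact ⟨a.le, b.le, c.le⟩
  have hcard : ∀ (R : Finset ℂ) (t : ℝ), R.card ≤ N →
      (R ∪ R.image (· + (t : ℂ))).card ≤ 2 * N := fun R t hR => by
    have h1 := Finset.card_union_le R (R.image (· + (t : ℂ)))
    have h2 := Finset.card_image_le (s := R) (f := (· + (t : ℂ)))
    omega
  have hineq : ∀ᶠ t : ℝ in 𝓝[≠] 0, ‖inner ℂ (G t) (H t)‖ ≤
      C * Real.exp (-(Real.exp (-8) / 8) * n * (δ / 2) ^ 2) * ‖G t‖ * ‖H t‖ := by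
    filter_upwards [hsep] with t ht
    refine hA n (S ∪ S.image (· + (t : ℂ))) (T ∪ T.image (· + (t : ℂ))) (δ / 2) hn (hcard S t hS)
      (hcard T t hT) (by linarith) ?_ _ (hGm t) _ (hHm t)
    intro x hx y hy
    rcases Finset.mem_union.mp hx with hx | hx <;> rcases Finset.mem_union.mp hy with hy | hy
    · exact le_trans (by linarith) (hδ x hx y hy)
    · obtain ⟨y', hy', rfl⟩ := Finset.mem_image.mp hy
      exact (ht x hx y' hy').2.1
    · obtain ⟨x', hx', rfl⟩ := Finset.mem_image.mp hx
      exact (ht x' hx' y hy).1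
    · obtain ⟨x', hx', rfl⟩ := Finset.mem_image.mp hx
      obtain ⟨y', hy', rfl⟩ := Finset.mem_image.mp hy
      exact (ht x' hx' y' hy').2.2
  have hlim := le_of_tendsto_of_tendsto (hG.inner hH).norm
    ((hG.norm.const_mul (C * Real.exp (-(Real.exp (-8) / 8) * n * (δ / 2) ^ 2))).mul hH.norm) hineq
  refine hlim.trans (le_of_eq ?_)
  congr 4
  ring

theorem norm_inner_evalVec_le_prod {n : ℕ} (hn : 1 ≤ n) (S : Finset ℂ) (z : ℂ)
    (a : Coeff n) (ha : ∀ x ∈ S, inner ℂ (evalVec n x) a = 0) :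
    ‖inner ℂ (evalVec n z) a‖ ≤ Real.exp 2 * ‖a‖ * ∏ x ∈ S, (2 * trunc n z x) :=
  norm_inner_evalVec_le_of_vanishing hn S z a ha fun _ hζ =>
    (norm_inner_le_norm _ _).trans
      (mul_le_mul_of_nonneg_right (norm_diskVec_le hn z hζ) (norm_nonneg _))

/-- The derivative at a zero is small, according to the distances to the other zeros. -/
theorem norm_inner_derivVec_le_prod {n : ℕ} (hn : 1 ≤ n) (S : Finset ℂ) {z : ℂ} (hz : z ∈ S)
    (a : Coeff n) (ha : ∀ x ∈ S, inner ℂ (evalVec n x) a = 0) :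
    ‖inner ℂ (derivVec n z) a‖ ≤
      2 * Real.exp 2 * ‖a‖ * ∏ x ∈ S.erase z, (2 * trunc n z x) := by
  classical
  have hnR : (1 : ℝ) ≤ n := by exact_mod_cast hn
  have hs0 : 0 < Real.sqrt n := Real.sqrt_pos.mpr (by linarith)
  set R : ℂ → ℝ := fun z => (1 + ‖z‖ ^ 2) ^ ((n : ℝ) / 2) with hR
  have hRpos : ∀ z, 0 < R z := fun z => by simp only [hR]; positivity
  have hRcont : Continuous R := by
    simp only [hR]
    exact (by fun_prop : Continuous fun z : ℂ => 1 + ‖z‖ ^ 2).rpow_const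
      fun z => Or.inl (by positivity)
  have hpoly : ∀ w, ‖poly n a w‖ = ‖inner ℂ (evalVec n w) a‖ * R w := fun w => by
    rw [← hatPoly_eq_inner, hatPoly, norm_div, Complex.norm_real, Real.norm_of_nonneg (hRpos w).le,
      div_mul_cancel₀ _ (hRpos w).ne']
  have hpz : poly n a z = 0 := by
    have := hpoly z
    rw [ha z hz, norm_zero, zero_mul] at this
    exact norm_eq_zero.mp this
  have hder : HasDerivAt (fun t : ℝ => poly n a (z + t)) (deriv (poly n a) z) 0 := by
    have h1 : HasDerivAt (fun t : ℝ => z + (t : ℂ)) 1 0 :=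
      (Complex.ofRealCLM.hasDerivAt (x := 0)).const_add z
    have h2 : HasDerivAt (poly n a) (deriv (poly n a) z) (z + ((0 : ℝ) : ℂ)) := by
      simpa using (hasDerivAt_poly n a z).differentiableAt.hasDerivAt
    have h3 := h2.scomp (0 : ℝ) h1
    simpa [Function.comp_def] using h3
  have hlim1 := (hasDerivAt_iff_tendsto_slope_zero.mp hder).norm
  -- This bounds the difference quotient at `z`: in the product bound at `z + t`, the factor of the
  -- zero `z` is linear in `|t|` and cancels `t⁻¹`.
  set B : ℝ → ℝ := fun t => Real.exp 2 * ‖a‖ * (2 * (Real.sqrt n /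
    (japanese (z + t) * japanese z)) * ∏ x ∈ S.erase z, (2 * trunc n (z + t) x)) * R (z + t)
    with hB
  have hBcont : Continuous B := by
    have hshift : Continuous fun t : ℝ => z + (t : ℂ) := by fun_prop
    have htr : ∀ x, Continuous fun t : ℝ => trunc n (z + t) x := fun x => by
      unfold trunc
      exact continuous_const.min (continuous_const.mul
        (continuous_chord.comp (by fun_prop : Continuous fun t : ℝ => ((z + t : ℂ), x))))
    refine (continuous_const.mul ((continuous_const.mul (continuous_const.div
      ((continuous_japanese.comp hshift).mul continuous_const) ?_)).mul
      (continuous_finsetProd _ fun x _ => continuous_const.mul (htr x)))).mul (hRcont.comp hshift)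
    intro t
    exact (mul_pos (japanese_pos _) (japanese_pos _)).ne'
  have hlim2 : Tendsto B (𝓝[≠] 0) (𝓝 (B 0)) := (hBcont.tendsto 0).mono_left nhdsWithin_le_nhds
  have hle : ∀ᶠ t : ℝ in 𝓝[≠] 0,
      ‖t⁻¹ • (poly n a (z + ((0 + t : ℝ) : ℂ)) - poly n a (z + ((0 : ℝ) : ℂ)))‖ ≤ B t := by
    filter_upwards [self_mem_nhdsWithin] with t ht
    have ht0 : 0 < |t| := abs_pos.mpr ht
    have h1 := norm_inner_evalVec_le_prod hn S (z + t) a ha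
    rw [← Finset.mul_prod_erase S _ hz] at h1
    have h2 : trunc n (z + t) z ≤ Real.sqrt n * (|t| / (japanese (z + t) * japanese z)) := by
      refine (min_le_right _ _).trans (le_of_eq ?_)
      unfold chord
      rw [add_sub_cancel_left, Complex.norm_real, Real.norm_eq_abs]
    have hP0 : 0 ≤ ∏ x ∈ S.erase z, (2 * trunc n (z + t) x) :=
      Finset.prod_nonneg fun x _ => mul_nonneg zero_le_two (trunc_nonneg _ _ _)
    rw [zero_add, Complex.ofReal_zero, add_zero, hpz, sub_zero, norm_smul, norm_inv,
      Real.norm_eq_abs, hpoly, inv_mul_le_iff₀ ht0]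
    calc ‖inner ℂ (evalVec n (z + t)) a‖ * R (z + t)
        ≤ Real.exp 2 * ‖a‖ * (2 * (Real.sqrt n * (|t| / (japanese (z + t) * japanese z))) *
          ∏ x ∈ S.erase z, (2 * trunc n (z + t) x)) * R (z + t) := by
          refine mul_le_mul_of_nonneg_right (h1.trans ?_) (hRpos _).le
          gcongr
      _ = |t| * B t := by simp only [hB]; ring
  have h := le_of_tendsto_of_tendsto hlim1 hlim2 hle
  have hJ := japanese_pos z
  have hw : derivWeight n z = Real.sqrt n * R z / japanese z ^ 2 := by
    rw [derivWeight, japanese_sq, Real.rpow_sub_one (by positivity), mul_div_assoc]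
  have hw0 : 0 < derivWeight n z := by
    rw [hw]; have := hRpos z; positivity
  rw [← hatDeriv_eq_inner, hatDeriv, norm_div, Complex.norm_real, ← derivWeight,
    Real.norm_of_nonneg hw0.le, div_le_iff₀ hw0]
  refine h.trans (le_of_eq ?_)
  rw [hw]
  simp only [hB, Complex.ofReal_zero, add_zero]
  field_simp

end KacRice

end

noncomputable section

namespace KacRice

open MeasureTheory

/-! ### Gram determinants -/

/-- The Gram determinant of a finite subfamily. -/
def gramDet {n : ℕ} {κ : Type} [DecidableEq κ] (v : κ → Coeff n) (S : Finset κ) : ℝ :=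
  (Matrix.gram ℂ (fun i : S => v i)).det.re

/-- The space of vectors orthogonal to a finite subfamily. -/
def orthSpan {n : ℕ} {κ : Type} (v : κ → Coeff n) (S : Finset κ) : Submodule ℂ (Coeff n) :=
  (Submodule.span ℂ (v '' S))ᗮ

theorem gramDet_empty {n : ℕ} {κ : Type} [DecidableEq κ] (v : κ → Coeff n) :
    gramDet v ∅ = 1 := by
  simp [gramDet]

/-- Splitting `x` into a combination of the `v i` and a component `u` orthogonal to them makes the
Gram matrix congruent, by unipotent block matrices, to the block diagonal matrix of `G` and `‖u‖²`.
The `v i` need not be independent. -/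
theorem det_gram_sumElim {n : ℕ} {α : Type} [Fintype α] [DecidableEq α] (v : α → Coeff n)
    (x : Coeff n) :
    (Matrix.gram ℂ (Sum.elim v fun _ : PUnit.{1} => x)).det = (Matrix.gram ℂ v).det *
      ((‖(Submodule.span ℂ (Set.range v))ᗮ.starProjection x‖ ^ 2 : ℝ) : ℂ) := by
  set V := Submodule.span ℂ (Set.range v) with hV
  set u := Vᗮ.starProjection x with hu
  have huV : u ∈ Vᗮ := Vᗮ.starProjection_apply_mem x
  have hxu : x - u ∈ V := by
    rw [hu, Submodule.starProjection_orthogonal_val, sub_sub_cancel]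
    exact V.starProjection_apply_mem x
  obtain ⟨c, hc⟩ := (Submodule.mem_span_range_iff_exists_fun ℂ).mp hxu
  have hx : x = ∑ i, c i • v i + u := by rw [hc]; abel
  have hvu : ∀ i, inner ℂ (v i) u = 0 := fun i => huV _ (Submodule.subset_span ⟨i, rfl⟩)
  have huv : ∀ i, inner ℂ u (v i) = 0 := fun i => by
    rw [← inner_conj_symm, hvu, map_zero]
  set G := Matrix.gram ℂ v with hG
  set C : Matrix α PUnit.{1} ℂ := Matrix.of fun i _ => c i with hC
  set d : Matrix PUnit.{1} PUnit.{1} ℂ := Matrix.of fun _ _ => ((‖u‖ ^ 2 : ℝ) : ℂ) with hd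
  have hfac : Matrix.gram ℂ (Sum.elim v fun _ : PUnit.{1} => x) =
      Matrix.fromBlocks 1 0 C.conjTranspose 1 * Matrix.fromBlocks G 0 0 d *
        Matrix.fromBlocks 1 C 0 1 := by
    rw [Matrix.fromBlocks_multiply, Matrix.fromBlocks_multiply]
    simp only [Matrix.one_mul, Matrix.mul_one, Matrix.zero_mul, Matrix.mul_zero, add_zero, zero_add]
    have h12 : ∀ i, inner ℂ (v i) x = (G * C) i PUnit.unit := fun i => by
      rw [hx, inner_add_right, hvu, add_zero, inner_sum, Matrix.mul_apply]
      refine Finset.sum_congr rfl fun j _ => ?_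
      rw [inner_smul_right, mul_comm]; rfl
    have h21 : ∀ j, inner ℂ x (v j) = (C.conjTranspose * G) PUnit.unit j := fun j => by
      rw [hx, inner_add_left, huv, add_zero, sum_inner, Matrix.mul_apply]
      refine Finset.sum_congr rfl fun i _ => ?_
      rw [inner_smul_left]; rfl
    have h22 : inner ℂ x x = (C.conjTranspose * G * C + d) PUnit.unit PUnit.unit := by
      nth_rw 2 [hx]
      rw [inner_add_right, inner_sum, Matrix.add_apply, Matrix.mul_apply]
      congr 1
      · refine Finset.sum_congr rfl fun i _ => ?_
        rw [inner_smul_right, h21, mul_comm]; rfl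
      · rw [hx, inner_add_left, sum_inner, inner_self_eq_norm_sq_to_K]
        have : ∑ i, inner ℂ (c i • v i) u = (0 : ℂ) :=
          Finset.sum_eq_zero fun i _ => by rw [inner_smul_left, hvu, mul_zero]
        rw [this, zero_add, hd]
        simp
    ext i j
    rcases i with i | i <;> rcases j with j | j
    · rfl
    · exact h12 i
    · exact h21 j
    · exact h22
  rw [hfac, Matrix.det_mul, Matrix.det_mul, Matrix.det_fromBlocks_zero₁₂,
    Matrix.det_fromBlocks_zero₂₁, Matrix.det_fromBlocks_zero₂₁]
  simp [hd]

/-- Squared volume is that of the base times the squared height. -/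
theorem gramDet_insert {n : ℕ} {κ : Type} [DecidableEq κ] (v : κ → Coeff n) {S : Finset κ} {k : κ}
    (hk : k ∉ S) :
    gramDet v (insert k S) = gramDet v S * ‖(orthSpan v S).starProjection (v k)‖ ^ 2 := by
  set e : (insert k S : Finset κ) ≃ S ⊕ PUnit.{1} :=
    (Finset.subtypeInsertEquivOption hk).trans (Equiv.optionEquivSumPUnit _) with he
  have h1 : (fun i : (insert k S : Finset κ) => v i) ∘ e.symm =
      Sum.elim (fun i : S => v i) (fun _ => v k) := by
    ext1 i
    rcases i with i | i <;> rfl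
  have h2 := det_gram_sumElim (fun i : S => v i) (v k)
  have h3 : Set.range (fun i : S => v i) = v '' S := by
    ext y; simp
  rw [← h1, h3] at h2
  have h4 : (Matrix.gram ℂ ((fun i : (insert k S : Finset κ) => v i) ∘ e.symm)).det =
      (Matrix.gram ℂ (fun i : (insert k S : Finset κ) => v i)).det := by
    rw [← Matrix.det_submatrix_equiv_self e.symm]
    rfl
  unfold gramDet
  rw [← h4, h2, Complex.re_mul_ofReal]
  rfl

theorem gramDet_nonneg {n : ℕ} {κ : Type} [DecidableEq κ] (v : κ → Coeff n) (S : Finset κ) :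
    0 ≤ gramDet v S := by
  induction S using Finset.induction_on with
  | empty => rw [gramDet_empty]; exact zero_le_one
  | insert k S hk ih => rw [gramDet_insert v hk]; positivity

theorem starProjection_starProjection_of_le {n : ℕ} {U V : Submodule ℂ (Coeff n)} (h : U ≤ V)
    (x : Coeff n) : U.starProjection (V.starProjection x) = U.starProjection x :=
  congrArg (fun T => T x) (Submodule.starProjection_comp_starProjection_of_le h)

/-- Write the projection `y` of `x` to `V ⊔ W` as `y₁ + y₂`. Since `x` is orthogonal to `V`, `‖y‖² =
⟨y₂, x⟩` up to conjugation, which is at most `ε ‖x‖ ‖y₂‖`; almost orthogonality of `y₁` and `y₂`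
gives `‖y₂‖ ≤ 2 ‖y‖`. -/
theorem norm_sub_starProjection_sup_le {n : ℕ} {A B V W : Submodule ℂ (Coeff n)} {ε : ℝ}
    (hε : 0 ≤ ε) (hε1 : ε ≤ 1 / 2)
    (h : ∀ g ∈ A, ∀ k ∈ B, ‖inner ℂ g k‖ ≤ ε * ‖g‖ * ‖k‖) (hV : V ≤ A) (hW : W ≤ B)
    {x : Coeff n} (hx : x ∈ A) (hxV : x ∈ Vᗮ) :
    ‖x - (V ⊔ W)ᗮ.starProjection x‖ ≤ 2 * ε * ‖x‖ := by
  rw [Submodule.starProjection_orthogonal_val, sub_sub_cancel]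
  set y := (V ⊔ W).starProjection x with hy
  have hyVW : y ∈ V ⊔ W := (V ⊔ W).starProjection_apply_mem x
  obtain ⟨y₁, hy₁, y₂, hy₂, hsum⟩ := Submodule.mem_sup.mp hyVW
  have h1 : inner ℂ y x = (‖y‖ : ℂ) ^ 2 := by
    have h2 := (V ⊔ W).sub_starProjection_mem_orthogonal x y hyVW
    rw [← hy, inner_sub_right, sub_eq_zero] at h2
    rw [h2, inner_self_eq_norm_sq_to_K]; rfl
  have h2 : inner ℂ y x = inner ℂ y₂ x := by
    rw [← hsum, inner_add_left, hxV y₁ hy₁, zero_add]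
  have h3 : ‖y‖ ^ 2 ≤ ε * ‖x‖ * ‖y₂‖ := by
    have h4 := h x hx y₂ (hW hy₂)
    rw [norm_inner_symm, ← h2, h1, norm_pow, Complex.norm_real, norm_norm] at h4
    exact h4
  have h5 : ‖y₂‖ ≤ 2 * ‖y‖ := by
    have h6 := norm_add_sq (𝕜 := ℂ) y₁ y₂
    rw [hsum] at h6
    have h7 := h y₁ (hV hy₁) y₂ (hW hy₂)
    have h8 := (abs_le.mp (RCLike.abs_re_le_norm (inner ℂ y₁ y₂))).1
    have h9 : ε * ‖y₁‖ * ‖y₂‖ ≤ 1 / 2 * ‖y₁‖ * ‖y₂‖ := by gcongr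
    refine le_of_sq_le_sq ?_ (by positivity)
    nlinarith [sq_nonneg (‖y₁‖ - ‖y₂‖ / 2)]
  rcases (norm_nonneg y).eq_or_lt with h0 | h0
  · rw [← h0]; positivity
  · have h6 : ε * ‖x‖ * ‖y₂‖ ≤ ε * ‖x‖ * (2 * ‖y‖) := by gcongr
    nlinarith

theorem orthSpan_union {n : ℕ} {κ : Type} [DecidableEq κ] (v : κ → Coeff n) (S T : Finset κ) :
    orthSpan v (S ∪ T) = (Submodule.span ℂ (v '' S) ⊔ Submodule.span ℂ (v '' T))ᗮ := by
  rw [orthSpan, Finset.coe_union, Set.image_union, Submodule.span_union]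

/-- Gram determinants of almost orthogonal families are almost multiplicative. -/
theorem gramDet_union {n : ℕ} {κ : Type} [DecidableEq κ] (v : κ → Coeff n)
    {A B : Submodule ℂ (Coeff n)} {ε : ℝ} (hε : 0 ≤ ε) (hε1 : ε ≤ 1 / 2)
    (h : ∀ g ∈ A, ∀ k ∈ B, ‖inner ℂ g k‖ ≤ ε * ‖g‖ * ‖k‖) (S : Finset κ)
    (hS : ∀ i ∈ S, v i ∈ A) (T : Finset κ) (hT : ∀ i ∈ T, v i ∈ B) (hST : Disjoint S T) :
    (1 - 2 * ε) ^ (2 * T.card) * (gramDet v S * gramDet v T) ≤ gramDet v (S ∪ T) ∧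
      gramDet v (S ∪ T) ≤ gramDet v S * gramDet v T := by
  induction T using Finset.induction_on with
  | empty => simp [gramDet_empty]
  | insert k T hk ih =>
    obtain ⟨ih1, ih2⟩ := ih (fun i hi => hT i (Finset.mem_insert_of_mem hi))
      (Finset.disjoint_of_subset_right (Finset.subset_insert _ _) hST)
    have hkS : k ∉ S := fun hkS =>
      Finset.disjoint_left.mp hST hkS (Finset.mem_insert_self _ _)
    have hkST : k ∉ S ∪ T := by simp [hk, hkS]
    -- The height of `v k` over `T`. Projecting it further off the span of `S` costs at most the
    -- factor `1 - 2ε`, by `norm_sub_starProjection_sup_le` with the two groups exchanged.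
    set x := (orthSpan v T).starProjection (v k) with hx
    have hTB : Submodule.span ℂ (v '' T) ≤ B := by
      rw [Submodule.span_le]
      rintro _ ⟨i, hi, rfl⟩
      exact hT i (Finset.mem_insert_of_mem hi)
    have hSA : Submodule.span ℂ (v '' S) ≤ A := by
      rw [Submodule.span_le]
      rintro _ ⟨i, hi, rfl⟩
      exact hS i hi
    have hxo : x ∈ (Submodule.span ℂ (v '' T))ᗮ := Submodule.starProjection_apply_mem _ _
    have hxB : x ∈ B := by
      rw [hx, orthSpan, Submodule.starProjection_orthogonal_val]
      exact B.sub_mem (hT k (Finset.mem_insert_self _ _))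
        (hTB (Submodule.starProjection_apply_mem _ _))
    have hle : orthSpan v (S ∪ T) ≤ orthSpan v T := by
      rw [orthSpan_union, orthSpan]
      exact Submodule.orthogonal_le le_sup_right
    have hproj : (orthSpan v (S ∪ T)).starProjection (v k) =
        (orthSpan v (S ∪ T)).starProjection x := (starProjection_starProjection_of_le hle _).symm
    have hup : ‖(orthSpan v (S ∪ T)).starProjection x‖ ≤ ‖x‖ :=
      Submodule.norm_starProjection_apply_le _ _
    have hlow : (1 - 2 * ε) * ‖x‖ ≤ ‖(orthSpan v (S ∪ T)).starProjection x‖ := by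
      have h1 := norm_sub_starProjection_sup_le hε hε1 (A := B) (B := A)
        (fun g hg k hk => by
          rw [norm_inner_symm, mul_right_comm]; exact h k hk g hg) hTB hSA hxB hxo
      rw [orthSpan_union, sup_comm]
      have h2 := norm_sub_norm_le x
        ((Submodule.span ℂ (v '' T) ⊔ Submodule.span ℂ (v '' S))ᗮ.starProjection x)
      linarith
    rw [Finset.union_insert, gramDet_insert v hkST, gramDet_insert v hk, hproj,
      Finset.card_insert_of_notMem hk, ← hx]
    have hST0 := gramDet_nonneg v (S ∪ T)
    have hS0 := gramDet_nonneg v S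
    have hT0 := gramDet_nonneg v T
    have h12 : 0 ≤ 1 - 2 * ε := by linarith
    constructor
    · calc (1 - 2 * ε) ^ (2 * (T.card + 1)) * (gramDet v S * (gramDet v T * ‖x‖ ^ 2))
          = ((1 - 2 * ε) ^ (2 * T.card) * (gramDet v S * gramDet v T)) *
            ((1 - 2 * ε) * ‖x‖) ^ 2 := by ring
        _ ≤ gramDet v (S ∪ T) * ‖(orthSpan v (S ∪ T)).starProjection x‖ ^ 2 :=
          mul_le_mul ih1 (pow_le_pow_left₀ (by positivity) hlow 2) (by positivity) hST0
    · calc gramDet v (S ∪ T) * ‖(orthSpan v (S ∪ T)).starProjection x‖ ^ 2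
          ≤ (gramDet v S * gramDet v T) * ‖x‖ ^ 2 :=
          mul_le_mul ih2 (pow_le_pow_left₀ (norm_nonneg _) hup 2) (by positivity) (by positivity)
        _ = _ := by ring

/-! ### The conditional law and the covariance matrix in terms of evaluation vectors -/

theorem covHat_eq_gram (n : ℕ) {κ : Type} (z : κ → ℂ) :
    covHat n z = Matrix.gram ℂ fun j => evalVec n (z j) := by
  ext i j
  simp only [covHat, Matrix.of_apply, Matrix.gram_apply, hatPoly_eq_inner,
    integral_inner_eq_zero, sub_zero, integral_inner_mul_conj_inner]

theorem vanishing_sub (n : ℕ) {κ : Type} (z : κ → ℂ) (I : Finset κ) :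
    vanishing n (sub z I) = orthSpan (fun j => evalVec n (z j)) I := by
  have hiff : ∀ a x, poly n a x = 0 ↔ inner ℂ (evalVec n x) a = 0 := fun a x => by
    rw [← hatPoly_eq_inner, hatPoly, div_eq_zero_iff, or_iff_left]
    exact_mod_cast (by positivity : ((1 + ‖x‖ ^ 2) ^ ((n : ℝ) / 2) : ℝ) ≠ 0)
  ext a
  rw [orthSpan, Submodule.mem_orthogonal]
  constructor
  · intro ha u hu
    induction hu using Submodule.span_induction with
    | mem x hx => obtain ⟨j, hj, rfl⟩ := hx; exact (hiff a _).mp (ha ⟨j, hj⟩)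
    | zero => simp
    | add x y _ _ hx hy => rw [inner_add_left, hx, hy, add_zero]
    | smul c x _ hx => rw [inner_smul_left, hx, mul_zero]
  · rintro ha ⟨j, hj⟩
    exact (hiff a _).mpr (ha _ (Submodule.subset_span ⟨j, hj, rfl⟩))

theorem vanishing_eq_orthSpan_univ (n : ℕ) {κ : Type} [Fintype κ] (z : κ → ℂ) :
    vanishing n z = orthSpan (fun j => evalVec n (z j)) Finset.univ := by
  rw [← vanishing_sub]
  ext a
  exact ⟨fun h j => h j, fun h j => h ⟨j, Finset.mem_univ j⟩⟩

/-- The projection is self-adjoint, so it moves from the Gaussian vector to the representing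
vectors, and the conditional law disappears. -/
theorem condMoment_eq (n : ℕ) {ι κ : Type} [Fintype ι] [Fintype κ] (p : κ → ℕ) (w : ι → ℂ)
    (z : κ → ℂ) :
    condMoment n p w z = ∫ a, (∏ t, Real.log ‖(inner ℂ ((vanishing n z).starProjection
        (evalVec n (w t))) a : ℂ)‖) *
      ∏ j, (Real.log ‖(inner ℂ ((vanishing n z).starProjection (derivVec n (z j))) a : ℂ)‖ ^ p j *
        ‖(inner ℂ ((vanishing n z).starProjection (derivVec n (z j))) a : ℂ)‖ ^ 2)
        ∂(coeffLaw n) := by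
  have hP : Measurable fun a => (vanishing n z).starProjection a :=
    (vanishing n z).starProjection.continuous.measurable
  unfold condMoment condLaw
  simp only [hatPoly_eq_inner, hatDeriv_eq_inner]
  rw [integral_map hP.aemeasurable]
  · simp only [Submodule.inner_starProjection_left_eq_right]
  · refine Measurable.aestronglyMeasurable ?_
    refine (Finset.measurable_prod _ fun t _ => ?_).mul (Finset.measurable_prod _ fun j _ => ?_)
    · exact Real.measurable_log.comp (measurable_inner_coeff n _).norm
    · exact ((Real.measurable_log.comp (measurable_inner_coeff n _).norm).pow_const _).mul
        ((measurable_inner_coeff n _).norm.pow_const _)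

theorem density_eq (n : ℕ) {ι κ : Type} [Fintype ι] [Fintype κ] [DecidableEq κ] (p : κ → ℕ)
    (w : ι → ℂ) (z : κ → ℂ) :
    density n p w z = (n : ℝ) ^ (Fintype.card ι + Fintype.card κ) *
      (condMoment n p w z / gramDet (fun j => evalVec n (z j)) Finset.univ) := by
  unfold density gramDet
  rw [covHat_eq_gram]
  congr 3
  rw [← Matrix.det_submatrix_equiv_self (Equiv.subtypeUnivEquiv (p := (· ∈ Finset.univ))
    (fun x : κ => Finset.mem_univ x))]
  rfl

theorem det_covHat_sub (n : ℕ) {κ : Type} [DecidableEq κ] (z : κ → ℂ) (I : Finset κ) :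
    (covHat n (sub z I)).det.re = gramDet (fun j => evalVec n (z j)) I := by
  rw [covHat_eq_gram]
  rfl

/-! ### Conditional standard deviations and the covariance determinant -/

theorem evalVec_mem_of_vanishing_image {n : ℕ} {κ : Type} [DecidableEq κ] {z : κ → ℂ}
    {I : Finset κ} {a : Coeff n} :
    a ∈ orthSpan (fun j => evalVec n (z j)) I ↔
      ∀ x ∈ I.image z, inner ℂ (evalVec n x) a = 0 := by
  rw [orthSpan, Submodule.mem_orthogonal]
  constructor
  · intro h x hx
    obtain ⟨i, hi, rfl⟩ := Finset.mem_image.mp hx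
    exact h _ (Submodule.subset_span ⟨i, hi, rfl⟩)
  · intro h u hu
    induction hu using Submodule.span_induction with
    | mem x hx => obtain ⟨j, hj, rfl⟩ := hx; exact h _ (Finset.mem_image_of_mem _ hj)
    | zero => simp
    | add x y _ _ hx hy => rw [inner_add_left, hx, hy, add_zero]
    | smul c x _ hx => rw [inner_smul_left, hx, mul_zero]

/-- Lower bound for the conditional standard deviation of `f̂_n(w)`. -/
theorem prod_trunc_le_norm_starProjection (N : ℕ) (hN : 1 ≤ N) {n : ℕ} (hn : N ≤ n) {κ : Type}
    {z : κ → ℂ} (hz : Function.Injective z) (I : Finset κ) (hI : I.card ≤ N) (w : ℂ) :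
    ∏ i ∈ I, (trunc n w (z i) / (2 * N)) ≤
      ‖(orthSpan (fun j => evalVec n (z j)) I).starProjection (evalVec n w)‖ := by
  classical
  obtain ⟨e, he1, he0, hez⟩ := exists_vanishing N hN (I.image z)
    (Finset.card_image_le.trans hI) w n hn
  rw [Finset.prod_image hz.injOn] at hez
  refine hez.trans ?_
  have heV := evalVec_mem_of_vanishing_image.mpr he0
  have h1 : inner ℂ (evalVec n w) e =
      inner ℂ ((orthSpan (fun j => evalVec n (z j)) I).starProjection (evalVec n w)) e := by
    rw [Submodule.inner_starProjection_left_eq_right, Submodule.starProjection_eq_self_iff.mpr heV]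
  rw [h1]
  exact (norm_inner_le_norm _ _).trans (mul_le_of_le_one_right (norm_nonneg _) he1)

/-- Upper bound for the conditional standard deviation of the derivative at a zero. -/
theorem norm_starProjection_derivVec_le {n : ℕ} (hn : 1 ≤ n) {κ : Type} [DecidableEq κ]
    {z : κ → ℂ} (hz : Function.Injective z) {I : Finset κ} {j : κ} (hj : j ∈ I) :
    ‖(orthSpan (fun j => evalVec n (z j)) I).starProjection (derivVec n (z j))‖ ≤
      2 * Real.exp 2 * ∏ i ∈ I.erase j, (2 * trunc n (z j) (z i)) := by
  set V := orthSpan (fun j => evalVec n (z j)) I with hV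
  set a := V.starProjection (derivVec n (z j)) with ha
  have haV : a ∈ V := V.starProjection_apply_mem _
  have h1 := norm_inner_derivVec_le_prod hn (I.image z) (Finset.mem_image_of_mem z hj) a
    (evalVec_mem_of_vanishing_image.mp haV)
  have h2 : ‖(inner ℂ (derivVec n (z j)) a : ℂ)‖ = ‖a‖ ^ 2 := by
    have : inner ℂ (derivVec n (z j)) a = inner ℂ a a := by
      have h3 := Submodule.inner_starProjection_left_eq_right V (derivVec n (z j)) a
      rw [← ha, Submodule.starProjection_eq_self_iff.mpr haV] at h3
      exact h3.symm
    rw [this, inner_self_eq_norm_sq_to_K]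
    simp
  rw [h2, ← Finset.image_erase hz, Finset.prod_image hz.injOn] at h1
  set P := ∏ i ∈ I.erase j, (2 * trunc n (z j) (z i)) with hP
  have hP0 : 0 ≤ P := Finset.prod_nonneg fun x _ => mul_nonneg zero_le_two (trunc_nonneg _ _ _)
  rcases (norm_nonneg a).eq_or_lt with h0 | h0
  · rw [← h0]; positivity
  · nlinarith

/-- Each new point multiplies the determinant by a squared height. One of the two resulting products
belongs to the new point; by symmetry of `trunc`, the other supplies the new pairs for the old
points. -/
theorem prod_trunc_le_gramDet (N : ℕ) (hN : 1 ≤ N) {n : ℕ} (hn : N ≤ n) {κ : Type} [DecidableEq κ]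
    {z : κ → ℂ} (hz : Function.Injective z) (I : Finset κ) (hI : I.card ≤ N) :
    ∏ j ∈ I, ∏ i ∈ I.erase j, (trunc n (z j) (z i) / (2 * N)) ≤
      gramDet (fun j => evalVec n (z j)) I := by
  induction I using Finset.induction_on with
  | empty => simp [gramDet_empty]
  | insert k I hk ih =>
    rw [Finset.card_insert_of_notMem hk] at hI
    rw [gramDet_insert _ hk, Finset.prod_insert hk, Finset.erase_insert hk]
    have h1 : ∏ j ∈ I, ∏ i ∈ (insert k I).erase j, (trunc n (z j) (z i) / (2 * N)) =
        (∏ j ∈ I, (trunc n (z k) (z j) / (2 * N))) *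
          ∏ j ∈ I, ∏ i ∈ I.erase j, (trunc n (z j) (z i) / (2 * N)) := by
      rw [← Finset.prod_mul_distrib]
      refine Finset.prod_congr rfl fun j hj => ?_
      have hjk : k ≠ j := fun h => hk (h ▸ hj)
      rw [Finset.erase_insert_of_ne hjk, Finset.prod_insert (fun h => hk (Finset.mem_of_mem_erase h)),
        trunc_comm]
    rw [h1]
    set P := ∏ j ∈ I, (trunc n (z k) (z j) / (2 * N)) with hP
    have hP0 : 0 ≤ P := Finset.prod_nonneg fun x _ => div_nonneg (trunc_nonneg _ _ _) (by positivity)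
    have h2 := prod_trunc_le_norm_starProjection N hN hn hz I (by omega) (z k)
    have h3 := pow_le_pow_left₀ hP0 h2 2
    have h4 := mul_le_mul (ih (by omega)) h3 (by positivity) (gramDet_nonneg _ _)
    refine le_trans (le_of_eq ?_) h4
    ring

/-- The product of the conditional standard deviations of the derivatives is bounded by the
Gram determinant. -/
theorem exists_prod_norm_derivVec_le (N : ℕ) (hN : 1 ≤ N) : ∃ C : ℝ, 0 < C ∧
    ∀ (n : ℕ) (κ : Type) [DecidableEq κ] (z : κ → ℂ) (I : Finset κ), N ≤ n →
      Function.Injective z → I.card ≤ N →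
      ∏ j ∈ I, ‖(orthSpan (fun j => evalVec n (z j)) I).starProjection (derivVec n (z j))‖ ≤
        C * gramDet (fun j => evalVec n (z j)) I := by
  have hNR : (1 : ℝ) ≤ N := by exact_mod_cast hN
  have hexp : 1 ≤ Real.exp 2 := Real.one_le_exp (by norm_num)
  -- For each derivative, `2 * exp 2` is the constant of the upper bound, and `4N` the ratio of
  -- upper to lower bound for each other point.
  refine ⟨(2 * Real.exp 2 * (4 * N) ^ N) ^ N, by positivity, ?_⟩
  intro n κ _ z I hn hz hI
  have hb1 : 1 ≤ (4 * (N : ℝ)) ^ N := one_le_pow₀ (by linarith)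
  have hb : 1 ≤ 2 * Real.exp 2 * (4 * N) ^ N := by nlinarith
  have h1 : ∀ j ∈ I, ‖(orthSpan (fun j => evalVec n (z j)) I).starProjection (derivVec n (z j))‖ ≤
      (2 * Real.exp 2 * (4 * N) ^ N) * ∏ i ∈ I.erase j, (trunc n (z j) (z i) / (2 * N)) := by
    intro j hj
    refine (norm_starProjection_derivVec_le (hN.trans hn) hz hj).trans ?_
    have h2 : ∏ i ∈ I.erase j, (2 * trunc n (z j) (z i)) =
        (4 * N) ^ (I.erase j).card * ∏ i ∈ I.erase j, (trunc n (z j) (z i) / (2 * N)) := by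
      rw [← Finset.prod_const, ← Finset.prod_mul_distrib]
      refine Finset.prod_congr rfl fun x _ => ?_
      field_simp; ring
    have hP0 : 0 ≤ ∏ i ∈ I.erase j, (trunc n (z j) (z i) / (2 * N)) :=
      Finset.prod_nonneg fun x _ => div_nonneg (trunc_nonneg _ _ _) (by positivity)
    have h3 : (4 * (N : ℝ)) ^ (I.erase j).card ≤ (4 * N) ^ N :=
      pow_le_pow_right₀ (by linarith) (Finset.card_erase_le.trans hI)
    rw [h2, mul_assoc (2 * Real.exp 2)]
    gcongr
  refine (Finset.prod_le_prod (fun j _ => norm_nonneg _) h1).trans ?_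
  rw [Finset.prod_mul_distrib, Finset.prod_const]
  refine mul_le_mul (pow_le_pow_right₀ hb hI) (prod_trunc_le_gramDet N hN hn hz I hI) ?_
    (by positivity)
  exact Finset.prod_nonneg fun j _ => Finset.prod_nonneg fun x _ =>
    div_nonneg (trunc_nonneg _ _ _) (by positivity)

/-! ### Tameness of the logarithmic factors -/

theorem TameFunction.mono {s K K' : ℝ} {F : ℂ → ℝ} (h : TameFunction s K F) (hK : K ≤ K') :
    TameFunction s K' F := by
  refine ⟨h.measurable, fun z hz => (h.bound z hz).trans ?_, fun z z' hz hz' =>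
    (h.holder z z' hz hz').trans ?_⟩
  · exact mul_le_mul_of_nonneg_right hK (majorant_nonneg (norm_nonneg _))
  · have h1 : 0 ≤ majorant s ‖z‖ + majorant s ‖z'‖ :=
      add_nonneg (majorant_nonneg (norm_nonneg _)) (majorant_nonneg (norm_nonneg _))
    gcongr

theorem abs_log_le_majorant {s r : ℝ} (hs : 0 < s) (hs1 : s ≤ 1) (hr : 0 < r) :
    |Real.log r| ≤ 2 / s * majorant s r := by
  have h1 := Real.log_le_rpow_div hr.le hs
  have h2 := Real.log_le_rpow_div (inv_pos.mpr hr).le hs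
  rw [Real.log_inv, Real.inv_rpow hr.le, ← Real.rpow_neg hr.le] at h2
  have h3 : r ^ s ≤ majorant s r := by
    rcases le_total r 1 with h | h
    · exact (Real.rpow_le_one hr.le h hs.le).trans (one_le_majorant hs hr)
    · have h4 := Real.rpow_le_rpow_of_exponent_le h hs1
      rw [Real.rpow_one] at h4
      have h5 : r ≤ r ^ 3 := le_self_pow₀ h (by norm_num)
      have h6 : 0 ≤ r ^ (-s) := Real.rpow_nonneg hr.le _
      unfold majorant; linarith
  have h4 : r ^ (-s) ≤ majorant s r := by
    unfold majorant; linarith [pow_pos hr 3]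
  have hm : 0 ≤ majorant s r := majorant_nonneg hr.le
  rw [abs_le]
  have h5 : r ^ s / s ≤ majorant s r / s := div_le_div_of_nonneg_right h3 hs.le
  have h6 : r ^ (-s) / s ≤ majorant s r / s := div_le_div_of_nonneg_right h4 hs.le
  have h7 : 2 / s * majorant s r = 2 * (majorant s r / s) := by ring
  have h8 : 0 ≤ majorant s r / s := by positivity
  rw [h7]
  constructor <;> linarith

/-- Apply `log x ≤ x - 1` to `(r / r')^s`, and use the subadditivity of `r ↦ r^s`. -/
theorem log_sub_log_le {s r r' : ℝ} (hs : 0 < s) (hs1 : s ≤ 1) (hr' : 0 < r') (h : r' ≤ r) :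
    Real.log r - Real.log r' ≤ 1 / s * (r - r') ^ s * r' ^ (-s) := by
  have hr : 0 < r := hr'.trans_le h
  have h1 : Real.log ((r / r') ^ s) ≤ (r / r') ^ s - 1 := Real.log_le_sub_one_of_pos (by positivity)
  rw [Real.log_rpow (by positivity), Real.log_div hr.ne' hr'.ne', Real.div_rpow hr.le hr'.le] at h1
  have h2 : r ^ s ≤ (r - r') ^ s + r' ^ s := by
    have := Real.rpow_add_le_add_rpow (sub_nonneg.mpr h) hr'.le hs.le hs1
    rwa [sub_add_cancel] at this
  have hp : 0 < r' ^ s := by positivity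
  have h3 : r ^ s / r' ^ s - 1 ≤ (r - r') ^ s * r' ^ (-s) := by
    rw [Real.rpow_neg hr'.le, ← div_eq_mul_inv, sub_le_iff_le_add, div_le_iff₀ hp, add_mul,
      div_mul_cancel₀ _ hp.ne', one_mul]
    exact h2
  have h4 := h1.trans h3
  rw [mul_assoc, one_div, ← div_eq_inv_mul, le_div_iff₀ hs]
  linarith

theorem abs_log_sub_log_le {s : ℝ} (hs : 0 < s) (hs1 : s ≤ 1) {z z' : ℂ} (hz : z ≠ 0)
    (hz' : z' ≠ 0) : |Real.log ‖z‖ - Real.log ‖z'‖| ≤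
      1 / s * ‖z - z'‖ ^ s * (majorant s ‖z‖ + majorant s ‖z'‖) := by
  have key : ∀ u v : ℂ, u ≠ 0 → v ≠ 0 → ‖v‖ ≤ ‖u‖ → |Real.log ‖u‖ - Real.log ‖v‖| ≤
      1 / s * ‖u - v‖ ^ s * (majorant s ‖u‖ + majorant s ‖v‖) := by
    intro u v hu hv huv
    have hv0 : 0 < ‖v‖ := norm_pos_iff.mpr hv
    have h0 : 0 ≤ Real.log ‖u‖ - Real.log ‖v‖ := sub_nonneg.mpr (Real.log_le_log hv0 huv)
    rw [abs_of_nonneg h0]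
    refine (log_sub_log_le hs hs1 hv0 huv).trans ?_
    have h1 : (‖u‖ - ‖v‖) ^ s ≤ ‖u - v‖ ^ s :=
      Real.rpow_le_rpow (sub_nonneg.mpr huv) (norm_sub_norm_le u v) hs.le
    have h2 : ‖v‖ ^ (-s) ≤ majorant s ‖u‖ + majorant s ‖v‖ := by
      have := majorant_nonneg (s := s) (norm_nonneg u)
      have := pow_pos hv0 3
      unfold majorant at *; linarith
    have h3 : 0 ≤ (‖u‖ - ‖v‖) ^ s := Real.rpow_nonneg (sub_nonneg.mpr huv) _
    gcongr
  rcases le_total ‖z'‖ ‖z‖ with h | h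
  · exact key z z' hz hz' h
  · rw [abs_sub_comm, norm_sub_rev, add_comm (majorant s ‖z‖)]
    exact key z' z hz' hz h

/-- The logarithm of a variable with small standard deviation `l` is large because of `log l`;
dividing by `L` makes it tame uniformly in `l`. In the application `L` is `|log Δ'_t|`, whence the
product in the final bound. -/
theorem tameFunction_log {s C L l : ℝ} (hs : 0 < s) (hs1 : s ≤ 1) (hC : 0 ≤ C) (hL : 1 / 2 ≤ L)
    (hl : 0 < l) (hlL : |Real.log l| ≤ C * L) :
    TameFunction s (C + 4 / s) (fun z => Real.log (l * ‖z‖) / L) := by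
  have hL0 : 0 < L := by linarith
  refine ⟨?_, fun z hz => ?_, fun z z' hz hz' => ?_⟩
  · exact (Real.measurable_log.comp (measurable_norm.const_mul l)).div_const L
  · have hz0 : 0 < ‖z‖ := norm_pos_iff.mpr hz
    rw [Real.log_mul hl.ne' hz0.ne', abs_div, abs_of_pos hL0, div_le_iff₀ hL0]
    refine (abs_add_le _ _).trans ?_
    have h1 := abs_log_le_majorant hs hs1 hz0
    have h2 := one_le_majorant hs hz0
    have h3 : C * L ≤ C * L * majorant s ‖z‖ := le_mul_of_one_le_right (by positivity) h2
    have h4 : 2 / s * majorant s ‖z‖ ≤ (4 / s * majorant s ‖z‖) * L := by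
      have h5 : 0 ≤ 4 / s * majorant s ‖z‖ := by positivity
      have h6 : 2 / s * majorant s ‖z‖ = (4 / s * majorant s ‖z‖) * (1 / 2) := by ring
      rw [h6]
      exact mul_le_mul_of_nonneg_left hL h5
    nlinarith
  · have hz0 : 0 < ‖z‖ := norm_pos_iff.mpr hz
    have hz0' : 0 < ‖z'‖ := norm_pos_iff.mpr hz'
    rw [Real.log_mul hl.ne' hz0.ne', Real.log_mul hl.ne' hz0'.ne', ← sub_div, add_sub_add_left_eq_sub,
      abs_div, abs_of_pos hL0, div_le_iff₀ hL0]
    refine (abs_log_sub_log_le hs hs1 hz hz').trans ?_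
    have hM : 0 ≤ majorant s ‖z‖ + majorant s ‖z'‖ :=
      add_nonneg (majorant_nonneg hz0.le) (majorant_nonneg hz0'.le)
    set X := ‖z - z'‖ ^ s * (majorant s ‖z‖ + majorant s ‖z'‖) with hX
    have hX0 : 0 ≤ X := by positivity
    have h1 : 1 / s ≤ (C + 4 / s) * L := by
      have h2 : 0 < 1 / s := by positivity
      have h3 : 4 / s = 4 * (1 / s) := by ring
      have h4 : 0 ≤ C * L := by positivity
      rw [h3]; nlinarith
    calc 1 / s * ‖z - z'‖ ^ s * (majorant s ‖z‖ + majorant s ‖z'‖) = 1 / s * X := by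
          rw [hX]; ring
      _ ≤ (C + 4 / s) * L * X := mul_le_mul_of_nonneg_right h1 hX0
      _ = _ := by rw [hX]; ring

/-- With exponent `1/(k+1)`, the `k`-th power of `|log u|` is bounded by a constant times `max u
u⁻¹`. -/
theorem mul_abs_log_pow_le (k : ℕ) {u : ℝ} (hu : 0 < u) :
    u * |Real.log u| ^ k ≤ ((k : ℝ) + 1) ^ k * (1 + u ^ 2) := by
  set e : ℝ := 1 / ((k : ℝ) + 1) with he
  have hk : (0 : ℝ) < (k : ℝ) + 1 := by positivity
  have he0 : 0 < e := by positivity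
  have hke : (k : ℝ) * e ≤ 1 := by
    rw [he, mul_one_div, div_le_one hk]; linarith
  have hdiv : ∀ x : ℝ, x / e = ((k : ℝ) + 1) * x := fun x => by rw [he]; field_simp
  rcases le_total u 1 with h | h
  · have h1 := Real.log_le_rpow_div (inv_pos.mpr hu).le he0
    rw [Real.log_inv, hdiv] at h1
    have h2 : |Real.log u| ≤ ((k : ℝ) + 1) * u⁻¹ ^ e := by
      rw [abs_of_nonpos (Real.log_nonpos hu.le h)]; exact h1
    have h3 := pow_le_pow_left₀ (abs_nonneg _) h2 k
    rw [mul_pow] at h3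
    have h4 : (u⁻¹ ^ e) ^ k ≤ u⁻¹ := by
      rw [← Real.rpow_natCast, ← Real.rpow_mul (inv_pos.mpr hu).le]
      have := Real.rpow_le_rpow_of_exponent_le (one_le_inv_iff₀.mpr ⟨hu, h⟩) (x := u⁻¹)
        (show e * k ≤ 1 by linarith)
      rwa [Real.rpow_one] at this
    calc u * |Real.log u| ^ k ≤ u * (((k : ℝ) + 1) ^ k * u⁻¹) := by gcongr; exact h3.trans (by gcongr)
      _ = ((k : ℝ) + 1) ^ k := by field_simp
      _ ≤ _ := le_mul_of_one_le_right (by positivity) (by nlinarith [sq_nonneg u])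
  · have h1 := Real.log_le_rpow_div hu.le he0
    rw [hdiv] at h1
    have h2 : |Real.log u| ≤ ((k : ℝ) + 1) * u ^ e := by
      rw [abs_of_nonneg (Real.log_nonneg h)]; exact h1
    have h3 := pow_le_pow_left₀ (abs_nonneg _) h2 k
    rw [mul_pow] at h3
    have h4 : (u ^ e) ^ k ≤ u := by
      rw [← Real.rpow_natCast, ← Real.rpow_mul hu.le]
      have := Real.rpow_le_rpow_of_exponent_le h (show e * k ≤ 1 by linarith)
      rwa [Real.rpow_one] at this
    calc u * |Real.log u| ^ k ≤ u * (((k : ℝ) + 1) ^ k * u) := by gcongr; exact h3.trans (by gcongr)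
      _ = ((k : ℝ) + 1) ^ k * u ^ 2 := by ring
      _ ≤ _ := by gcongr; linarith

/-- The mean value inequality, since the derivative is a combination of terms `u log^k u`. For `p =
0` the truncated exponent `p - 1` is harmless, its term carrying the factor `p`. -/
theorem exists_sq_mul_log_pow_lipschitz (p : ℕ) : ∃ C : ℝ, 1 ≤ C ∧ ∀ u v : ℝ, 0 < u → 0 < v →
    |u ^ 2 * Real.log u ^ p - v ^ 2 * Real.log v ^ p| ≤ C * |u - v| * (1 + u ^ 2 + v ^ 2) := by
  set A : ℝ := 2 * ((p : ℝ) + 1) ^ p + p * (((p - 1 : ℕ) : ℝ) + 1) ^ (p - 1) with hA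
  have hA0 : 0 ≤ A := by positivity
  refine ⟨A + 1, by linarith, ?_⟩
  have key : ∀ u v : ℝ, 0 < u → u ≤ v →
      |v ^ 2 * Real.log v ^ p - u ^ 2 * Real.log u ^ p| ≤ A * (1 + v ^ 2) * |v - u| := by
    intro u v hu huv
    have hder : ∀ x ∈ Set.Icc u v, HasDerivWithinAt (fun x => x ^ 2 * Real.log x ^ p)
        (2 * x * Real.log x ^ p + x ^ 2 * (p * Real.log x ^ (p - 1) * x⁻¹)) (Set.Icc u v) x := by
      intro x hx
      have hx0 : x ≠ 0 := (hu.trans_le hx.1).ne'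
      have h1 := (hasDerivAt_pow 2 x).fun_mul ((Real.hasDerivAt_log hx0).fun_pow p)
      refine HasDerivAt.hasDerivWithinAt ?_
      simpa using h1
    have hb : ∀ x ∈ Set.Icc u v,
        ‖2 * x * Real.log x ^ p + x ^ 2 * (p * Real.log x ^ (p - 1) * x⁻¹)‖ ≤ A * (1 + v ^ 2) := by
      intro x hx
      have hx0 : 0 < x := hu.trans_le hx.1
      have e : x ^ 2 * (p * Real.log x ^ (p - 1) * x⁻¹) = p * (x * Real.log x ^ (p - 1)) := by
        field_simp
      rw [e, Real.norm_eq_abs]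
      refine (abs_add_le _ _).trans ?_
      have h1 := mul_abs_log_pow_le p hx0
      have h2 := mul_abs_log_pow_le (p - 1) hx0
      have h3 : |2 * x * Real.log x ^ p| = 2 * (x * |Real.log x| ^ p) := by
        rw [abs_mul, abs_mul, abs_of_pos hx0, abs_pow]; norm_num; ring
      have h4 : |(p : ℝ) * (x * Real.log x ^ (p - 1))| = p * (x * |Real.log x| ^ (p - 1)) := by
        rw [abs_mul, abs_mul, abs_of_pos hx0, abs_pow, Nat.abs_cast]
      rw [h3, h4]
      have h5 : 1 + x ^ 2 ≤ 1 + v ^ 2 := by nlinarith [hx.2]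
      calc 2 * (x * |Real.log x| ^ p) + p * (x * |Real.log x| ^ (p - 1))
          ≤ 2 * (((p : ℝ) + 1) ^ p * (1 + x ^ 2)) +
            p * ((((p - 1 : ℕ) : ℝ) + 1) ^ (p - 1) * (1 + x ^ 2)) := by gcongr
        _ = A * (1 + x ^ 2) := by rw [hA]; ring
        _ ≤ A * (1 + v ^ 2) := by gcongr
    have := Convex.norm_image_sub_le_of_norm_hasDerivWithin_le hder hb (convex_Icc u v)
      (Set.left_mem_Icc.mpr huv) (Set.right_mem_Icc.mpr huv)
    simpa [Real.norm_eq_abs] using this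
  intro u v hu hv
  rcases le_total u v with h | h
  · rw [abs_sub_comm, abs_sub_comm u v]
    refine (key u v hu h).trans ?_
    have h1 : A * (1 + v ^ 2) ≤ (A + 1) * (1 + u ^ 2 + v ^ 2) :=
      mul_le_mul (by linarith) (by linarith [sq_nonneg u]) (by positivity) (by linarith)
    calc A * (1 + v ^ 2) * |v - u| ≤ (A + 1) * (1 + u ^ 2 + v ^ 2) * |v - u| := by gcongr
      _ = _ := by ring
  · refine (key v u hv h).trans ?_
    have h1 : A * (1 + u ^ 2) ≤ (A + 1) * (1 + u ^ 2 + v ^ 2) :=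
      mul_le_mul (by linarith) (by linarith [sq_nonneg v]) (by positivity) (by linarith)
    calc A * (1 + u ^ 2) * |u - v| ≤ (A + 1) * (1 + u ^ 2 + v ^ 2) * |u - v| := by gcongr
      _ = _ := by ring

/-- A derivative with standard deviation `μ` yields `μ² |z|² log^p(μ|z|)`. One power of `μ` stays
here and absorbs the powers of `log μ`, which makes the constant uniform as `μ` tends to 0; the
other is reserved for the Gram determinant. -/
theorem exists_tameFunction_deriv (p : ℕ) (B : ℝ) (hB : 1 ≤ B) : ∃ K : ℝ, 1 ≤ K ∧
    ∀ s μ : ℝ, 0 < s → s ≤ 1 → 0 < μ → μ ≤ B →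
      TameFunction s K (fun z => μ * (Real.log (μ * ‖z‖) ^ p * ‖z‖ ^ 2)) := by
  obtain ⟨C, hC, hlip⟩ := exists_sq_mul_log_pow_lipschitz p
  set D : ℝ := ((p : ℝ) + 1) ^ p with hD
  have hD0 : 0 < D := by positivity
  refine ⟨18 * C * B ^ 2 + 4 * D * B ^ 2, ?_, ?_⟩
  · have : 1 ≤ B ^ 2 := one_le_pow₀ hB
    have : 0 < 4 * D * B ^ 2 := by positivity
    nlinarith
  intro s μ hs hs1 hμ hμB
  have hB2 : 1 ≤ B ^ 2 := one_le_pow₀ hB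
  have hμ2 : μ ^ 2 ≤ B ^ 2 := pow_le_pow_left₀ hμ.le hμB 2
  refine ⟨?_, fun z hz => ?_, fun z z' hz hz' => ?_⟩
  · exact (((Real.measurable_log.comp (measurable_norm.const_mul μ)).pow_const p).mul
      (measurable_norm.pow_const 2)).const_mul μ
  · have hr : 0 < ‖z‖ := norm_pos_iff.mpr hz
    set r := ‖z‖ with hrdef
    have h1 := mul_abs_log_pow_le p (mul_pos hμ hr)
    have h2 := one_le_majorant hs hr
    have h3 : r ^ 3 ≤ majorant s r := by
      have := Real.rpow_nonneg hr.le (-s); unfold majorant; linarith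
    rw [abs_mul, abs_mul, abs_of_pos hμ, abs_pow, abs_of_pos (by positivity : 0 < r ^ 2)]
    have h4 : 1 + (μ * r) ^ 2 ≤ B ^ 2 * (1 + r ^ 2) := by
      rw [mul_pow]
      have : μ ^ 2 * r ^ 2 ≤ B ^ 2 * r ^ 2 := by gcongr
      linarith
    have h5 : r * (1 + r ^ 2) ≤ 1 + 2 * r ^ 3 := by nlinarith [sq_nonneg (r - 1), mul_nonneg hr.le (sq_nonneg (r-1))]
    calc μ * (|Real.log (μ * r)| ^ p * r ^ 2) = r * (μ * r * |Real.log (μ * r)| ^ p) := by ring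
      _ ≤ r * (D * (1 + (μ * r) ^ 2)) := by gcongr
      _ ≤ r * (D * (B ^ 2 * (1 + r ^ 2))) := by gcongr
      _ = D * B ^ 2 * (r * (1 + r ^ 2)) := by ring
      _ ≤ D * B ^ 2 * (1 + 2 * r ^ 3) := by gcongr
      _ ≤ D * B ^ 2 * (4 * majorant s r) := by gcongr; linarith
      _ ≤ _ := by
        have : 0 ≤ 18 * C * B ^ 2 * majorant s r := by positivity
        nlinarith
  · have hr : 0 < ‖z‖ := norm_pos_iff.mpr hz
    have hr' : 0 < ‖z'‖ := norm_pos_iff.mpr hz'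
    have hd : |‖z‖ - ‖z'‖| ≤ ‖z - z'‖ := abs_norm_sub_norm_le z z'
    set r := ‖z‖ with hrdef
    set r' := ‖z'‖ with hrdef'
    have h1 := hlip (μ * r) (μ * r') (mul_pos hμ hr) (mul_pos hμ hr')
    have e1 : μ * (μ * (Real.log (μ * r) ^ p * r ^ 2) - μ * (Real.log (μ * r') ^ p * r' ^ 2)) =
        (μ * r) ^ 2 * Real.log (μ * r) ^ p - (μ * r') ^ 2 * Real.log (μ * r') ^ p := by ring
    have e2 : |μ * r - μ * r'| = μ * |r - r'| := by rw [← mul_sub, abs_mul, abs_of_pos hμ]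
    rw [← e1, abs_mul, abs_of_pos hμ, e2] at h1
    set X := |μ * (Real.log (μ * r) ^ p * r ^ 2) - μ * (Real.log (μ * r') ^ p * r' ^ 2)| with hX
    have h2 : X ≤ C * |r - r'| * (1 + (μ * r) ^ 2 + (μ * r') ^ 2) := by
      have h3 : μ * X ≤ μ * (C * |r - r'| * (1 + (μ * r) ^ 2 + (μ * r') ^ 2)) := by linarith
      exact le_of_mul_le_mul_left h3 hμ
    have h4 : 1 + (μ * r) ^ 2 + (μ * r') ^ 2 ≤ B ^ 2 * (1 + r ^ 2 + r' ^ 2) := by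
      rw [mul_pow, mul_pow]
      have : μ ^ 2 * r ^ 2 ≤ B ^ 2 * r ^ 2 := by gcongr
      have : μ ^ 2 * r' ^ 2 ≤ B ^ 2 * r' ^ 2 := by gcongr
      linarith
    -- The Lipschitz bound becomes a Hölder bound at the cost of one degree of growth; with the
    -- quadratic factor this makes the growth cubic.
    have h5 : |r - r'| ≤ ‖z - z'‖ ^ s * (1 + r + r') := by
      rcases (abs_nonneg (r - r')).eq_or_lt with h0 | h0
      · rw [← h0]; positivity
      · have h6 : |r - r'| = |r - r'| ^ s * |r - r'| ^ (1 - s) := by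
          rw [← Real.rpow_add h0]; simp
        have h7 : |r - r'| ^ (1 - s) ≤ 1 + r + r' := by
          have h8 : |r - r'| ≤ 1 + r + r' := by
            rw [abs_le]; constructor <;> linarith
          have h9 : 1 ≤ 1 + r + r' := by linarith
          calc |r - r'| ^ (1 - s) ≤ (1 + r + r') ^ (1 - s) :=
                Real.rpow_le_rpow h0.le h8 (by linarith)
            _ ≤ (1 + r + r') ^ (1 : ℝ) := Real.rpow_le_rpow_of_exponent_le h9 (by linarith)
            _ = _ := Real.rpow_one _
        rw [h6]
        have h8 : |r - r'| ^ s ≤ ‖z - z'‖ ^ s := Real.rpow_le_rpow h0.le hd hs.le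
        have h9 : 0 ≤ ‖z - z'‖ ^ s := by positivity
        exact mul_le_mul h8 h7 (by positivity) h9
    have hm := one_le_majorant hs hr
    have h3r : r ^ 3 ≤ majorant s r := by
      have := Real.rpow_nonneg hr.le (-s); unfold majorant; linarith
    have h3r' : r' ^ 3 ≤ majorant s r' := by
      have := Real.rpow_nonneg hr'.le (-s); unfold majorant; linarith
    have hm' := majorant_nonneg (s := s) hr'.le
    have h6 : (1 + r + r') * (1 + r ^ 2 + r' ^ 2) ≤ 9 * (1 + r ^ 3 + r' ^ 3) := by
      have a1 : ∀ x y : ℝ, 0 ≤ x → 0 ≤ y → x * y ^ 2 ≤ x ^ 3 + y ^ 3 := fun x y hx hy => by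
        nlinarith [mul_nonneg (add_nonneg hx hy) (sq_nonneg (x - y)), pow_nonneg hx 3, pow_nonneg hy 3, mul_nonneg hx (sq_nonneg (x - y)), mul_nonneg hy (sq_nonneg (x-y)), mul_nonneg hx (mul_nonneg hx hy)]
      have b1 := a1 1 r zero_le_one hr.le
      have b2 := a1 1 r' zero_le_one hr'.le
      have b3 := a1 r 1 hr.le zero_le_one
      have b4 := a1 r' 1 hr'.le zero_le_one
      have b5 := a1 r r' hr.le hr'.le
      have b6 := a1 r' r hr'.le hr.le
      have := pow_pos hr 3
      have := pow_pos hr' 3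
      nlinarith
    have hZ : 0 ≤ ‖z - z'‖ ^ s := by positivity
    calc X ≤ C * |r - r'| * (1 + (μ * r) ^ 2 + (μ * r') ^ 2) := h2
      _ ≤ C * (‖z - z'‖ ^ s * (1 + r + r')) * (B ^ 2 * (1 + r ^ 2 + r' ^ 2)) := by gcongr
      _ = C * B ^ 2 * ‖z - z'‖ ^ s * ((1 + r + r') * (1 + r ^ 2 + r' ^ 2)) := by ring
      _ ≤ C * B ^ 2 * ‖z - z'‖ ^ s * (18 * (majorant s r + majorant s r')) := by
        exact mul_le_mul_of_nonneg_left (by linarith) (by positivity)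
      _ = 18 * C * B ^ 2 * ‖z - z'‖ ^ s * (majorant s r + majorant s r') := by ring
      _ ≤ _ := by
        have h7 : 18 * C * B ^ 2 ≤ 18 * C * B ^ 2 + 4 * D * B ^ 2 := by
          have : 0 < 4 * D * B ^ 2 := by positivity
          linarith
        have h8 : 0 ≤ majorant s r + majorant s r' := by linarith
        gcongr

/-! ### Densities in terms of projected vectors -/

/-- The expectation of a product of logarithms and weighted derivatives over a subfamily of
Gaussian variables. -/
def momentOn {n : ℕ} {ι κ : Type} (p : κ → ℕ) (u : ι ⊕ κ → Coeff n) (I' : Finset ι)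
    (I : Finset κ) : ℝ :=
  ∫ a, (∏ t ∈ I', Real.log ‖(inner ℂ (u (Sum.inl t)) a : ℂ)‖) *
    ∏ j ∈ I, (Real.log ‖(inner ℂ (u (Sum.inr j)) a : ℂ)‖ ^ p j *
      ‖(inner ℂ (u (Sum.inr j)) a : ℂ)‖ ^ 2) ∂(coeffLaw n)

/-- The evaluation vectors at the points `w` and the derivative vectors at the points `z`. -/
def jetVec (n : ℕ) {ι κ : Type} (w : ι → ℂ) (z : κ → ℂ) : ι ⊕ κ → Coeff n :=
  Sum.elim (fun t => evalVec n (w t)) (fun j => derivVec n (z j))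

theorem density_eq_momentOn (n : ℕ) {ι κ : Type} [Fintype ι] [Fintype κ] [DecidableEq κ]
    (p : κ → ℕ) (w : ι → ℂ) (z : κ → ℂ) :
    density n p w z = (n : ℝ) ^ (Fintype.card ι + Fintype.card κ) *
      (momentOn p (fun i => (orthSpan (fun j => evalVec n (z j)) Finset.univ).starProjection
        (jetVec n w z i)) Finset.univ Finset.univ /
        gramDet (fun j => evalVec n (z j)) Finset.univ) := by
  rw [density_eq, condMoment_eq, vanishing_eq_orthSpan_univ]
  rfl

theorem subDensity_eq_momentOn (n : ℕ) {ι κ : Type} [DecidableEq κ] (p : κ → ℕ) (w : ι → ℂ)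
    (z : κ → ℂ) (I' : Finset ι) (I : Finset κ) :
    subDensity n p w z I' I = (n : ℝ) ^ (I'.card + I.card) *
      (momentOn p (fun i => (orthSpan (fun j => evalVec n (scaled n z j)) I).starProjection
        (jetVec n (scaled n w) (scaled n z) i)) I' I /
        gramDet (fun j => evalVec n (scaled n z j)) I) := by
  unfold subDensity density
  rw [condMoment_eq, vanishing_sub, det_covHat_sub, Fintype.card_coe, Fintype.card_coe]
  congr 2
  unfold momentOn
  refine integral_congr_ae (Filter.Eventually.of_forall fun a => ?_)
  simp only
  rw [← Finset.prod_coe_sort I', ← Finset.prod_coe_sort I]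
  rfl

theorem momentOn_congr {n : ℕ} {ι κ : Type} (p : κ → ℕ) {u u' : ι ⊕ κ → Coeff n} {I' : Finset ι}
    {I : Finset κ} (h : ∀ i ∈ I'.disjSum I, u i = u' i) :
    momentOn p u I' I = momentOn p u' I' I := by
  unfold momentOn
  refine integral_congr_ae (Filter.Eventually.of_forall fun a => ?_)
  simp only
  congr 1
  · exact Finset.prod_congr rfl fun t ht => by rw [h _ (Finset.inl_mem_disjSum.mpr ht)]
  · exact Finset.prod_congr rfl fun j hj => by rw [h _ (Finset.inr_mem_disjSum.mpr hj)]

theorem momentOn_eq_zero {n : ℕ} {ι κ : Type} (p : κ → ℕ) {u : ι ⊕ κ → Coeff n} {I' : Finset ι}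
    {I : Finset κ} {j : κ} (hj : j ∈ I) (h : u (Sum.inr j) = 0) : momentOn p u I' I = 0 := by
  unfold momentOn
  have : ∀ a : Coeff n, ∏ j ∈ I, (Real.log ‖(inner ℂ (u (Sum.inr j)) a : ℂ)‖ ^ p j *
      ‖(inner ℂ (u (Sum.inr j)) a : ℂ)‖ ^ 2) = 0 := fun a =>
    Finset.prod_eq_zero hj (by simp [h])
  simp only [this, mul_zero, integral_zero]

/-- The normalized factors: logarithms, and weighted derivatives. -/
def factor {ι κ : Type} (p : κ → ℕ) (r : ι ⊕ κ → ℝ) (L : ι → ℝ) : ι ⊕ κ → ℂ → ℝ :=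
  Sum.elim (fun t z => Real.log (r (Sum.inl t) * ‖z‖) / L t)
    (fun j z => r (Sum.inr j) * (Real.log (r (Sum.inr j) * ‖z‖) ^ p j * ‖z‖ ^ 2))

/-- Each logarithm releases its `L t`; each derivative releases only one of its two powers of `r`,
the other remaining in `factor`. -/
theorem momentOn_smul {n : ℕ} {ι κ : Type} (p : κ → ℕ) (r : ι ⊕ κ → ℝ) (L : ι → ℝ)
    (x : ι ⊕ κ → Coeff n) (I' : Finset ι) (I : Finset κ) (hr : ∀ i, 0 ≤ r i) (hL : ∀ t, L t ≠ 0) :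
    momentOn p (fun i => (r i : ℂ) • x i) I' I = ((∏ t ∈ I', L t) * ∏ j ∈ I, r (Sum.inr j)) *
      ∫ a, ∏ i ∈ I'.disjSum I, factor p r L i (inner ℂ (x i) a) ∂(coeffLaw n) := by
  unfold momentOn
  rw [← integral_const_mul]
  refine integral_congr_ae (Filter.Eventually.of_forall fun a => ?_)
  simp only
  have hn : ∀ i, ‖(inner ℂ ((r i : ℂ) • x i) a : ℂ)‖ = r i * ‖(inner ℂ (x i) a : ℂ)‖ := fun i => by
    rw [inner_smul_left, norm_mul, Complex.conj_ofReal, Complex.norm_real,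
      Real.norm_of_nonneg (hr i)]
  simp only [hn]
  rw [Finset.prod_disjSum, mul_mul_mul_comm, ← Finset.prod_mul_distrib, ← Finset.prod_mul_distrib]
  congr 1
  · refine Finset.prod_congr rfl fun t _ => ?_
    simp only [factor, Sum.elim_inl]
    rw [mul_div_cancel₀ _ (hL t)]
  · refine Finset.prod_congr rfl fun j _ => ?_
    simp only [factor, Sum.elim_inr]
    ring

/-! ### Distances -/

theorem groupDist_le {n : ℕ} {ι κ : Type} {w : ι → ℂ} {z : κ → ℂ} {I' J' : Finset ι}
    {I J : Finset κ} {i j : ι ⊕ κ} (hi : i ∈ I'.disjSum I) (hj : j ∈ J'.disjSum J) :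
    groupDist n w z I' J' I J / 2 ≤
      chord (Sum.elim (scaled n w) (scaled n z) i) (Sum.elim (scaled n w) (scaled n z) j) := by
  have key : ∀ (x : I' ⊕ I) (y : J' ⊕ J), groupDist n w z I' J' I J ≤
      2 * chord (Sum.elim (sub (scaled n w) I') (sub (scaled n z) I) x)
        (Sum.elim (sub (scaled n w) J') (sub (scaled n z) J) y) := fun x y => by
    rw [← sphDist_eq]
    exact ciInf_le (Set.finite_range _).bddBelow (x, y)
  have : groupDist n w z I' J' I J ≤ 2 *
      chord (Sum.elim (scaled n w) (scaled n z) i) (Sum.elim (scaled n w) (scaled n z) j) := by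
    rcases Finset.mem_disjSum.mp hi with ⟨t, ht, rfl⟩ | ⟨t, ht, rfl⟩ <;>
      rcases Finset.mem_disjSum.mp hj with ⟨u, hu, rfl⟩ | ⟨u, hu, rfl⟩
    · exact key (Sum.inl ⟨t, ht⟩) (Sum.inl ⟨u, hu⟩)
    · exact key (Sum.inl ⟨t, ht⟩) (Sum.inr ⟨u, hu⟩)
    · exact key (Sum.inr ⟨t, ht⟩) (Sum.inl ⟨u, hu⟩)
    · exact key (Sum.inr ⟨t, ht⟩) (Sum.inr ⟨u, hu⟩)
  linarith

/-- The logarithm of the conditional standard deviation of `f̂_n(w_t)` is bounded by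
`|log Δ'_t|`. -/
theorem abs_log_deltaPrime {n N : ℕ} (hN : 1 ≤ N) (hn : 1 ≤ n) {ι κ : Type} [Fintype κ]
    [Nonempty κ] {w : ι → ℂ} {z : κ → ℂ} {t : ι} (hw : ∀ j, scaled n w t ≠ scaled n z j)
    (I : Finset κ) {r : ℝ} (hr1 : r ≤ 1)
    (hr : ∏ i ∈ I, (trunc n (scaled n w t) (scaled n z i) / (2 * N)) ≤ r) :
    1 / 2 ≤ |Real.log (deltaPrime n w z t)| ∧
      0 < r ∧ |Real.log r| ≤ (2 * Real.log (8 * N) + 1) * |Real.log (deltaPrime n w z t)| := by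
  have hnR : (1 : ℝ) ≤ n := by exact_mod_cast hn
  have hNR : (1 : ℝ) ≤ N := by exact_mod_cast hN
  set m : κ → ℝ := fun j => min ((n : ℝ) * sphDist (scaled n w t) (scaled n z j) ^ 2) (1 / 2)
    with hm
  set τ : κ → ℝ := fun j => trunc n (scaled n w t) (scaled n z j) with hτ
  have hσ : ∀ j, 0 < chord (scaled n w t) (scaled n z j) := fun j => chord_pos (hw j)
  have hmpos : ∀ j, 0 < m j := fun j => by
    have := hσ j
    refine lt_min ?_ (by norm_num)
    rw [sphDist_eq]
    positivity
  have hmle : ∀ j, m j ≤ 1 / 2 := fun j => min_le_right _ _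
  have hτpos : ∀ j, 0 < τ j := fun j => trunc_pos hn (hw j)
  -- The 4 is the square of the ratio of the spherical distance to `chord`; the square of `τ j` may
  -- be dropped because `τ j ≤ 1`.
  have hτm : ∀ j, m j / 4 ≤ τ j := fun j => by
    have h1 : τ j ^ 2 ≤ τ j := by
      have : τ j ≤ 1 := trunc_le_one _ _ _
      nlinarith [hτpos j]
    refine le_trans ?_ h1
    rcases le_total 1 (Real.sqrt n * chord (scaled n w t) (scaled n z j)) with h | h
    · have : τ j = 1 := min_eq_left h
      rw [this]; linarith [hmle j]
    · have h2 : τ j = Real.sqrt n * chord (scaled n w t) (scaled n z j) := min_eq_right h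
      have h3 : m j ≤ (n : ℝ) * sphDist (scaled n w t) (scaled n z j) ^ 2 := min_le_left _ _
      rw [sphDist_eq] at h3
      rw [h2, mul_pow, Real.sq_sqrt (by linarith)]
      linarith
  have hlog2 : 1 / 2 ≤ Real.log 2 := by
    have := Real.log_two_gt_d9; linarith
  have hlogm : ∀ j, 1 / 2 ≤ -Real.log (m j) := fun j => by
    have h1 := Real.log_le_log (hmpos j) (hmle j)
    rw [one_div, Real.log_inv] at h1
    linarith
  have hL : |Real.log (deltaPrime n w z t)| = ∑ j, -Real.log (m j) := by
    have h1 : Real.log (deltaPrime n w z t) = ∑ j, Real.log (m j) :=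
      Real.log_prod fun j _ => (hmpos j).ne'
    rw [h1, Finset.sum_neg_distrib, abs_of_nonpos]
    exact Finset.sum_nonpos fun j _ => by linarith [hlogm j]
  have hPpos : 0 < ∏ i ∈ I, (τ i / (2 * N)) :=
    Finset.prod_pos fun i _ => div_pos (hτpos i) (by positivity)
  have hr0 : 0 < r := hPpos.trans_le hr
  refine ⟨?_, hr0, ?_⟩
  · rw [hL]
    obtain ⟨j⟩ := ‹Nonempty κ›
    exact (hlogm j).trans (Finset.single_le_sum (f := fun j => -Real.log (m j))
      (fun i _ => by linarith [hlogm i]) (Finset.mem_univ j))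
  · have hlog8 : 0 ≤ Real.log (8 * N) := Real.log_nonneg (by linarith)
    rw [abs_of_nonpos (Real.log_nonpos hr0.le hr1), hL, Finset.mul_sum]
    have h1 := Real.log_le_log hPpos hr
    rw [Real.log_prod fun i _ => (div_pos (hτpos i) (by positivity : (0 : ℝ) < 2 * N)).ne'] at h1
    -- The cutoff 1/2 in `Δ'` gives `-log (m j) ≥ 1/2`, so the additive constant `log (8N)` is
    -- absorbed multiplicatively.
    have h2 : ∀ j, -Real.log (τ j / (2 * N)) ≤ (2 * Real.log (8 * N) + 1) * -Real.log (m j) := by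
      intro j
      have h3 : m j / (8 * N) ≤ τ j / (2 * N) := by
        rw [div_le_div_iff₀ (by positivity) (by positivity)]
        nlinarith [hτm j]
      have h4 := Real.log_le_log (div_pos (hmpos j) (by positivity)) h3
      rw [Real.log_div (hmpos j).ne' (by positivity)] at h4
      nlinarith [hlogm j]
    calc -Real.log r ≤ ∑ i ∈ I, -Real.log (τ i / (2 * N)) := by
          rw [Finset.sum_neg_distrib]; linarith
      _ ≤ ∑ i ∈ I, (2 * Real.log (8 * N) + 1) * -Real.log (m i) :=
          Finset.sum_le_sum fun i _ => h2 i
      _ ≤ ∑ i, (2 * Real.log (8 * N) + 1) * -Real.log (m i) :=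
          Finset.sum_le_sum_of_subset_of_nonneg (Finset.subset_univ I) fun i _ _ =>
            mul_nonneg (by linarith) (by linarith [hlogm i])

/-- The comparison of quotients needed for the factorization. -/
theorem abs_div_sub_mul_div_le {E EA EB g gA gB r C ε η K M : ℝ} (hgA : 0 < gA) (hgB : 0 < gB)
    (hg : g ≤ gA * gB) (hglow : (1 - ε) * (gA * gB) ≤ g) (hε0 : 0 ≤ ε) (hε : ε ≤ 1 / 2)
    (hr0 : 0 ≤ r) (hr : r ≤ C * (gA * gB)) (hC : 0 ≤ C) (hE : |E - EA * EB| ≤ K * η)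
    (hM : |EA * EB| ≤ M) :
    |r * (E / g - EA * EB / (gA * gB))| ≤ C * (2 * (K * η) + 2 * ε * M) := by
  have hG : 0 < gA * gB := mul_pos hgA hgB
  have hg0 : 0 < g := lt_of_lt_of_le (mul_pos (by linarith) hG) hglow
  set q := gA * gB / g with hq
  have hq1 : 1 ≤ q := (one_le_div hg0).mpr hg
  have hq2 : q ≤ 1 + 2 * ε := by
    rw [hq, div_le_iff₀ hg0]
    have : (1 + 2 * ε) * ((1 - ε) * (gA * gB)) ≤ (1 + 2 * ε) * g :=
      mul_le_mul_of_nonneg_left hglow (by linarith)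
    have h2 : gA * gB ≤ (1 + 2 * ε) * ((1 - ε) * (gA * gB)) := by
      have : 1 ≤ (1 + 2 * ε) * (1 - ε) := by nlinarith
      nlinarith
    linarith
  have e : r * (E / g - EA * EB / (gA * gB)) =
      (r / (gA * gB)) * ((E - EA * EB) * q + EA * EB * (q - 1)) := by
    rw [hq]; field_simp; ring
  have hrG : r / (gA * gB) ≤ C := (div_le_iff₀ hG).mpr hr
  have hrG0 : 0 ≤ r / (gA * gB) := by positivity
  rw [e, abs_mul, abs_of_nonneg hrG0]
  refine mul_le_mul hrG ?_ (abs_nonneg _) hC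
  refine (abs_add_le _ _).trans ?_
  rw [abs_mul, abs_mul, abs_of_nonneg (by linarith : 0 ≤ q), abs_of_nonneg (by linarith : 0 ≤ q - 1)]
  have h1 : |E - EA * EB| * q ≤ K * η * 2 :=
    mul_le_mul hE (by linarith) (by linarith) ((abs_nonneg _).trans hE)
  have h2 : |EA * EB| * (q - 1) ≤ M * (2 * ε) :=
    mul_le_mul hM (by linarith) (by linarith) ((abs_nonneg _).trans hM)
  linarith

/-! ### Assembly of the two groups -/

theorem jetVec_mem_jetSpan {n : ℕ} {ι κ : Type} [DecidableEq ι] [DecidableEq κ] (w : ι → ℂ)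
    (z : κ → ℂ) {A : Finset (ι ⊕ κ)} {i : ι ⊕ κ} (hi : i ∈ A) :
    jetVec n w z i ∈ jetSpan n (A.image (Sum.elim w z)) := by
  refine Submodule.subset_span ?_
  rcases i with t | j
  · exact Or.inl ⟨w t, Finset.mem_coe.mpr (Finset.mem_image.mpr ⟨_, hi, rfl⟩), rfl⟩
  · exact Or.inr ⟨z j, Finset.mem_coe.mpr (Finset.mem_image.mpr ⟨_, hi, rfl⟩), rfl⟩

theorem evalVec_mem_jetSpan {n : ℕ} {ι κ : Type} [DecidableEq ι] [DecidableEq κ] (w : ι → ℂ)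
    (z : κ → ℂ) {I' : Finset ι} {I : Finset κ} {j : κ} (hj : j ∈ I) :
    evalVec n (z j) ∈ jetSpan n ((I'.disjSum I).image (Sum.elim w z)) := by
  refine Submodule.subset_span (Or.inl ⟨z j, Finset.mem_coe.mpr (Finset.mem_image.mpr
    ⟨Sum.inr j, Finset.inr_mem_disjSum.mpr hj, rfl⟩), rfl⟩)

theorem isCompl_disjSum {ι κ : Type} [Fintype ι] [Fintype κ] [DecidableEq ι] [DecidableEq κ]
    {I' J' : Finset ι} {I J : Finset κ} (h' : IsCompl I' J') (h : IsCompl I J) :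
    IsCompl (I'.disjSum I) (J'.disjSum J) := by
  have hu' : I' ∪ J' = Finset.univ := h'.sup_eq_top
  have hu : I ∪ J = Finset.univ := h.sup_eq_top
  constructor
  · rw [Finset.disjoint_left]
    rintro (t | j) h1 h2
    · exact Finset.disjoint_left.mp h'.disjoint (Finset.inl_mem_disjSum.mp h1)
        (Finset.inl_mem_disjSum.mp h2)
    · exact Finset.disjoint_left.mp h.disjoint (Finset.inr_mem_disjSum.mp h1)
        (Finset.inr_mem_disjSum.mp h2)
  · rw [codisjoint_iff_le_sup]
    rintro (t | j) -
    · have : t ∈ I' ∪ J' := by rw [hu']; exact Finset.mem_univ t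
      rcases Finset.mem_union.mp this with h | h
      · exact Finset.mem_union_left _ (Finset.inl_mem_disjSum.mpr h)
      · exact Finset.mem_union_right _ (Finset.inl_mem_disjSum.mpr h)
    · have : j ∈ I ∪ J := by rw [hu]; exact Finset.mem_univ j
      rcases Finset.mem_union.mp this with h | h
      · exact Finset.mem_union_left _ (Finset.inr_mem_disjSum.mpr h)
      · exact Finset.mem_union_right _ (Finset.inr_mem_disjSum.mpr h)

/-- Projecting a vector of one group to the orthogonal complement of all the conditions, rather
than of those of its group, hardly changes it. -/
theorem norm_sub_starProjection_le {n : ℕ} {κ : Type} [DecidableEq κ] (v : κ → Coeff n)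
    {A B : Submodule ℂ (Coeff n)} {ε : ℝ} (hε : 0 ≤ ε) (hε1 : ε ≤ 1 / 2)
    (h : ∀ g ∈ A, ∀ k ∈ B, ‖inner ℂ g k‖ ≤ ε * ‖g‖ * ‖k‖) {S T : Finset κ}
    (hS : ∀ i ∈ S, v i ∈ A) (hT : ∀ i ∈ T, v i ∈ B) {b : Coeff n} (hb : b ∈ A) :
    (orthSpan v S).starProjection b ∈ A ∧
      ‖(orthSpan v S).starProjection b - (orthSpan v (S ∪ T)).starProjection b‖ ≤
        2 * ε * ‖(orthSpan v S).starProjection b‖ := by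
  have hSA : Submodule.span ℂ (v '' S) ≤ A := by
    rw [Submodule.span_le]
    rintro _ ⟨i, hi, rfl⟩
    exact hS i hi
  have hTB : Submodule.span ℂ (v '' T) ≤ B := by
    rw [Submodule.span_le]
    rintro _ ⟨i, hi, rfl⟩
    exact hT i hi
  have hmem : (orthSpan v S).starProjection b ∈ A := by
    rw [orthSpan, Submodule.starProjection_orthogonal_val]
    exact A.sub_mem hb (hSA (Submodule.starProjection_apply_mem _ _))
  refine ⟨hmem, ?_⟩
  have hle : orthSpan v (S ∪ T) ≤ orthSpan v S := by
    rw [orthSpan_union, orthSpan]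
    exact Submodule.orthogonal_le le_sup_left
  rw [← starProjection_starProjection_of_le hle, orthSpan_union]
  exact norm_sub_starProjection_sup_le hε hε1 h hSA hTB hmem
    (Submodule.starProjection_apply_mem _ _)

theorem factor_tame {ι κ : Type} [Fintype κ] (p : κ → ℕ) {r : ι ⊕ κ → ℝ} {L : ι → ℝ}
    {s C B : ℝ} {K : κ → ℝ} (hs : 0 < s) (hs1 : s ≤ 1) (hC : 0 ≤ C) (hL : ∀ t, 1 / 2 ≤ L t)
    (hr : ∀ i, 0 < r i) (hrL : ∀ t, |Real.log (r (Sum.inl t))| ≤ C * L t)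
    (hrB : ∀ j, r (Sum.inr j) ≤ B) (hK1 : ∀ j, 1 ≤ K j)
    (hK : ∀ j, ∀ s μ : ℝ, 0 < s → s ≤ 1 → 0 < μ → μ ≤ B →
      TameFunction s (K j) (fun z => μ * (Real.log (μ * ‖z‖) ^ p j * ‖z‖ ^ 2))) (i : ι ⊕ κ) :
    TameFunction s (C + 4 / s + ∑ j, K j) (factor p r L i) := by
  have hsum : 0 ≤ ∑ j, K j := Finset.sum_nonneg fun j _ => by linarith [hK1 j]
  have hs4 : 0 < 4 / s := by positivity
  rcases i with t | j
  · exact (tameFunction_log hs hs1 hC (hL t) (hr _) (hrL t)).mono (by linarith)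
  · have h1 : K j ≤ ∑ j, K j :=
      Finset.single_le_sum (f := K) (fun i _ => by linarith [hK1 i]) (Finset.mem_univ j)
    exact (hK j s _ hs hs1 (hr _) (hrB j)).mono (by linarith)

/-- As `d ≤ 2`, separation by `D/√n` already excludes small `n`. In `D`, the term 64 gives the
threshold for `√n * (d / 2)`, `4N` serves `2N ≤ n`, `4/cA` makes the exponent at least `D`, and `8 N
CA` then bounds `CA * exp (-D) ≤ CA / D` by `1/(8N)`. -/
theorem sqrt_mul_bounds {n N : ℕ} (hn : 1 ≤ n) {D d CA cA : ℝ} (hN : 1 ≤ N) (hCA : 0 < CA)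
    (hcA : 0 < cA) (hD : D = 64 + 4 * N + 4 / cA + 8 * N * CA) (hd : D / Real.sqrt n ≤ d)
    (hd2 : d ≤ 2) :
    2 * N ≤ n ∧ 32 ≤ Real.sqrt n * (d / 2) ∧
      CA * Real.exp (-cA * n * (d / 2) ^ 2) ≤ 1 / (8 * N) := by
  have hnR : (1 : ℝ) ≤ n := by exact_mod_cast hn
  have hNR : (1 : ℝ) ≤ N := by exact_mod_cast hN
  have hs0 : 0 < Real.sqrt n := Real.sqrt_pos.mpr (by linarith)
  have hsn : Real.sqrt n ^ 2 = n := Real.sq_sqrt (by linarith)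
  have h4c : 0 < 4 / cA := by positivity
  have hNC : 0 < 8 * N * CA := by positivity
  have hD64 : 64 ≤ D := by rw [hD]; linarith
  have hDN : 4 * N ≤ D := by rw [hD]; linarith
  have hDc : 4 / cA ≤ D := by rw [hD]; linarith
  have hDC : 8 * N * CA ≤ D := by rw [hD]; linarith
  have hD0 : 0 < D := by linarith
  have h1 : D ≤ Real.sqrt n * d := by
    rw [div_le_iff₀ hs0] at hd; linarith
  have hd0 : 0 < d := lt_of_lt_of_le (by positivity) hd
  have h2 : D ^ 2 ≤ n * d ^ 2 := by
    have := pow_le_pow_left₀ hD0.le h1 2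
    rwa [mul_pow, hsn] at this
  refine ⟨?_, by linarith, ?_⟩
  · have h3 : (n : ℝ) * d ^ 2 ≤ n * 4 := by
      refine mul_le_mul_of_nonneg_left ?_ (by linarith)
      nlinarith
    have h4 : (2 * N : ℝ) ≤ n := by nlinarith
    exact_mod_cast h4
  · have h3 : D ≤ cA * n * (d / 2) ^ 2 := by
      rw [div_le_iff₀ hcA] at hDc
      have h4 : D * 4 ≤ cA * D ^ 2 := by nlinarith
      have h5 : cA * D ^ 2 ≤ cA * (n * d ^ 2) := mul_le_mul_of_nonneg_left h2 hcA.le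
      nlinarith
    have h4 : Real.exp (-cA * n * (d / 2) ^ 2) ≤ D⁻¹ := by
      have h5 : Real.exp (-cA * n * (d / 2) ^ 2) ≤ Real.exp (-D) :=
        Real.exp_le_exp.mpr (by linarith)
      refine h5.trans ?_
      rw [Real.exp_neg]
      exact inv_anti₀ hD0 (by have := Real.add_one_le_exp D; linarith)
    calc CA * Real.exp (-cA * n * (d / 2) ^ 2) ≤ CA * D⁻¹ := by gcongr
      _ ≤ 1 / (8 * N) := by
        rw [← div_eq_mul_inv, div_le_div_iff₀ hD0 (by positivity)]
        linarith

set_option maxHeartbeats 1000000 in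
-- The vectors `x₀` are conditioned on the zeros of their own group, `y₀` on all zeros; they differ
-- by a relative error `2ε`. After scaling both by `r i = ‖x₀ i‖`, decoupling compares the
-- expectations, and the determinants of the two groups pay for the extracted powers of `r`.
theorem exists_abs_density_sub_le (ℓ m : ℕ) (hm : 1 ≤ m) :
    ∃ D c : ℝ, 0 < D ∧ 0 < c ∧ ∀ p : Fin m → ℕ, ∃ C : ℝ, 0 < C ∧
      ∀ n : ℕ, 1 ≤ n →
      ∀ (w : Fin ℓ → ℂ) (z : Fin m → ℂ), Function.Injective (Sum.elim w z) →
      ∀ (I' J' : Finset (Fin ℓ)) (I J : Finset (Fin m)), IsCompl I' J' → IsCompl I J →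
        (I'.Nonempty ∨ I.Nonempty) → (J'.Nonempty ∨ J.Nonempty) →
        D / Real.sqrt n ≤ groupDist n w z I' J' I J →
        |density n p (scaled n w) (scaled n z)
            - subDensity n p w z I' I * subDensity n p w z J' J|
          ≤ C * (n : ℝ) ^ (ℓ + m) * (∏ t, |Real.log (deltaPrime n w z t)|)
              * Real.exp (-c * n * groupDist n w z I' J' I J ^ 2) := by
  obtain ⟨N, hNdef⟩ : ∃ N : ℕ, N = ℓ + m := ⟨_, rfl⟩
  have hN : 1 ≤ N := by omega
  have hNR : (1 : ℝ) ≤ N := by exact_mod_cast hN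
  obtain ⟨CA, cA, hCA, hcA, hOrth⟩ := exists_almost_orthogonal_jetSpan N hN
  obtain ⟨CG, hCG, hG⟩ := exists_prod_norm_derivVec_le N hN
  obtain ⟨s, hs⟩ : ∃ s : ℝ, s = 1 / (N + 1) := ⟨_, rfl⟩
  have hs0 : 0 < s := by rw [hs]; positivity
  have hs1 : s ≤ 1 := by rw [hs, div_le_one (by positivity)]; linarith
  obtain ⟨D, hD⟩ : ∃ D : ℝ, D = 64 + 4 * N + 4 / cA + 8 * N * CA := ⟨_, rfl⟩
  have hD0 : 0 < D := by rw [hD]; positivity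
  -- The 1/4 is there because `chord` is half of the spherical distance, and `s` because the error
  -- is `ε ^ s`. Both constants are fixed before `p`, which enters only through the tameness
  -- constants `K`.
  refine ⟨D, cA / 4 * s, hD0, by positivity, fun p => ?_⟩
  obtain ⟨B, hB⟩ : ∃ B : ℝ, B = 2 * Real.exp 2 * 2 ^ N := ⟨_, rfl⟩
  have hB1 : 1 ≤ B := by
    have h1 : 1 ≤ Real.exp 2 := Real.one_le_exp (by norm_num)
    have h2 : (1 : ℝ) ≤ 2 ^ N := one_le_pow₀ (by norm_num)
    rw [hB]; nlinarith
  choose K hK1 hK using fun j => exists_tameFunction_deriv (p j) B hB1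
  obtain ⟨CL, hCL⟩ : ∃ CL : ℝ, CL = 2 * Real.log (8 * N) + 1 := ⟨_, rfl⟩
  have hCL1 : 1 ≤ CL := by
    have : 0 ≤ Real.log (8 * N) := Real.log_nonneg (by linarith)
    rw [hCL]; linarith
  have hKsum : 0 ≤ ∑ j, K j := Finset.sum_nonneg fun j _ => by linarith [hK1 j]
  obtain ⟨Cd, hCd, hdec⟩ := exists_decoupling_bound N (CL + 4 / s + ∑ j, K j) (by
    have : 0 < 4 / s := by positivity
    linarith)
  rw [← hs] at hdec
  refine ⟨CG * CG * (Cd * (2 + 8 * N)) * CA ^ s, by positivity, ?_⟩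
  intro n hn w z hinj I' J' I J hI' hI hne hne' hd
  have hnR : (1 : ℝ) ≤ n := by exact_mod_cast hn
  have hsn0 : (Real.sqrt n : ℂ) ≠ 0 := by
    exact_mod_cast (Real.sqrt_pos.mpr (by linarith : (0 : ℝ) < n)).ne'
  obtain ⟨d, hddef⟩ : ∃ d, d = groupDist n w z I' J' I J := ⟨_, rfl⟩
  rw [← hddef] at hd ⊢
  set A := I'.disjSum I with hA
  set A' := J'.disjSum J with hA'
  have hAA : IsCompl A A' := isCompl_disjSum hI' hI
  have hsep : ∀ i ∈ A, ∀ j ∈ A', d / 2 ≤ chord (Sum.elim (scaled n w) (scaled n z) i)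
      (Sum.elim (scaled n w) (scaled n z) j) := fun i hi j hj => by
    rw [hddef]; exact groupDist_le hi hj
  have hd2 : d ≤ 2 := by
    have h1 : A.Nonempty := by
      rcases hne with ⟨t, ht⟩ | ⟨j, hj⟩
      · exact ⟨_, Finset.inl_mem_disjSum.mpr ht⟩
      · exact ⟨_, Finset.inr_mem_disjSum.mpr hj⟩
    have h2 : A'.Nonempty := by
      rcases hne' with ⟨t, ht⟩ | ⟨j, hj⟩
      · exact ⟨_, Finset.inl_mem_disjSum.mpr ht⟩
      · exact ⟨_, Finset.inr_mem_disjSum.mpr hj⟩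
    obtain ⟨i, hi⟩ := h1
    obtain ⟨j, hj⟩ := h2
    have := (hsep i hi j hj).trans (chord_le_one _ _)
    linarith
  obtain ⟨hnN, hsd, hεN⟩ := sqrt_mul_bounds hn hN hCA hcA hD hd hd2
  obtain ⟨ε, hε⟩ : ∃ ε, ε = CA * Real.exp (-cA * n * (d / 2) ^ 2) := ⟨_, rfl⟩
  rw [← hε] at hεN
  have hε0 : 0 < ε := by rw [hε]; positivity
  have hεN' : ε * (8 * N) ≤ 1 := (le_div_iff₀ (by positivity)).mp hεN
  have hε8 : ε ≤ 1 / 8 := by nlinarith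
  have hNn : N ≤ n := by omega
  set W := scaled n w with hW
  set Z := scaled n z with hZ
  have hptsinj : Function.Injective (Sum.elim W Z) := by
    have : Sum.elim W Z = (fun x : ℂ => x / (Real.sqrt n : ℂ)) ∘ Sum.elim w z := by
      ext i; rcases i with i | i <;> rfl
    rw [this]
    have hdiv : Function.Injective fun x : ℂ => x / (Real.sqrt n : ℂ) := fun a b hab =>
      (div_left_inj' hsn0).mp hab
    exact hdiv.comp hinj
  have hZinj : Function.Injective Z := hptsinj.comp Sum.inr_injective
  have hWZ : ∀ t j, W t ≠ Z j := fun t j h => by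
    have := hptsinj (show Sum.elim W Z (Sum.inl t) = Sum.elim W Z (Sum.inr j) from h)
    cases this
  have hcard : ∀ R : Finset (Fin ℓ ⊕ Fin m), (R.image (Sum.elim W Z)).card ≤ N := fun R => by
    refine Finset.card_image_le.trans ((Finset.card_le_univ R).trans ?_)
    simp [hNdef]
  have hcardI : ∀ R : Finset (Fin m), R.card ≤ N := fun R => by
    refine (Finset.card_le_univ R).trans ?_
    simp [hNdef]
  set V := jetSpan n (A.image (Sum.elim W Z)) with hV
  set V' := jetSpan n (A'.image (Sum.elim W Z)) with hV'
  have horth : ∀ g ∈ V, ∀ h ∈ V', ‖inner ℂ g h‖ ≤ ε * ‖g‖ * ‖h‖ := by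
    rw [hε]
    refine hOrth n _ _ (d / 2) hnN (hcard A) (hcard A') hsd ?_
    intro x hx y hy
    obtain ⟨i, hi, rfl⟩ := Finset.mem_image.mp hx
    obtain ⟨j, hj, rfl⟩ := Finset.mem_image.mp hy
    exact hsep i hi j hj
  have horth' : ∀ g ∈ V', ∀ h ∈ V, ‖inner ℂ g h‖ ≤ ε * ‖g‖ * ‖h‖ := fun g hg h hh => by
    rw [norm_inner_symm, mul_right_comm]; exact horth h hh g hg
  set b := jetVec n W Z with hb
  set φ : Fin m → Coeff n := fun j => evalVec n (Z j) with hφ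
  have hbV : ∀ i ∈ A, b i ∈ V := fun i hi => jetVec_mem_jetSpan W Z hi
  have hbV' : ∀ i ∈ A', b i ∈ V' := fun i hi => jetVec_mem_jetSpan W Z hi
  have hφV : ∀ j ∈ I, φ j ∈ V := fun j hj => evalVec_mem_jetSpan W Z hj
  have hφV' : ∀ j ∈ J, φ j ∈ V' := fun j hj => evalVec_mem_jetSpan W Z hj
  have hIJ : I ∪ J = Finset.univ := hI.sup_eq_top
  have hmemA' : ∀ i, i ∉ A → i ∈ A' := fun i hi => by
    have h1 : i ∈ A ∪ A' := by
      have : A ∪ A' = Finset.univ := hAA.sup_eq_top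
      rw [this]; exact Finset.mem_univ i
    exact (Finset.mem_union.mp h1).resolve_left hi
  have hnotA : ∀ i ∈ A', i ∉ A := fun i hi hi' => Finset.disjoint_left.mp hAA.disjoint hi' hi
  set x₀ : Fin ℓ ⊕ Fin m → Coeff n := fun i =>
    if i ∈ A then (orthSpan φ I).starProjection (b i) else (orthSpan φ J).starProjection (b i)
    with hx₀
  set y₀ : Fin ℓ ⊕ Fin m → Coeff n := fun i => (orthSpan φ Finset.univ).starProjection (b i)
    with hy₀
  have hx₀A : ∀ i ∈ A, x₀ i = (orthSpan φ I).starProjection (b i) := fun i hi => if_pos hi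
  have hx₀A' : ∀ i ∈ A', x₀ i = (orthSpan φ J).starProjection (b i) := fun i hi =>
    if_neg (hnotA i hi)
  have hε2 : ε ≤ 1 / 2 := by linarith
  have hxyA : ∀ i ∈ A, x₀ i ∈ V ∧ ‖x₀ i - y₀ i‖ ≤ 2 * ε * ‖x₀ i‖ := fun i hi => by
    rw [hx₀A i hi, hy₀, ← hIJ]
    exact norm_sub_starProjection_le φ hε0.le hε2 horth hφV hφV' (hbV i hi)
  have hxyA' : ∀ i ∈ A', x₀ i ∈ V' ∧ ‖x₀ i - y₀ i‖ ≤ 2 * ε * ‖x₀ i‖ := fun i hi => by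
    rw [hx₀A' i hi, hy₀, ← hIJ, Finset.union_comm]
    exact norm_sub_starProjection_le φ hε0.le hε2 horth' hφV' hφV (hbV' i hi)
  have hxy : ∀ i, ‖x₀ i - y₀ i‖ ≤ 2 * ε * ‖x₀ i‖ := fun i => by
    by_cases hi : i ∈ A
    · exact (hxyA i hi).2
    · exact (hxyA' i (hmemA' i hi)).2
  set r : Fin ℓ ⊕ Fin m → ℝ := fun i => ‖x₀ i‖ with hr
  have hpow : (n : ℝ) ^ (I'.card + I.card) * (n : ℝ) ^ (J'.card + J.card) = (n : ℝ) ^ (ℓ + m) := by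
    rw [← pow_add]
    congr 1
    have h1 : I'.card + J'.card = ℓ := by
      rw [← Finset.card_union_of_disjoint hI'.disjoint]
      have : I' ∪ J' = Finset.univ := hI'.sup_eq_top
      rw [this]; simp
    have h2 : I.card + J.card = m := by
      rw [← Finset.card_union_of_disjoint hI.disjoint, hIJ]; simp
    omega
  rw [density_eq_momentOn, subDensity_eq_momentOn, subDensity_eq_momentOn, Fintype.card_fin,
    Fintype.card_fin, ← hφ, ← hb]
  have hmI : momentOn p (fun i => (orthSpan φ I).starProjection (b i)) I' I =
      momentOn p x₀ I' I := momentOn_congr p fun i hi => (hx₀A i hi).symm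
  have hmJ : momentOn p (fun i => (orthSpan φ J).starProjection (b i)) J' J =
      momentOn p x₀ J' J := momentOn_congr p fun i hi => (hx₀A' i hi).symm
  rw [hmI, hmJ]
  have hfac : ∀ X Y Y' g g' g'' : ℝ, (n : ℝ) ^ (ℓ + m) * (X / g) -
      (n : ℝ) ^ (I'.card + I.card) * (Y / g') * ((n : ℝ) ^ (J'.card + J.card) * (Y' / g'')) =
      (n : ℝ) ^ (ℓ + m) * (X / g - Y / g' * (Y' / g'')) := fun X Y Y' g g' g'' => by
    rw [← hpow]; ring
  rw [hfac, abs_mul, abs_of_nonneg (by positivity : (0 : ℝ) ≤ (n : ℝ) ^ (ℓ + m))]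
  have hεs : ε ^ s = CA ^ s * Real.exp (-(cA / 4 * s) * n * d ^ 2) := by
    rw [hε, Real.mul_rpow hCA.le (Real.exp_pos _).le, ← Real.exp_mul]
    congr 2; ring
  suffices hmain : |momentOn p y₀ Finset.univ Finset.univ / gramDet φ Finset.univ -
      momentOn p x₀ I' I / gramDet φ I * (momentOn p x₀ J' J / gramDet φ J)| ≤
      CG * CG * (Cd * (2 + 8 * N)) * (∏ t, |Real.log (deltaPrime n w z t)|) * ε ^ s by
    calc _ ≤ (n : ℝ) ^ (ℓ + m) * (CG * CG * (Cd * (2 + 8 * N)) *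
          (∏ t, |Real.log (deltaPrime n w z t)|) * ε ^ s) := by gcongr
      _ = _ := by rw [hεs]; ring
  -- If a conditioned derivative vector is zero, so is its fully conditioned version, and both
  -- densities contain a factor 0; otherwise all vectors can be normalized.
  by_cases hzero : ∃ j, r (Sum.inr j) = 0
  · obtain ⟨j, hj⟩ := hzero
    have hx0 : x₀ (Sum.inr j) = 0 := norm_eq_zero.mp hj
    have hy0 : y₀ (Sum.inr j) = 0 := by
      have h1 := hxy (Sum.inr j)
      rw [hx0, norm_zero, mul_zero, zero_sub, norm_neg] at h1
      exact norm_le_zero_iff.mp h1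
    have h1 : momentOn p y₀ Finset.univ Finset.univ = 0 :=
      momentOn_eq_zero p (Finset.mem_univ j) hy0
    have h2 : momentOn p x₀ I' I / gramDet φ I * (momentOn p x₀ J' J / gramDet φ J) = 0 := by
      have : j ∈ I ∪ J := by rw [hIJ]; exact Finset.mem_univ j
      rcases Finset.mem_union.mp this with h | h
      · rw [momentOn_eq_zero p h hx0]; simp
      · rw [momentOn_eq_zero p h hx0]; simp
    rw [h1, h2, zero_div, sub_zero, abs_zero]
    positivity
  push Not at hzero
  have : Nonempty (Fin m) := ⟨⟨0, hm⟩⟩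
  set L : Fin ℓ → ℝ := fun t => |Real.log (deltaPrime n w z t)| with hL
  have hLr : ∀ t, 1 / 2 ≤ L t ∧ 0 < r (Sum.inl t) ∧
      |Real.log (r (Sum.inl t))| ≤ CL * L t := fun t => by
    have hle : ∀ R : Finset (Fin m), ‖(orthSpan φ R).starProjection (evalVec n (W t))‖ ≤ 1 :=
      fun R => (Submodule.norm_starProjection_apply_le _ _).trans (norm_evalVec n _).le
    rw [hCL]
    by_cases hi : Sum.inl t ∈ A
    · have hri : r (Sum.inl t) = ‖(orthSpan φ I).starProjection (evalVec n (W t))‖ := by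
        simp only [hr, hx₀A _ hi]; rfl
      rw [hri]
      exact abs_log_deltaPrime hN hn (hWZ t) I (hle I)
        (prod_trunc_le_norm_starProjection N hN hNn hZinj I (hcardI I) (W t))
    · have hri : r (Sum.inl t) = ‖(orthSpan φ J).starProjection (evalVec n (W t))‖ := by
        simp only [hr, hx₀A' _ (hmemA' _ hi)]; rfl
      rw [hri]
      exact abs_log_deltaPrime hN hn (hWZ t) J (hle J)
        (prod_trunc_le_norm_starProjection N hN hNn hZinj J (hcardI J) (W t))
  have hrpos : ∀ i, 0 < r i := fun i => by
    rcases i with t | j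
    · exact (hLr t).2.1
    · exact lt_of_le_of_ne (norm_nonneg _) (Ne.symm (hzero j))
  have hrI : ∀ j ∈ I, r (Sum.inr j) = ‖(orthSpan φ I).starProjection (derivVec n (Z j))‖ :=
    fun j hj => by
      simp only [hr, hx₀A _ (Finset.inr_mem_disjSum.mpr hj)]; rfl
  have hrJ : ∀ j ∈ J, r (Sum.inr j) = ‖(orthSpan φ J).starProjection (derivVec n (Z j))‖ :=
    fun j hj => by
      simp only [hr, hx₀A' _ (Finset.inr_mem_disjSum.mpr hj)]; rfl
  have hrB : ∀ j, r (Sum.inr j) ≤ B := fun j => by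
    have hbd : ∀ R : Finset (Fin m), j ∈ R →
        ‖(orthSpan φ R).starProjection (derivVec n (Z j))‖ ≤ B := fun R hR => by
      refine (norm_starProjection_derivVec_le hn hZinj hR).trans ?_
      rw [hB]
      have h1 : ∏ i ∈ R.erase j, (2 * trunc n (Z j) (Z i)) ≤ 2 ^ N := by
        refine (Finset.prod_le_prod (fun i _ => mul_nonneg zero_le_two (trunc_nonneg _ _ _))
          (fun i _ => (mul_le_of_le_one_right zero_le_two (trunc_le_one _ _ _)))).trans ?_
        rw [Finset.prod_const]
        exact pow_le_pow_right₀ (by norm_num) (hcardI _)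
      gcongr
    have : j ∈ I ∪ J := by rw [hIJ]; exact Finset.mem_univ j
    rcases Finset.mem_union.mp this with h | h
    · rw [hrI j h]; exact hbd I h
    · rw [hrJ j h]; exact hbd J h
  have htame : ∀ i, TameFunction s (CL + 4 / s + ∑ j, K j) (factor p r L i) :=
    factor_tame p hs0 hs1 (by linarith) (fun t => (hLr t).1) hrpos (fun t => (hLr t).2.2) hrB hK1 hK
  have hrc : ∀ i, (r i : ℂ) ≠ 0 := fun i => by exact_mod_cast (hrpos i).ne'
  set x : Fin ℓ ⊕ Fin m → Coeff n := fun i => ((r i : ℂ)⁻¹) • x₀ i with hx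
  set y : Fin ℓ ⊕ Fin m → Coeff n := fun i => ((r i : ℂ)⁻¹) • y₀ i with hy
  have hx₀x : x₀ = fun i => (r i : ℂ) • x i := by
    ext1 i; simp only [hx]; rw [smul_smul, mul_inv_cancel₀ (hrc i), one_smul]
  have hy₀y : y₀ = fun i => (r i : ℂ) • y i := by
    ext1 i; simp only [hy]; rw [smul_smul, mul_inv_cancel₀ (hrc i), one_smul]
  have hx1 : ∀ i, ‖x i‖ = 1 := fun i => by
    simp only [hx]
    rw [norm_smul, norm_inv, Complex.norm_real, Real.norm_of_nonneg (hrpos i).le]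
    exact inv_mul_cancel₀ (hrpos i).ne'
  have hxy1 : ∀ i, ‖x i - y i‖ ≤ 2 * ε := fun i => by
    simp only [hx, hy]
    rw [← smul_sub, norm_smul, norm_inv, Complex.norm_real, Real.norm_of_nonneg (hrpos i).le,
      inv_mul_le_iff₀ (hrpos i), mul_comm]
    exact hxy i
  obtain ⟨hdec1, hdec2⟩ := hdec n (Fin ℓ ⊕ Fin m) A A' (factor p r L) x y V V' ε hAA
    (by simp [hNdef]) hε0 hε8 horth htame hx1
    (fun i hi => V.smul_mem _ (hxyA i hi).1) (fun i hi => V'.smul_mem _ (hxyA' i hi).1) hxy1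
  have hLne : ∀ t, L t ≠ 0 := fun t => by linarith [(hLr t).1]
  have hr0 : ∀ i, 0 ≤ r i := fun i => (hrpos i).le
  have hMU := momentOn_smul p r L y Finset.univ Finset.univ hr0 hLne
  have hMI := momentOn_smul p r L x I' I hr0 hLne
  have hMJ := momentOn_smul p r L x J' J hr0 hLne
  rw [Finset.univ_disjSum_univ] at hMU
  rw [← hy₀y] at hMU
  rw [← hx₀x] at hMI hMJ
  rw [hMU, hMI, hMJ]
  set E := ∫ a, ∏ i, factor p r L i (inner ℂ (y i) a) ∂(coeffLaw n)
  set EA := ∫ a, ∏ i ∈ A, factor p r L i (inner ℂ (x i) a) ∂(coeffLaw n)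
  set EB := ∫ a, ∏ i ∈ A', factor p r L i (inner ℂ (x i) a) ∂(coeffLaw n)
  clear_value E EA EB
  have hgpos : ∀ R : Finset (Fin m), 0 < gramDet φ R := fun R => by
    refine lt_of_lt_of_le ?_ (prod_trunc_le_gramDet N hN hNn hZinj R (hcardI R))
    refine Finset.prod_pos fun j _ => Finset.prod_pos fun i hi => ?_
    exact div_pos (trunc_pos hn (fun h => (Finset.ne_of_mem_erase hi) (hZinj h).symm))
      (by positivity)
  obtain ⟨hg1, hg2⟩ := gramDet_union φ hε0.le hε2 horth I hφV J hφV' hI.disjoint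
  rw [hIJ] at hg1 hg2
  have hGG : 0 < gramDet φ I * gramDet φ J := mul_pos (hgpos I) (hgpos J)
  -- Bernoulli's inequality for the power `2 * J.card ≤ 2N` of `1 - 2ε`.
  have hg1' : (1 - 4 * N * ε) * (gramDet φ I * gramDet φ J) ≤ gramDet φ Finset.univ := by
    refine le_trans (mul_le_mul_of_nonneg_right ?_ hGG.le) hg1
    have h1 := one_add_mul_le_pow (a := -(2 * ε)) (by linarith) (2 * J.card)
    have h2 : (J.card : ℝ) ≤ N := by exact_mod_cast hcardI J
    have h3 : (1 : ℝ) + -(2 * ε) = 1 - 2 * ε := by ring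
    rw [h3] at h1
    refine le_trans ?_ h1
    push_cast
    nlinarith
  have hprodL : (∏ t ∈ I', L t) * ∏ t ∈ J', L t = ∏ t, L t := by
    rw [← Finset.prod_union hI'.disjoint]
    have : I' ∪ J' = Finset.univ := hI'.sup_eq_top
    rw [this]
  have hprodr : (∏ j ∈ I, r (Sum.inr j)) * ∏ j ∈ J, r (Sum.inr j) = ∏ j, r (Sum.inr j) := by
    rw [← Finset.prod_union hI.disjoint, hIJ]
  have hrle : ∏ j, r (Sum.inr j) ≤ CG * CG * (gramDet φ I * gramDet φ J) := by
    have h1 : ∏ j ∈ I, r (Sum.inr j) ≤ CG * gramDet φ I := by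
      rw [Finset.prod_congr rfl hrI]
      exact hG n (Fin m) Z I hNn hZinj (hcardI I)
    have h2 : ∏ j ∈ J, r (Sum.inr j) ≤ CG * gramDet φ J := by
      rw [Finset.prod_congr rfl hrJ]
      exact hG n (Fin m) Z J hNn hZinj (hcardI J)
    rw [← hprodr]
    calc _ ≤ CG * gramDet φ I * (CG * gramDet φ J) :=
          mul_le_mul h1 h2 (Finset.prod_nonneg fun j _ => hr0 _)
            (mul_nonneg hCG.le (hgpos I).le)
      _ = _ := by ring
  have h4 : 0 ≤ 4 * (N : ℝ) * ε := mul_nonneg (mul_nonneg (by norm_num) N.cast_nonneg) hε0.le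
  have hfin := abs_div_sub_mul_div_le (hgpos I) (hgpos J) hg2 hg1'
    h4 (by linarith) (Finset.prod_nonneg fun j _ => hr0 (Sum.inr j)) hrle
    (mul_nonneg hCG.le hCG.le) hdec1 hdec2
  have halg : (∏ t, L t) * (∏ j, r (Sum.inr j)) * E / gramDet φ Finset.univ -
      (∏ t ∈ I', L t) * (∏ j ∈ I, r (Sum.inr j)) * EA / gramDet φ I *
        ((∏ t ∈ J', L t) * (∏ j ∈ J, r (Sum.inr j)) * EB / gramDet φ J) =
      (∏ t, L t) * ((∏ j, r (Sum.inr j)) * (E / gramDet φ Finset.univ -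
        EA * EB / (gramDet φ I * gramDet φ J))) := by
    rw [← hprodL, ← hprodr]; ring
  have hLpos : 0 ≤ ∏ t, L t := Finset.prod_nonneg fun t _ => by linarith [(hLr t).1]
  rw [halg, abs_mul, abs_of_nonneg hLpos]
  have hεεs : ε ≤ ε ^ s := by
    have := Real.rpow_le_rpow_of_exponent_ge hε0 (by linarith) hs1
    rwa [Real.rpow_one] at this
  have hfin2 : CG * CG * (2 * (Cd * ε ^ s) + 2 * (4 * N * ε) * Cd) ≤
      CG * CG * (Cd * (2 + 8 * N)) * ε ^ s := by
    have h1 : 2 * (4 * N * ε) * Cd ≤ 2 * (4 * N * ε ^ s) * Cd := by gcongr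
    calc _ ≤ CG * CG * (2 * (Cd * ε ^ s) + 2 * (4 * N * ε ^ s) * Cd) := by gcongr
      _ = _ := by ring
  calc _ ≤ (∏ t, L t) * (CG * CG * (Cd * (2 + 8 * N)) * ε ^ s) :=
        mul_le_mul_of_nonneg_left (hfin.trans hfin2) hLpos
    _ = _ := by ring

end KacRice

end

theorem theorem2p7 (ℓ m : ℕ) (hm : 1 ≤ m) :
    ∃ D c : ℝ, 0 < D ∧ 0 < c ∧ ∀ p : Fin m → ℕ, ∃ C : ℝ, 0 < C ∧
      ∀ n : ℕ, 1 ≤ n →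
      ∀ (w : Fin ℓ → ℂ) (z : Fin m → ℂ), Function.Injective (Sum.elim w z) →
      ∀ (I' J' : Finset (Fin ℓ)) (I J : Finset (Fin m)), IsCompl I' J' → IsCompl I J →
        (I'.Nonempty ∨ I.Nonempty) → (J'.Nonempty ∨ J.Nonempty) →
        D / Real.sqrt n ≤ KacRice.groupDist n w z I' J' I J →
        |KacRice.density n p (KacRice.scaled n w) (KacRice.scaled n z)
            - KacRice.subDensity n p w z I' I * KacRice.subDensity n p w z J' J|
          ≤ C * (n : ℝ) ^ (ℓ + m) * (∏ t, |Real.log (KacRice.deltaPrime n w z t)|)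
              * Real.exp (-c * n * KacRice.groupDist n w z I' J' I J ^ 2) :=
  KacRice.exists_abs_density_sub_le ℓ m hm
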